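/- Identify $\mathbb R^2$ with $\mathbb C$ by $(x,\xi)\mapsto x+i\xi$, let $\lambda=\xi\,dx$, and let $e\colon\mathbb R\to S^1$, $e(t)=e^{it}$. A Jordan curve is a continuous injective map $c\colon S^1\to\mathbb R^2$; it is smooth if $c\circ e$ is $C^\infty$ with nowhere vanishing derivative, and rectifiable if it has finite length. The open domain $D$ bounded by $c$ is the set of points of $\mathbb R^2\setminus c(S^1)$ whose connected component in $\mathbb R^2\setminus c(S^1)$ is bounded. We say that a Jordan curve $c$ with $\operatorname{area}(D)=\pi$ satisfies the assumptions $(*)$ if there is a sequence $(c_n)_n$ of smooth Jordan curves such that (1) $c_n\to c$ uniformly on $S^1$; (2) the primitives $f_n$ of $(c_n\circ e)^*\lambda$ with $f_n(0)=0$ converge, uniformly on every compact subset of $\mathbb R$, to a continuous function $f\colon\mathbb R\to\mathbb R$. **Proposition.** Let $c$ be a rectifiable Jordan curve, $C=c(S^1)$, and suppose that the open domain $D$ bounded by $c$ has area $\pi$. Then: (a) There is a homeomorphism $\varphi$ from the closed unit disk onto $\overline D$ that maps the open unit disk biholomorphically onto $D$ and the unit circle onto $C$, such that the curves $c_n(z)=\varphi\bigl((1-\tfrac1n)z\bigr)$,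 $z\in S^1$, $n\ge 2$, are smooth Jordan curves that satisfy (1) and (2) for the parametrization $\varphi|_{S^1}$ of $C$. In particular $\varphi|_{S^1}$ satisfies $(*)$. (b) The given parametrization $c$ of $C$ satisfies $(*)$ as well. -/

import Mathlib

open Set Filter Topology MeasureTheory

namespace RectangularPeg

/-- A Jordan curve in the plane `ℝ² = ℂ`: a continuous injective map from the unit circle. -/
noncomputable def IsJordanCurve (c : Circle → ℂ) : Prop :=
  Continuous c ∧ Function.Injective c

/-- The curve as a `2π`-periodic function on `ℝ`, that is, `c ∘ e` with `e t = exp (i t)`. -/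
noncomputable def lift (c : Circle → ℂ) (t : ℝ) : ℂ :=
  c (Circle.exp t)

/-- A smooth Jordan curve: a smoothly embedded circle
(injective, of class `C^∞`, with nowhere vanishing velocity). -/
noncomputable def IsSmoothJordanCurve (c : Circle → ℂ) : Prop :=
  IsJordanCurve c ∧ ContDiff ℝ (⊤ : ℕ∞) (lift c) ∧ ∀ t : ℝ, deriv (lift c) t ≠ 0

/-- A curve is rectifiable if its length, the total variation over one period, is finite. -/
noncomputable def IsRectifiable (c : Circle → ℂ) : Prop :=
  eVariationOn (lift c) (Icc 0 (2 * Real.pi)) < ⊤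

/-- The open domain bounded by a curve: the points off the curve whose connected component in the
complement of the curve is bounded. -/
noncomputable def enclosedDomain (c : Circle → ℂ) : Set ℂ :=
  {z | z ∉ range c ∧ Bornology.IsBounded (connectedComponentIn (range c)ᶜ z)}

/-- `f` is the primitive, normalised by `f 0 = 0`, of the pullback `(c ∘ e)^* λ` of the Liouville
form `λ = ξ dx`, where `x = Re` and `ξ = Im` are the coordinates of the plane. -/
noncomputable def IsLiouvillePrimitive (c : Circle → ℂ) (f : ℝ → ℝ) : Prop :=
  f 0 = 0 ∧
    ∀ t : ℝ, HasDerivAt f ((lift c t).im * deriv (fun s : ℝ => (lift c s).re) t) t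

/-- The smooth Jordan curves `cs n` converge uniformly to `c`, and the primitives of
`(cs n ∘ e)^* λ` converge, uniformly on every compact subset of `ℝ`, to a continuous function. -/
noncomputable def IsSmoothApproximation (cs : ℕ → Circle → ℂ) (c : Circle → ℂ) : Prop :=
  (∀ n, IsSmoothJordanCurve (cs n)) ∧
  TendstoUniformly cs c atTop ∧
  ∃ (F : ℕ → ℝ → ℝ) (f : ℝ → ℝ),
    (∀ n, IsLiouvillePrimitive (cs n) (F n)) ∧
    Continuous f ∧
    ∀ K : Set ℝ, IsCompact K → TendstoUniformlyOn F f atTop K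

/-- The assumptions on the curve in the rectangular peg theorem. -/
noncomputable def SatisfiesPegAssumptions (c : Circle → ℂ) : Prop :=
  IsJordanCurve c ∧
  volume (enclosedDomain c) = ENNReal.ofReal Real.pi ∧
  ∃ cs : ℕ → Circle → ℂ, IsSmoothApproximation cs c

/-- `φ` restricts to a homeomorphism from the closed unit disk onto the closure of `D` (continuous
and bijective, hence a homeomorphism by compactness) that maps the open unit disk
biholomorphically onto `D`. Values of `φ` outside the closed disk are irrelevant. -/
noncomputable def IsExtendedRiemannMap (φ : ℂ → ℂ) (D : Set ℂ) : Prop :=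
  ContinuousOn φ (Metric.closedBall 0 1) ∧
  BijOn φ (Metric.closedBall 0 1) (closure D) ∧
  DifferentiableOn ℂ φ (Metric.ball 0 1) ∧
  BijOn φ (Metric.ball 0 1) D

/-- The restriction of `φ` to the circle of radius `r` about `0`, as a curve. -/
noncomputable def circleImage (φ : ℂ → ℂ) (r : ℝ) (z : Circle) : ℂ :=
  φ ((r : ℂ) * (z : ℂ))

end RectangularPeg

namespace RectangularPeg

/-! The map `φ` is a Riemann map of `D`, extended to the closed disk by Carathéodory's theorem. Its
concentric curves are smooth because an injective holomorphic map has nonvanishing derivative, and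
they converge uniformly because `φ` is uniformly continuous on the closed disk. The real point is
(2). Rectifiability depends only on the image of a Jordan curve, so the boundary values of `φ` have
finite variation, and the maximum principle bounds the variation along inner circles
(`exists_eVariationOn_circleImage_le`). Given a common length bound, integration by parts controls
the difference of two Liouville primitives by the uniform distance of the curves
(`abs_integral_liouville_sub_le`), so the primitives are uniformly Cauchy on compact sets.

For (b), `c` and the boundary values of `φ` have the same image, hence differ by a circle
homeomorphism, which lifts to a strictly monotone map of the line up to sign. Uniformly close
diffeomorphisms of degree one reparametrize the approximating curves. Primitives transform by
composition, so no bound on the derivatives of these diffeomorphisms is needed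
(`IsSmoothApproximation.exists_of_range_eq`).

The plane topology rests on continuous logarithms. Two points off a compact set `K` lie in one
component of `Kᶜ` exactly when `(z - p) / (z - q)` has a continuous logarithm on `K` (Eilenberg).
This gives Janiszewski's theorem, from which come the simple connectivity of `D` used for the
Riemann map and the crosscut arguments used for Carathéodory's theorem. That a bounded component
exists at all is read off from the area. -/

/-- `f` has a continuous logarithm on the set `K`. -/
def HasLogOn {X : Type*} [TopologicalSpace X] (f : X → ℂ) (K : Set X) : Prop :=
  ∃ g : X → ℂ, ContinuousOn g K ∧ ∀ x ∈ K, Complex.exp (g x) = f x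

/-! ### Continuous logarithms on subsets. -/

section HasLogOn

variable {X Y : Type*} [TopologicalSpace X] [TopologicalSpace Y] {f g : X → ℂ} {K L : Set X}

theorem HasLogOn.mono (h : HasLogOn f K) (hL : L ⊆ K) : HasLogOn f L := by
  obtain ⟨u, hu, hu'⟩ := h
  exact ⟨u, hu.mono hL, fun x hx => hu' x (hL hx)⟩

theorem HasLogOn.congr (h : HasLogOn f K) (hfg : ∀ x ∈ K, g x = f x) : HasLogOn g K := by
  obtain ⟨u, hu, hu'⟩ := h
  exact ⟨u, hu, fun x hx => (hu' x hx).trans (hfg x hx).symm⟩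

theorem HasLogOn.mul (hf : HasLogOn f K) (hg : HasLogOn g K) :
    HasLogOn (fun x => f x * g x) K := by
  obtain ⟨u, hu, hu'⟩ := hf
  obtain ⟨v, hv, hv'⟩ := hg
  exact ⟨fun x => u x + v x, hu.add hv, fun x hx => by rw [Complex.exp_add, hu' x hx, hv' x hx]⟩

theorem HasLogOn.inv (hf : HasLogOn f K) : HasLogOn (fun x => (f x)⁻¹) K := by
  obtain ⟨u, hu, hu'⟩ := hf
  exact ⟨fun x => -u x, hu.neg, fun x hx => by rw [Complex.exp_neg, hu' x hx]⟩

theorem HasLogOn.comp {f : Y → ℂ} {K : Set Y} (hf : HasLogOn f K) {φ : X → Y} {L : Set X}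
    (hφ : ContinuousOn φ L) (h : MapsTo φ L K) : HasLogOn (f ∘ φ) L := by
  obtain ⟨u, hu, hu'⟩ := hf
  exact ⟨u ∘ φ, hu.comp hφ h, fun x hx => hu' _ (h hx)⟩

theorem hasLogOn_of_mem_slitPlane (hf : ContinuousOn f K) (h : ∀ x ∈ K, f x ∈ Complex.slitPlane) :
    HasLogOn f K :=
  ⟨fun x => Complex.log (f x), hf.clog h, fun x hx =>
    Complex.exp_log (Complex.slitPlane_ne_zero (h x hx))⟩

theorem hasLogOn_const {a : ℂ} (ha : a ≠ 0) : HasLogOn (fun _ : X => a) K :=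
  ⟨fun _ => Complex.log a, continuousOn_const, fun _ _ => Complex.exp_log ha⟩

/-- Two continuous logarithms of the same function on a preconnected set differ by a constant. -/
theorem sub_eq_sub_of_exp_eq {g₁ g₂ : X → ℂ} (hK : IsPreconnected K) (h₁ : ContinuousOn g₁ K)
    (h₂ : ContinuousOn g₂ K) (h : ∀ x ∈ K, Complex.exp (g₁ x) = Complex.exp (g₂ x))
    {x y : X} (hx : x ∈ K) (hy : y ∈ K) : g₁ x - g₂ x = g₁ y - g₂ y := by
  have hd : IsDiscrete ((AddSubgroup.zmultiples (2 * Real.pi * Complex.I) : AddSubgroup ℂ) : Set ℂ) :=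
    ⟨NormedSpace.discreteTopology_zmultiples _⟩
  refine hK.constant_of_mapsTo hd (f := fun x => g₁ x - g₂ x) (h₁.sub h₂) (fun z hz => ?_) hx hy
  obtain ⟨n, hn⟩ := Complex.exp_eq_exp_iff_exists_int.1 (h z hz)
  refine AddSubgroup.mem_zmultiples_iff.2 ⟨n, ?_⟩
  simp [hn]

end HasLogOn

theorem hasLogOn_univ_of_contractible {X : Type*} [TopologicalSpace X] [ContractibleSpace X]
    [LocallyPathConnectedSpace X] {f : X → ℂ} (hf : Continuous f) (h0 : ∀ x, f x ≠ 0) :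
    HasLogOn f univ := by
  have : ContractibleSpace (univ : Set X) := (Homeomorph.Set.univ X).contractibleSpace
  have hs : IsSimplyConnected (univ : Set X) :=
    inferInstanceAs (SimplyConnectedSpace (univ : Set X))
  obtain ⟨g, hg, hg'⟩ := Complex.exists_continuousOn_eqOn_exp_comp hs isOpen_univ hf.continuousOn
    (by simpa using h0)
  exact ⟨g, hg, fun x hx => hg' hx⟩

theorem exists_continuous_log_real {f : ℝ → ℂ} (hf : Continuous f) (h0 : ∀ x, f x ≠ 0) :
    ∃ g : ℝ → ℂ, Continuous g ∧ ∀ x, Complex.exp (g x) = f x := by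
  obtain ⟨g, hg, hg'⟩ := hasLogOn_univ_of_contractible hf h0
  exact ⟨g, continuousOn_univ.1 hg, fun x => hg' x trivial⟩

/-! ### Separation in the plane: the theorems of Eilenberg and Janiszewski. -/

/-- The exterior of a disk is connected. -/
theorem isPreconnected_norm_gt (R : ℝ) (hR : 0 < R) : IsPreconnected {z : ℂ | R < ‖z‖} := by
  have h : {z : ℂ | R < ‖z‖} = Complex.exp '' {z : ℂ | Real.log R < z.re} := by
    ext z
    constructor
    · intro hz
      have h0 : z ≠ 0 := norm_pos_iff.1 (hR.trans hz)
      refine ⟨Complex.log z, ?_, Complex.exp_log h0⟩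
      simpa [Complex.log_re] using Real.log_lt_log hR hz
    · rintro ⟨w, hw, rfl⟩
      simpa [Complex.norm_exp, Real.log_lt_iff_lt_exp hR] using hw
  rw [h]
  exact (convex_halfSpace_re_gt _).isPreconnected.image _ Complex.continuous_exp.continuousOn

/-- Points in the same component of the complement of a closed set have the same winding there. -/
theorem hasLogOn_div_of_mem_connectedComponentIn {K : Set ℂ} (hK : IsClosed K) {p q : ℂ}
    (h : q ∈ connectedComponentIn Kᶜ p) : HasLogOn (fun z => (z - p) / (z - q)) K := by
  have hpK : p ∈ Kᶜ := connectedComponentIn_nonempty_iff.1 ⟨q, h⟩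
  -- The relation is symmetric and transitive, so on a connected set it suffices that it holds
  -- between nearby points; there the quotient is within distance `1` of `1`.
  refine (isPreconnected_connectedComponentIn (F := Kᶜ) (x := p)).induction₂
    (fun a b => HasLogOn (fun z => (z - a) / (z - b)) K) ?_ ?_ ?_ (mem_connectedComponentIn hpK) h
  · intro a ha
    have haK : a ∈ Kᶜ := connectedComponentIn_subset _ _ ha
    obtain ⟨r, hr, hball⟩ := Metric.isOpen_iff.1 hK.isOpen_compl a haK
    filter_upwards [mem_nhdsWithin_of_mem_nhds (Metric.ball_mem_nhds a (half_pos hr))] with b hb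
    have hne : ∀ z ∈ K, r ≤ ‖z - a‖ := fun z hz => by
      by_contra hlt
      exact hball (by simpa [dist_eq_norm] using not_le.1 hlt) hz
    rw [Metric.mem_ball, dist_eq_norm] at hb
    have hne' : ∀ z ∈ K, r / 2 < ‖z - b‖ := fun z hz => by
      have h1 := norm_sub_norm_le (z - a) (b - a)
      have h2 : z - a - (b - a) = z - b := by ring
      rw [h2] at h1
      linarith [hne z hz]
    have hz0 : ∀ z ∈ K, z - b ≠ 0 := fun z hz => norm_pos_iff.1 (by linarith [hne' z hz])
    refine hasLogOn_of_mem_slitPlane (by fun_prop (disch := assumption)) fun z hz => ?_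
    have h3 : (z - a) / (z - b) = 1 + (b - a) / (z - b) := by
      field_simp [hz0 z hz]; ring
    rw [h3]
    refine Complex.mem_slitPlane_of_norm_lt_one ?_
    rw [norm_div, div_lt_one (by linarith [hne' z hz])]
    linarith [hne' z hz]
  · intro a b d ha hb hd h1 h2
    refine (h1.mul h2).congr fun z hz => ?_
    have hbz : z - b ≠ 0 := sub_ne_zero.2 fun he =>
      connectedComponentIn_subset _ _ hb (he ▸ hz)
    field_simp
  · intro a b _ _ h1
    exact h1.inv.congr fun z _ => by simp

/-- A continuous nonvanishing function on the plane cannot agree with `(z - p) ^ n`, `n ≠ 0`, near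
infinity. -/
theorem eq_zero_of_eq_zpow_near_infinity {H : ℂ → ℂ} (hH : Continuous H) (h0 : ∀ z, H z ≠ 0)
    {p : ℂ} {n : ℤ} {R : ℝ} (hR : ∀ z, R < ‖z - p‖ → H z = (z - p) ^ n) : n = 0 := by
  obtain ⟨g, hg, hg'⟩ := hasLogOn_univ_of_contractible hH h0
  rw [continuousOn_univ] at hg
  -- Around the circle of radius `ρ`, a logarithm of `(z - p) ^ n` gains `2πi n`; but `g` is defined
  -- on the whole plane and returns to its value.
  set ρ : ℝ := max R 0 + 1 with hρ
  have hρ0 : 0 < ρ := by positivity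
  have hρR : R < ρ := lt_of_le_of_lt (le_max_left _ _) (lt_add_one _)
  have key : ∀ t : ℝ, Complex.exp (g (p + ρ * Complex.exp (t * Complex.I)))
      = Complex.exp (n * (Real.log ρ + t * Complex.I)) := by
    intro t
    rw [hg' _ trivial, hR]
    · have h1 : Complex.exp (Real.log ρ) = ρ := by
        rw [← Complex.ofReal_exp, Real.exp_log hρ0]
      rw [Complex.exp_int_mul, Complex.exp_add, h1]
      simp
    · simpa [abs_of_pos hρ0] using hρR
  have h := sub_eq_sub_of_exp_eq (K := univ) (g₁ := fun t : ℝ => g (p + ρ * Complex.exp (t * Complex.I)))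
    (g₂ := fun t : ℝ => n * (Real.log ρ + t * Complex.I)) isPreconnected_univ
    (by fun_prop) (by fun_prop) (fun t _ => key t) (mem_univ 0) (mem_univ (2 * Real.pi))
  simp only [Complex.ofReal_mul, Complex.ofReal_ofNat, Complex.exp_two_pi_mul_I, Complex.ofReal_zero,
    zero_mul, Complex.exp_zero] at h
  have h2 : (n : ℂ) * (2 * Real.pi * Complex.I) = 0 := by linear_combination h
  simpa using h2

/-- If `(z - p) ^ n * G z` has a logarithm on the boundary of a bounded neighbourhood `U` of `p`, in
which `G` does not vanish, then `n = 0`. -/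
theorem eq_zero_of_hasLogOn_zpow_mul {K U : Set ℂ} (hK : IsClosed K) (hU : IsOpen U)
    (hUb : Bornology.IsBounded U) (hUK : frontier U ⊆ K) {p : ℂ} (hp : p ∈ U) {G : ℂ → ℂ}
    (hG : ContinuousOn G (closure U)) (hG0 : ∀ z ∈ closure U, G z ≠ 0) {n : ℤ}
    (h : HasLogOn (fun z => (z - p) ^ n * G z) K) : n = 0 := by
  obtain ⟨g, hg, hg'⟩ := h
  -- Tietze's theorem extends the logarithm from `K` to the plane.
  obtain ⟨gt, hgt⟩ := ContinuousMap.exists_restrict_eq hK ⟨K.domRestrict g, hg.domRestrict⟩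
  have hgt' : ∀ z ∈ K, gt z = g z := fun z hz => congrArg (fun f : C(K, ℂ) => f ⟨z, hz⟩) hgt
  classical
  -- The two formulas agree on the frontier of `U`, so `H` is continuous and zero-free, and it
  -- equals `(z - p) ^ n` outside a disk.
  let H : ℂ → ℂ := fun z => if z ∈ U then Complex.exp (gt z) / G z else (z - p) ^ n
  have hpz : ∀ z, z ∉ U → z - p ≠ 0 := fun z hz => sub_ne_zero.2 fun he => hz (he ▸ hp)
  have hfr : ∀ z ∈ frontier U, Complex.exp (gt z) / G z = (z - p) ^ n := fun z hz => by
    have hzc := hG0 z (frontier_subset_closure hz)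
    rw [hgt' z (hUK hz), hg' z (hUK hz)]
    field_simp
  have hH : Continuous H := by
    refine continuous_if hfr ?_ ?_
    · exact (gt.continuous.cexp.continuousOn).div hG hG0
    · have hcl : closure {z | z ∉ U} = Uᶜ := hU.isClosed_compl.closure_eq
      rw [hcl]
      exact ContinuousOn.zpow₀ (by fun_prop) _ fun z hz => Or.inl (hpz z hz)
  have hH0 : ∀ z, H z ≠ 0 := fun z => by
    by_cases hz : z ∈ U
    · simp only [H, if_pos hz]
      exact div_ne_zero (Complex.exp_ne_zero _) (hG0 z (subset_closure hz))
    · simp only [H, if_neg hz]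
      exact zpow_ne_zero _ (hpz z hz)
  obtain ⟨R, hR⟩ := hUb.subset_closedBall p
  refine eq_zero_of_eq_zpow_near_infinity hH hH0 (p := p) (R := R) fun z hz => ?_
  have hzU : z ∉ U := fun hz' => by
    have := hR hz'
    rw [Metric.mem_closedBall, dist_eq_norm] at this
    linarith
  simp [H, hzU]

theorem frontier_connectedComponentIn_subset {K : Set ℂ} (hK : IsClosed K) (p : ℂ) :
    frontier (connectedComponentIn Kᶜ p) ⊆ K := by
  intro z hz
  by_contra hzK
  have hUo : IsOpen (connectedComponentIn Kᶜ z) := hK.isOpen_compl.connectedComponentIn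
  have hzz : z ∈ connectedComponentIn Kᶜ z := mem_connectedComponentIn hzK
  obtain ⟨w, hw, hw'⟩ := mem_closure_iff.1 (frontier_subset_closure hz) _ hUo hzz
  have h1 := connectedComponentIn_eq hw
  have h2 := connectedComponentIn_eq hw'
  have h3 : z ∈ connectedComponentIn Kᶜ p := by rw [h2, ← h1]; exact hzz
  have hpo : IsOpen (connectedComponentIn Kᶜ p) := hK.isOpen_compl.connectedComponentIn
  rw [hpo.frontier_eq] at hz
  exact hz.2 h3

theorem closure_connectedComponentIn_subset {K : Set ℂ} (hK : IsClosed K) (p : ℂ) :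
    closure (connectedComponentIn Kᶜ p) ⊆ connectedComponentIn Kᶜ p ∪ K := by
  rw [closure_eq_self_union_frontier]
  exact union_subset_union_right _ (frontier_connectedComponentIn_subset hK p)

/-- The complement of a compact set has at most one unbounded component. -/
theorem connectedComponentIn_eq_of_not_isBounded {K : Set ℂ} (hK : Bornology.IsBounded K) {p q : ℂ}
    (hp : ¬ Bornology.IsBounded (connectedComponentIn Kᶜ p))
    (hq : ¬ Bornology.IsBounded (connectedComponentIn Kᶜ q)) :
    connectedComponentIn Kᶜ p = connectedComponentIn Kᶜ q := by
  obtain ⟨R, hR0, hR⟩ := hK.subset_closedBall_lt 0 0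
  have hE := isPreconnected_norm_gt R hR0
  have hEK : {z : ℂ | R < ‖z‖} ⊆ Kᶜ := fun z hz hzK => by
    have := hR hzK
    rw [mem_closedBall_zero_iff] at this
    exact absurd hz (not_lt.2 this)
  have key : ∀ a, ¬ Bornology.IsBounded (connectedComponentIn Kᶜ a) →
      {z : ℂ | R < ‖z‖} ⊆ connectedComponentIn Kᶜ a := by
    intro a ha
    obtain ⟨z, hz, hzR⟩ : ∃ z ∈ connectedComponentIn Kᶜ a, R < ‖z‖ := by
      by_contra hcon
      push Not at hcon
      exact ha (Metric.isBounded_closedBall.subset fun z hz =>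
        mem_closedBall_zero_iff.2 (hcon z hz))
    rw [connectedComponentIn_eq hz]
    exact hE.subset_connectedComponentIn hzR hEK
  have hz : ((R + 1 : ℝ) : ℂ) ∈ {z : ℂ | R < ‖z‖} := by
    simp only [mem_ofPred_eq, Complex.norm_real, Real.norm_eq_abs]
    exact lt_of_lt_of_le (lt_add_one R) (le_abs_self _)
  rw [connectedComponentIn_eq (key p hp hz), connectedComponentIn_eq (key q hq hz)]

/-- Eilenberg's criterion. -/
theorem mem_connectedComponentIn_of_hasLogOn_div {K : Set ℂ} (hK : IsCompact K) {p q : ℂ}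
    (hp : p ∉ K) (hq : q ∉ K) (h : HasLogOn (fun z => (z - p) / (z - q)) K) :
    q ∈ connectedComponentIn Kᶜ p := by
  -- If the bounded component of `a` missed `b`, then `(z - b)⁻¹` would be zero-free on its closure
  -- and the exponent `1` of `z - a` would have to vanish.
  have main : ∀ a b, a ∉ K → b ∉ K → HasLogOn (fun z => (z - a) / (z - b)) K →
      Bornology.IsBounded (connectedComponentIn Kᶜ a) → b ∈ connectedComponentIn Kᶜ a := by
    intro a b ha hb hl hbd
    by_contra hba
    have hcl : ∀ z ∈ closure (connectedComponentIn Kᶜ a), z - b ≠ 0 := fun z hz => by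
      refine sub_ne_zero.2 fun he => ?_
      rcases closure_connectedComponentIn_subset hK.isClosed a hz with h' | h'
      · exact hba (he ▸ h')
      · exact hb (he ▸ h')
    have := eq_zero_of_hasLogOn_zpow_mul (n := 1) (G := fun z => (z - b)⁻¹) hK.isClosed
      hK.isClosed.isOpen_compl.connectedComponentIn hbd
      (frontier_connectedComponentIn_subset hK.isClosed a) (mem_connectedComponentIn ha)
      (ContinuousOn.inv₀ (by fun_prop) hcl) (fun z hz => inv_ne_zero (hcl z hz))
      (hl.congr fun z _ => by rw [zpow_one, div_eq_mul_inv])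
    exact one_ne_zero this
  by_cases hb : Bornology.IsBounded (connectedComponentIn Kᶜ p)
  · exact main p q hp hq h hb
  by_cases hb' : Bornology.IsBounded (connectedComponentIn Kᶜ q)
  · have := main q p hq hp (h.inv.congr fun z _ => by simp) hb'
    rw [← connectedComponentIn_eq this]
    exact mem_connectedComponentIn hq
  · rw [connectedComponentIn_eq_of_not_isBounded hK.isBounded hb hb']
    exact mem_connectedComponentIn hq

/-- Janiszewski's theorem. -/
theorem mem_connectedComponentIn_compl_union {K L : Set ℂ} (hK : IsCompact K) (hL : IsCompact L)
    (hKL : IsPreconnected (K ∩ L)) {p q : ℂ} (h₁ : q ∈ connectedComponentIn Kᶜ p)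
    (h₂ : q ∈ connectedComponentIn Lᶜ p) : q ∈ connectedComponentIn (K ∪ L)ᶜ p := by
  have hpK : p ∉ K := connectedComponentIn_nonempty_iff.1 ⟨q, h₁⟩
  have hpL : p ∉ L := connectedComponentIn_nonempty_iff.1 ⟨q, h₂⟩
  have hqK : q ∉ K := connectedComponentIn_subset _ _ h₁
  have hqL : q ∉ L := connectedComponentIn_subset _ _ h₂
  refine mem_connectedComponentIn_of_hasLogOn_div (hK.union hL) (by simp [hpK, hpL])
    (by simp [hqK, hqL]) ?_
  obtain ⟨g₁, hg₁, hg₁'⟩ := hasLogOn_div_of_mem_connectedComponentIn hK.isClosed h₁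
  obtain ⟨g₂, hg₂, hg₂'⟩ := hasLogOn_div_of_mem_connectedComponentIn hL.isClosed h₂
  -- Connectedness of `K ∩ L` makes the two logarithms differ there by one constant `k`; shifting
  -- `g₂` by `k` lets them be glued.
  obtain ⟨k, hk, hk'⟩ : ∃ k : ℂ, Complex.exp k = 1 ∧ ∀ z ∈ K ∩ L, g₁ z = g₂ z + k := by
    rcases (K ∩ L).eq_empty_or_nonempty with he | ⟨w, hw⟩
    · exact ⟨0, Complex.exp_zero, by simp [he]⟩
    · refine ⟨g₁ w - g₂ w, ?_, fun z hz => ?_⟩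
      · rw [Complex.exp_sub, hg₁' w hw.1, hg₂' w hw.2, div_self]
        exact div_ne_zero (sub_ne_zero.2 fun he => hpK (he ▸ hw.1))
          (sub_ne_zero.2 fun he => hqK (he ▸ hw.1))
      · have := sub_eq_sub_of_exp_eq hKL (hg₁.mono inter_subset_left) (hg₂.mono inter_subset_right)
          (fun x hx => (hg₁' x hx.1).trans (hg₂' x hx.2).symm) hz hw
        linear_combination this
  classical
  refine ⟨fun z => if z ∈ K then g₁ z else g₂ z + k, ?_, fun z hz => ?_⟩
  · refine ContinuousOn.union_of_isClosed ?_ ?_ hK.isClosed hL.isClosed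
    · exact hg₁.congr fun z hz => by simp [hz]
    · refine (hg₂.add (continuousOn_const (c := k))).congr fun z hz => ?_
      by_cases hzK : z ∈ K
      · simp only [hzK, if_true]; exact hk' z ⟨hzK, hz⟩
      · simp [hzK]
  · by_cases hzK : z ∈ K
    · simp only [hzK, if_true]; exact hg₁' z hzK
    · simp only [hzK, if_false]
      rw [Complex.exp_add, hk, mul_one, hg₂' z (hz.resolve_left hzK)]

theorem HasLogOn.of_comp_isEmbedding {X : Type*} [TopologicalSpace X] {e : X → ℂ}
    (he : IsEmbedding e) {f : ℂ → ℂ} {S : Set X} (h : HasLogOn (f ∘ e) S) :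
    HasLogOn f (e '' S) := by
  obtain ⟨u, hu, hu'⟩ := h
  refine ⟨Function.extend e u 0, ?_, ?_⟩
  · rintro _ ⟨x, hx, rfl⟩
    rw [ContinuousWithinAt, ← he.map_nhdsWithin_eq, tendsto_map'_iff,
      Function.extend_comp he.injective, he.injective.extend_apply]
    exact hu x hx
  · rintro _ ⟨x, hx, rfl⟩
    rw [he.injective.extend_apply]
    exact hu' x hx

/-- An arc does not separate the plane: pulled back to the interval and extended constantly to the
line, every zero-free function has a logarithm, so Eilenberg's criterion applies. -/
theorem mem_connectedComponentIn_compl_arc {γ : ℝ → ℂ} {a b : ℝ} (hab : a ≤ b)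
    (hγ : ContinuousOn γ (Icc a b)) (hinj : InjOn γ (Icc a b)) {p q : ℂ} (hp : p ∉ γ '' Icc a b)
    (hq : q ∉ γ '' Icc a b) : q ∈ connectedComponentIn (γ '' Icc a b)ᶜ p := by
  refine mem_connectedComponentIn_of_hasLogOn_div (isCompact_Icc.image_of_continuousOn hγ) hp hq ?_
  let e : Icc a b → ℂ := fun t => γ t
  have hec : Continuous e := hγ.domRestrict
  have hei : Function.Injective e := fun s t hst => Subtype.ext (hinj s.2 t.2 hst)
  have hE := (hec.isClosedEmbedding hei).isEmbedding
  have himg : γ '' Icc a b = e '' univ := by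
    rw [image_univ]; ext z; simp [e]
  have hne : ∀ (r : ℂ), r ∉ γ '' Icc a b → ∀ t, e t - r ≠ 0 := fun r hr t =>
    sub_ne_zero.2 fun h => hr ⟨t, t.2, h⟩
  have hcont : Continuous fun t => e (projIcc a b hab t) := hec.comp continuous_projIcc
  obtain ⟨g, hg, hg'⟩ := exists_continuous_log_real
    (f := fun t => (e (projIcc a b hab t) - p) / (e (projIcc a b hab t) - q))
    (by
      refine Continuous.div (by fun_prop) (by fun_prop) fun t => hne q hq _)
    (fun t => div_ne_zero (hne p hp _) (hne q hq _))
  rw [himg]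
  refine HasLogOn.of_comp_isEmbedding hE ⟨fun t => g t, by fun_prop, fun t _ => ?_⟩
  rw [hg' t, projIcc_val]
  rfl

theorem isQuotientMap_circleExp : IsQuotientMap Circle.exp :=
  isLocalHomeomorph_circleExp.isOpenMap.isQuotientMap Circle.exp.continuous Circle.exp_surjective

theorem exists_circle_factor {E : Type*} [TopologicalSpace E] {G : ℝ → E} (hG : Continuous G)
    (hper : Function.Periodic G (2 * Real.pi)) :
    ∃ u : Circle → E, Continuous u ∧ ∀ t, u (Circle.exp t) = G t := by
  have h : ∀ t, G (Complex.arg (Circle.exp t)) = G t := fun t => by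
    obtain ⟨m, hm⟩ := Circle.exp_eq_exp.1 (Circle.exp_arg (Circle.exp t))
    rw [hm]
    exact hper.int_mul m t
  refine ⟨fun z => G (Complex.arg z), ?_, h⟩
  rw [isQuotientMap_circleExp.continuous_iff]
  exact hG.congr fun t => (h t).symm

/-- The integer `d` is the winding number about `0` of the closed curve `exp ∘ G`. -/
theorem exists_eq_add_mul_of_exp_periodic {G : ℝ → ℂ} (hG : Continuous G)
    (hper : ∀ t, Complex.exp (G (t + 2 * Real.pi)) = Complex.exp (G t)) :
    ∃ d : ℤ, ∀ t, G (t + 2 * Real.pi) = G t + d * (2 * Real.pi * Complex.I) := by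
  obtain ⟨d, hd⟩ := Complex.exp_eq_exp_iff_exists_int.1 (hper 0)
  refine ⟨d, fun t => ?_⟩
  have := sub_eq_sub_of_exp_eq (K := univ) (g₁ := fun t => G (t + 2 * Real.pi)) (g₂ := G)
    isPreconnected_univ (by fun_prop) (by fun_prop) (fun t _ => hper t) (mem_univ t) (mem_univ 0)
  linear_combination this + hd

/-! ### Components of the complement of a Jordan curve. -/

section Jordan

variable {c : Circle → ℂ}

theorem IsJordanCurve.isEmbedding (hc : IsJordanCurve c) : IsEmbedding c :=
  (hc.1.isClosedEmbedding hc.2).isEmbedding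

theorem IsJordanCurve.isCompact_range (hc : IsJordanCurve c) : IsCompact (range c) :=
  _root_.isCompact_range hc.1

/-- The complement of a Jordan curve has at most one bounded component. -/
theorem IsJordanCurve.mem_connectedComponentIn_of_isBounded (hc : IsJordanCurve c) {p₁ p₂ p₃ : ℂ}
    (h₁ : p₁ ∉ range c) (h₂ : p₂ ∉ range c) (h₃ : p₃ ∉ range c)
    (hb₁ : Bornology.IsBounded (connectedComponentIn (range c)ᶜ p₁))
    (hb₂ : Bornology.IsBounded (connectedComponentIn (range c)ᶜ p₂))
    (h₁₃ : p₃ ∉ connectedComponentIn (range c)ᶜ p₁)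
    (h₂₃ : p₃ ∉ connectedComponentIn (range c)ᶜ p₂) :
    p₂ ∈ connectedComponentIn (range c)ᶜ p₁ := by
  by_contra h₁₂
  have hK := hc.isCompact_range.isClosed
  have hne : ∀ p, p ∉ range c → ∀ z, c z - p ≠ 0 := fun p hp z =>
    sub_ne_zero.2 fun h => hp ⟨z, h⟩
  have hlog : ∀ p, p ∉ range c → ∃ G : ℝ → ℂ, Continuous G ∧
      (∀ t, Complex.exp (G t) = (c (Circle.exp t) - p) / (c (Circle.exp t) - p₃)) ∧
      ∃ d : ℤ, ∀ t, G (t + 2 * Real.pi) = G t + d * (2 * Real.pi * Complex.I) := by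
    intro p hp
    have hcc := hc.1
    obtain ⟨G, hG, hG'⟩ := exists_continuous_log_real
      (f := fun t => (c (Circle.exp t) - p) / (c (Circle.exp t) - p₃))
      (Continuous.div (by fun_prop) (by fun_prop) fun t => hne p₃ h₃ _)
      (fun t => div_ne_zero (hne p hp _) (hne p₃ h₃ _))
    exact ⟨G, hG, hG', exists_eq_add_mul_of_exp_periodic hG fun t => by
      rw [hG', hG', Circle.exp_add_two_pi]⟩
  obtain ⟨G₁, hG₁, hG₁', d₁, hd₁⟩ := hlog p₁ h₁
  obtain ⟨G₂, hG₂, hG₂', d₂, hd₂⟩ := hlog p₂ h₂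
  -- Two integers `d₁`, `d₂` always satisfy a nontrivial integral relation. The corresponding
  -- product of powers has winding number zero, hence a logarithm on the curve.
  obtain ⟨n₁, n₂, hn, hn0⟩ : ∃ n₁ n₂ : ℤ, n₁ * d₁ + n₂ * d₂ = 0 ∧ ¬ (n₁ = 0 ∧ n₂ = 0) := by
    by_cases h : d₁ = 0
    · exact ⟨1, 0, by simp [h], by simp⟩
    · exact ⟨d₂, -d₁, by ring, by simp [h]⟩
  obtain ⟨u, hu, hu'⟩ := exists_circle_factor (G := fun t => n₁ * G₁ t + n₂ * G₂ t) (by fun_prop)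
    (fun t => by
      have hn' : (n₁ : ℂ) * d₁ + n₂ * d₂ = 0 := by exact_mod_cast hn
      change n₁ * G₁ (t + 2 * Real.pi) + n₂ * G₂ (t + 2 * Real.pi) = _
      rw [hd₁, hd₂]
      linear_combination (2 * Real.pi * Complex.I) * hn')
  have hL : HasLogOn (fun z => ((z - p₁) / (z - p₃)) ^ n₁ * ((z - p₂) / (z - p₃)) ^ n₂) (range c) := by
    rw [← image_univ]
    refine HasLogOn.of_comp_isEmbedding hc.isEmbedding ⟨u, hu.continuousOn, fun z _ => ?_⟩
    obtain ⟨t, rfl⟩ := Circle.exp_surjective z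
    rw [hu', Complex.exp_add, Complex.exp_int_mul, Complex.exp_int_mul, hG₁', hG₂']
    rfl
  have hout : ∀ p q, q ∉ range c → q ∉ connectedComponentIn (range c)ᶜ p →
      ∀ z ∈ closure (connectedComponentIn (range c)ᶜ p), z - q ≠ 0 := by
    intro p q hq hpq z hz
    refine sub_ne_zero.2 fun he => ?_
    rcases closure_connectedComponentIn_subset hK p hz with h | h
    · exact hpq (he ▸ h)
    · exact hq (he ▸ h)
  have hrange : ∀ p, p ∉ range c → ∀ z ∈ range c, z - p ≠ 0 := fun p hp z hz =>
    sub_ne_zero.2 fun he => hp (he ▸ hz)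
  -- On the closure of the component of `p`, all factors other than `(z - p) ^ m` are zero-free, so
  -- `m = 0`. Applied at `p₁` and at `p₂` this contradicts the nontriviality of the relation.
  have key : ∀ (p q : ℂ) (m n : ℤ), p ∉ range c → q ∉ range c →
      Bornology.IsBounded (connectedComponentIn (range c)ᶜ p) →
      q ∉ connectedComponentIn (range c)ᶜ p → p₃ ∉ connectedComponentIn (range c)ᶜ p →
      HasLogOn (fun z => ((z - p) / (z - p₃)) ^ m * ((z - q) / (z - p₃)) ^ n) (range c) → m = 0 := by
    intro p q m n hp hq hb hpq hp3 hlog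
    have hq0 := hout p q hq hpq
    have h30 := hout p p₃ h₃ hp3
    refine eq_zero_of_hasLogOn_zpow_mul (G := fun z => ((z - p₃) ^ m)⁻¹ * ((z - q) / (z - p₃)) ^ n)
      hK hK.isOpen_compl.connectedComponentIn hb
      (frontier_connectedComponentIn_subset hK p) (mem_connectedComponentIn hp) ?_ ?_ ?_
    · refine ContinuousOn.mul (ContinuousOn.inv₀ (ContinuousOn.zpow₀ (by fun_prop) _
        fun z hz => Or.inl (h30 z hz)) fun z hz => zpow_ne_zero _ (h30 z hz)) ?_
      exact ContinuousOn.zpow₀ (ContinuousOn.div (by fun_prop) (by fun_prop) h30) _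
        fun z hz => Or.inl (div_ne_zero (hq0 z hz) (h30 z hz))
    · intro z hz
      exact mul_ne_zero (inv_ne_zero (zpow_ne_zero _ (h30 z hz)))
        (zpow_ne_zero _ (div_ne_zero (hq0 z hz) (h30 z hz)))
    · refine hlog.congr fun z hz => ?_
      rw [div_zpow (z - p), div_eq_mul_inv ((z - p) ^ m), mul_assoc]
  refine hn0 ⟨key p₁ p₂ n₁ n₂ h₁ h₂ hb₁ h₁₂ h₁₃ hL, key p₂ p₁ n₂ n₁ h₂ h₁ hb₂ (fun h => h₁₂ ?_) h₂₃
    (hL.congr fun z _ => mul_comm _ _)⟩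
  rw [← connectedComponentIn_eq h]
  exact mem_connectedComponentIn h₂

theorem exists_not_isBounded_connectedComponentIn {K : Set ℂ} (hK : IsCompact K) :
    ∃ p, p ∉ K ∧ ¬ Bornology.IsBounded (connectedComponentIn Kᶜ p) := by
  obtain ⟨R, hR0, hR⟩ := hK.isBounded.subset_closedBall_lt 0 0
  have hE := isPreconnected_norm_gt R hR0
  have hEK : {z : ℂ | R < ‖z‖} ⊆ Kᶜ := fun z hz hzK => by
    have := hR hzK
    rw [mem_closedBall_zero_iff] at this
    exact absurd hz (not_lt.2 this)
  have hz : ∀ s : ℝ, R < s → (s : ℂ) ∈ {z : ℂ | R < ‖z‖} := fun s hs => by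
    simp only [mem_ofPred_eq, Complex.norm_real, Real.norm_eq_abs]
    exact lt_of_lt_of_le hs (le_abs_self _)
  refine ⟨((R + 1 : ℝ) : ℂ), hEK (hz _ (lt_add_one R)), fun hb => ?_⟩
  have hsub := hE.subset_connectedComponentIn (hz _ (lt_add_one R)) hEK
  obtain ⟨S, hS⟩ := (hb.subset hsub).subset_closedBall 0
  have := hS (hz (max R S + 1) (lt_of_le_of_lt (le_max_left _ _) (lt_add_one _)))
  rw [mem_closedBall_zero_iff, Complex.norm_real, Real.norm_eq_abs] at this
  linarith [le_abs_self (max R S + 1), le_max_right R S]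

/-- The inner domain of a Jordan curve is a single component of the complement. -/
theorem IsJordanCurve.enclosedDomain_eq (hc : IsJordanCurve c) {z₀ : ℂ}
    (h : z₀ ∈ enclosedDomain c) : enclosedDomain c = connectedComponentIn (range c)ᶜ z₀ := by
  ext z
  constructor
  · rintro ⟨hz, hzb⟩
    obtain ⟨p, hp, hpb⟩ := exists_not_isBounded_connectedComponentIn hc.isCompact_range
    refine hc.mem_connectedComponentIn_of_isBounded h.1 hz hp h.2 hzb (fun h' => hpb ?_)
      (fun h' => hpb ?_)
    · rw [← connectedComponentIn_eq h']; exact h.2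
    · rw [← connectedComponentIn_eq h']; exact hzb
  · intro hz
    refine ⟨connectedComponentIn_subset _ _ hz, ?_⟩
    rw [← connectedComponentIn_eq hz]
    exact h.2

theorem _root_.IsPreconnected.subset_of_disjoint_frontier {X : Type*} [TopologicalSpace X] {T U : Set X}
    (hT : IsPreconnected T) (hU : IsOpen U) (hTU : (T ∩ U).Nonempty)
    (hd : Disjoint T (frontier U)) : T ⊆ U := by
  refine hT.subset_left_of_subset_union (v := (closure U)ᶜ) hU isClosed_closure.isOpen_compl
    (disjoint_compl_right.mono_left subset_closure |>.symm.symm) (fun z hz => ?_) hTU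
  by_cases h : z ∈ U
  · exact Or.inl h
  · exact Or.inr fun h' => disjoint_left.1 hd hz (hU.frontier_eq ▸ ⟨h', h⟩)

/-- If a point of the curve were not in the frontier, neither would be a small arc around it, and
the frontier would lie in the complementary arc. An arc does not separate the plane, so `p` could be
joined to the unbounded component without crossing the frontier. -/
theorem IsJordanCurve.frontier_connectedComponentIn (hc : IsJordanCurve c) {p : ℂ} (hp : p ∉ range c)
    (hb : Bornology.IsBounded (connectedComponentIn (range c)ᶜ p)) :
    frontier (connectedComponentIn (range c)ᶜ p) = range c := by
  have hK := hc.isCompact_range.isClosed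
  set U := connectedComponentIn (range c)ᶜ p with hU
  have hUo : IsOpen U := hK.isOpen_compl.connectedComponentIn
  have hsub := frontier_connectedComponentIn_subset hK p
  refine subset_antisymm hsub ?_
  rintro _ ⟨w, rfl⟩
  by_contra hw
  obtain ⟨t₀, rfl⟩ := Circle.exp_surjective w
  have hcc : Continuous fun t : ℝ => c (Circle.exp t) := hc.1.comp Circle.exp.continuous
  have hopen : IsOpen ((fun t : ℝ => c (Circle.exp t)) ⁻¹' (frontier U)ᶜ) :=
    isClosed_frontier.isOpen_compl.preimage hcc
  obtain ⟨δ, hδ, hball⟩ := Metric.isOpen_iff.1 hopen t₀ hw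
  -- `η ≤ 1` keeps the complementary parameter interval `[a, b]` nonempty, and `η > 0` keeps it
  -- shorter than a period, where `Circle.exp` is injective.
  set η := min δ 1 with hη
  have hη0 : 0 < η := lt_min hδ one_pos
  have hη1 : η ≤ 1 := min_le_right _ _
  have hpi := Real.pi_gt_three
  set a := t₀ + η / 2 with ha
  set b := t₀ - η / 2 + 2 * Real.pi with hbdef
  have hJ : frontier U ⊆ (fun t : ℝ => c (Circle.exp t)) '' Icc a b := by
    intro z hz
    obtain ⟨w, rfl⟩ := hsub hz
    obtain ⟨s, rfl⟩ := Circle.exp_surjective w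
    obtain ⟨m, hm, -⟩ := existsUnique_add_zsmul_mem_Ico Real.two_pi_pos s (t₀ - η / 2)
    simp only [zsmul_eq_mul] at hm
    have he : Circle.exp (s + m * (2 * Real.pi)) = Circle.exp s := Circle.periodic_exp.int_mul m s
    rw [← he] at hz ⊢
    refine ⟨_, ⟨?_, hm.2.le⟩, rfl⟩
    by_contra hlt
    refine hball (a := s + m * (2 * Real.pi)) ?_ hz
    rw [Metric.mem_ball, Real.dist_eq, abs_lt]
    constructor <;> linarith [hm.1, min_le_left δ 1]
  have hJsub : (fun t : ℝ => c (Circle.exp t)) '' Icc a b ⊆ range c := by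
    rintro _ ⟨t, _, rfl⟩; exact mem_range_self _
  have hJc : IsCompact ((fun t : ℝ => c (Circle.exp t)) '' Icc a b) := isCompact_Icc.image hcc
  obtain ⟨q, hq, hqb⟩ := exists_not_isBounded_connectedComponentIn (hc.isCompact_range)
  have hqU : q ∉ U := fun h => hqb (by rw [← connectedComponentIn_eq h]; exact hb)
  have hmem := mem_connectedComponentIn_compl_arc (γ := fun t : ℝ => c (Circle.exp t)) (a := a) (b := b)
    (by linarith) hcc.continuousOn
    (fun s hs t ht hst => Circle.exp_injOn_Icc (by linarith) hs ht (hc.2 hst))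
    (fun h => hp (hJsub h)) (fun h => hq (hJsub h))
  refine hqU ((isPreconnected_connectedComponentIn).subset_of_disjoint_frontier hUo
    ⟨p, mem_connectedComponentIn (notMem_subset hJsub hp), mem_connectedComponentIn hp⟩ ?_ hmem)
  exact disjoint_left.2 fun z hz hz' => connectedComponentIn_subset _ _ hz (hJ hz')

end Jordan

/-! ### The inner domain and its simple connectivity. -/

section Domain

variable {c : Circle → ℂ}

theorem IsJordanCurve.isOpen_enclosedDomain (hc : IsJordanCurve c) : IsOpen (enclosedDomain c) := by
  rw [isOpen_iff_mem_nhds]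
  intro z hz
  rw [hc.enclosedDomain_eq hz]
  exact hc.isCompact_range.isClosed.isOpen_compl.connectedComponentIn.mem_nhds
    (mem_connectedComponentIn hz.1)

theorem IsJordanCurve.isPreconnected_enclosedDomain (hc : IsJordanCurve c) :
    IsPreconnected (enclosedDomain c) := by
  rcases (enclosedDomain c).eq_empty_or_nonempty with h | ⟨z, hz⟩
  · rw [h]; exact isPreconnected_empty
  · rw [hc.enclosedDomain_eq hz]; exact isPreconnected_connectedComponentIn

theorem IsJordanCurve.isBounded_enclosedDomain (hc : IsJordanCurve c) :
    Bornology.IsBounded (enclosedDomain c) := by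
  rcases (enclosedDomain c).eq_empty_or_nonempty with h | ⟨z, hz⟩
  · rw [h]; exact Bornology.isBounded_empty
  · rw [hc.enclosedDomain_eq hz]; exact hz.2

theorem IsJordanCurve.frontier_enclosedDomain (hc : IsJordanCurve c)
    (h : (enclosedDomain c).Nonempty) : frontier (enclosedDomain c) = range c := by
  obtain ⟨z, hz⟩ := h
  rw [hc.enclosedDomain_eq hz]
  exact hc.frontier_connectedComponentIn hz.1 hz.2

theorem IsJordanCurve.mem_connectedComponentIn_of_mem (hc : IsJordanCurve c) {z w : ℂ}
    (hz : z ∈ enclosedDomain c) (hw : w ∈ enclosedDomain c) :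
    w ∈ connectedComponentIn (range c)ᶜ z := by
  rwa [← hc.enclosedDomain_eq hz]

theorem IsJordanCurve.subset_enclosedDomain (hc : IsJordanCurve c) {T : Set ℂ}
    (hT : IsPreconnected T) (hTc : T ⊆ (range c)ᶜ) {z : ℂ} (hzT : z ∈ T)
    (hz : z ∈ enclosedDomain c) : T ⊆ enclosedDomain c := by
  rw [hc.enclosedDomain_eq hz]
  exact hT.subset_connectedComponentIn hzT hTc

/-- The bounded components of the complement of a compact subset of the inner domain lie in the inner
domain. -/
theorem IsJordanCurve.mem_enclosedDomain_of_isBounded (hc : IsJordanCurve c) {K : Set ℂ}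
    (hKD : K ⊆ enclosedDomain c) {w : ℂ} (hw : w ∉ K) (hK : IsClosed K)
    (hb : Bornology.IsBounded (connectedComponentIn Kᶜ w)) : w ∈ enclosedDomain c := by
  by_contra hwD
  have hcK : (range c) ⊆ Kᶜ := fun z hz hzK => (hKD hzK).1 hz
  have hout : ∀ a, a ∉ range c → ¬ Bornology.IsBounded (connectedComponentIn (range c)ᶜ a) →
      connectedComponentIn (range c)ᶜ a ⊆ Kᶜ := by
    intro a ha hab z hz hzK
    refine hab ?_
    rw [connectedComponentIn_eq hz]
    exact (hKD hzK).2
  -- It remains to find an unbounded connected set off `K` that meets the component of `w`. An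
  -- unbounded component of the complement of the curve serves: the one of `w`, or, if `w` is on the
  -- curve, any of them, since its frontier meets the curve and the whole curve lies in the
  -- component of `w`.
  have hbig : ∀ T : Set ℂ, IsPreconnected T → T ⊆ Kᶜ → (T ∩ connectedComponentIn Kᶜ w).Nonempty →
      Bornology.IsBounded T := by
    rintro T hT hTK ⟨z, hzT, hz⟩
    refine hb.subset ?_
    rw [connectedComponentIn_eq hz]
    exact hT.subset_connectedComponentIn hzT hTK
  by_cases hwc : w ∈ range c
  · obtain ⟨p, hp, hpb⟩ := exists_not_isBounded_connectedComponentIn hc.isCompact_range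
    have hne : (frontier (connectedComponentIn (range c)ᶜ p)).Nonempty := by
      rw [nonempty_frontier_iff]
      refine ⟨⟨p, mem_connectedComponentIn hp⟩, fun h => ?_⟩
      have := connectedComponentIn_subset (range c)ᶜ p (h ▸ mem_univ w)
      exact this hwc
    obtain ⟨z, hz⟩ := hne
    have hzc := frontier_connectedComponentIn_subset hc.isCompact_range.isClosed p hz
    have hcV : range c ⊆ connectedComponentIn Kᶜ w :=
      (isConnected_range hc.1).isPreconnected.subset_connectedComponentIn hwc hcK
    have hVo : IsOpen (connectedComponentIn Kᶜ w) := hK.isOpen_compl.connectedComponentIn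
    obtain ⟨y, hy, hy'⟩ := mem_closure_iff.1 (frontier_subset_closure hz) _ hVo (hcV hzc)
    exact hpb (hbig _ isPreconnected_connectedComponentIn (hout p hp hpb) ⟨y, hy', hy⟩)
  · have hub : ¬ Bornology.IsBounded (connectedComponentIn (range c)ᶜ w) := fun h => hwD ⟨hwc, h⟩
    exact hub (hbig _ isPreconnected_connectedComponentIn (hout w hwc hub)
      ⟨w, mem_connectedComponentIn hwc, mem_connectedComponentIn hw⟩)

/-- The inner domain is exhausted by compact sets with connected relative complement. -/
theorem IsJordanCurve.exists_isCompact_isPreconnected_diff (hc : IsJordanCurve c) {K : Set ℂ}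
    (hK : IsCompact K) (hKD : K ⊆ enclosedDomain c) :
    ∃ L, IsCompact L ∧ K ⊆ L ∧ L ⊆ enclosedDomain c ∧ IsPreconnected (enclosedDomain c \ L) := by
  -- `L` is `K` with its holes filled in.
  set L : Set ℂ := {z | z ∉ K → Bornology.IsBounded (connectedComponentIn Kᶜ z)} with hL
  have hKL : K ⊆ L := fun z hz h => absurd hz h
  have hLD : L ⊆ enclosedDomain c := fun z hz => by
    by_cases h : z ∈ K
    · exact hKD h
    · exact hc.mem_enclosedDomain_of_isBounded hKD h hK.isClosed (hz h)
  have hLclosed : IsClosed L := by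
    rw [← isOpen_compl_iff, isOpen_iff_mem_nhds]
    intro z hz
    rw [mem_compl_iff, hL, mem_ofPred_eq, Classical.not_imp] at hz
    refine mem_of_superset (hK.isClosed.isOpen_compl.connectedComponentIn.mem_nhds
      (mem_connectedComponentIn hz.1)) fun y hy hyL => hz.2 ?_
    rw [connectedComponentIn_eq hy]
    exact hyL (connectedComponentIn_subset _ _ hy)
  refine ⟨L, Metric.isCompact_of_isClosed_isBounded hLclosed (hc.isBounded_enclosedDomain.subset hLD),
    hKL, hLD, ?_⟩
  refine isPreconnected_of_forall_pair fun p hp q hq => ?_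
  have hnot : ∀ p, p ∉ L → p ∉ K ∧ ¬ Bornology.IsBounded (connectedComponentIn Kᶜ p) := by
    intro p hp
    rwa [hL, mem_ofPred_eq, Classical.not_imp] at hp
  obtain ⟨hpK, hpb⟩ := hnot p hp.2
  obtain ⟨hqK, hqb⟩ := hnot q hq.2
  have h₁ : q ∈ connectedComponentIn Kᶜ p := by
    rw [connectedComponentIn_eq_of_not_isBounded hK.isBounded hpb hqb]
    exact mem_connectedComponentIn hqK
  have hKc : K ∩ range c = ∅ :=
    (disjoint_left.2 fun z hz hz' => (hKD hz).1 hz').inter_eq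
  -- The points `p` and `q` are joined off `K`, in its unbounded component, and off the curve,
  -- inside the domain. As `K` and the curve are disjoint, Janiszewski's theorem joins them off
  -- both.
  have hmem := mem_connectedComponentIn_compl_union hK hc.isCompact_range
    (by rw [hKc]; exact isPreconnected_empty) h₁ (hc.mem_connectedComponentIn_of_mem hp.1 hq.1)
  have hpm : p ∈ connectedComponentIn (K ∪ range c)ᶜ p :=
    mem_connectedComponentIn fun h => h.elim hpK hp.1.1
  refine ⟨_, fun z hz => ⟨?_, fun hzL => ?_⟩, hpm, hmem, isPreconnected_connectedComponentIn⟩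
  · exact hc.subset_enclosedDomain isPreconnected_connectedComponentIn
      ((connectedComponentIn_subset _ _).trans (compl_subset_compl.2 subset_union_right)) hpm hp.1 hz
  · have hzp : z ∈ connectedComponentIn Kᶜ p :=
      connectedComponentIn_mono p (compl_subset_compl.2 subset_union_left) hz
    refine hpb ?_
    rw [connectedComponentIn_eq hzp]
    exact hzL (connectedComponentIn_subset _ _ hzp)

/-- The point `a` can be moved within its component to a far point `b`, and `z - b = -b (1 - z / b)`
has a principal logarithm on `K`. -/
theorem hasLogOn_sub_of_not_isBounded {K : Set ℂ} (hK : IsCompact K) {a : ℂ}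
    (ha : ¬ Bornology.IsBounded (connectedComponentIn Kᶜ a)) : HasLogOn (fun z => z - a) K := by
  obtain ⟨R, hR0, hR⟩ := hK.isBounded.subset_closedBall_lt 0 0
  obtain ⟨b, hb, hbR⟩ : ∃ b ∈ connectedComponentIn Kᶜ a, R < ‖b‖ := by
    by_contra hcon
    push Not at hcon
    exact ha (Metric.isBounded_closedBall.subset fun z hz => mem_closedBall_zero_iff.2 (hcon z hz))
  have hb0 : b ≠ 0 := norm_pos_iff.1 (hR0.trans hbR)
  have hbK : ∀ z ∈ K, z - b ≠ 0 := fun z hz =>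
    sub_ne_zero.2 fun h => connectedComponentIn_subset _ _ hb (h ▸ hz)
  have h1 := hasLogOn_div_of_mem_connectedComponentIn hK.isClosed hb
  have h2 : HasLogOn (fun z => 1 + (-z / b)) K := by
    refine hasLogOn_of_mem_slitPlane (by fun_prop) fun z hz => Complex.mem_slitPlane_of_norm_lt_one ?_
    rw [norm_div, norm_neg, div_lt_one (hR0.trans hbR)]
    exact (mem_closedBall_zero_iff.1 (hR hz)).trans_lt hbR
  refine ((h1.mul h2).mul (hasLogOn_const (neg_ne_zero.2 hb0))).congr fun z hz => ?_
  have := hbK z hz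
  field_simp
  ring

/-- An injective open map of the inner domain omitting `a` has a logarithm of `ψ - a` on each compact
set with connected relative complement. -/
theorem hasLogOn_sub_of_injOn {D L : Set ℂ} (hL : IsCompact L) (hLD : L ⊆ D)
    (hLne : L.Nonempty) (hDL : IsPreconnected (D \ L)) {ψ : ℂ → ℂ} (hψ : ContinuousOn ψ D)
    (hinj : InjOn ψ D) (hopen : IsOpen (ψ '' D)) {a : ℂ} (ha : a ∉ ψ '' D) :
    HasLogOn (fun z => ψ z - a) L := by
  have hM : IsCompact (ψ '' L) := hL.image_of_continuousOn (hψ.mono hLD)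
  have haM : a ∉ ψ '' L := fun h => ha (image_mono hLD h)
  suffices h : ¬ Bornology.IsBounded (connectedComponentIn (ψ '' L)ᶜ a) by
    exact (hasLogOn_sub_of_not_isBounded hM h).comp (hψ.mono hLD) (mapsTo_image ψ L)
  intro hb
  -- The frontier of each component of the complement of `ψ '' L` lies in `ψ '' L`, inside the open
  -- set `ψ '' D`; so every component meets the connected set `ψ '' (D \ L)`. Hence there is only
  -- one component, and it is unbounded.
  have hmeet : ∀ v, v ∉ ψ '' L → ∃ x ∈ D \ L, ψ x ∈ connectedComponentIn (ψ '' L)ᶜ v := by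
    intro v hv
    have hne : (frontier (connectedComponentIn (ψ '' L)ᶜ v)).Nonempty := by
      rw [nonempty_frontier_iff]
      refine ⟨⟨v, mem_connectedComponentIn hv⟩, fun h => ?_⟩
      obtain ⟨y, hy⟩ := hLne
      exact connectedComponentIn_subset (ψ '' L)ᶜ v (h ▸ mem_univ (ψ y)) (mem_image_of_mem ψ hy)
    obtain ⟨y, hy⟩ := hne
    have hyM := frontier_connectedComponentIn_subset hM.isClosed v hy
    obtain ⟨_, ⟨x, hx, rfl⟩, hxv⟩ :=
      mem_closure_iff.1 (frontier_subset_closure hy) _ hopen (image_mono hLD hyM)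
    exact ⟨x, ⟨hx, fun hxL => connectedComponentIn_subset _ _ hxv (mem_image_of_mem ψ hxL)⟩, hxv⟩
  obtain ⟨p, hp, hpb⟩ := exists_not_isBounded_connectedComponentIn hM
  obtain ⟨x, hx, hxa⟩ := hmeet a haM
  obtain ⟨y, hy, hyp⟩ := hmeet p hp
  have hsub : ψ '' (D \ L) ⊆ (ψ '' L)ᶜ := by
    rintro _ ⟨z, hz, rfl⟩ ⟨w, hw, hwz⟩
    exact hz.2 (hinj (hLD hw) hz.1 hwz ▸ hw)
  have h := (hDL.image ψ (hψ.mono sdiff_subset)).subset_connectedComponentIn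
    (mem_image_of_mem ψ hx) hsub (mem_image_of_mem ψ hy)
  rw [← connectedComponentIn_eq hxa] at h
  refine hpb ?_
  rwa [connectedComponentIn_eq hyp, ← connectedComponentIn_eq h]

/-- If a nonvanishing function on an open connected set has a logarithm on every compact subset, then
it has a global logarithm. -/
theorem hasLogOn_of_forall_isCompact {D : Set ℂ} (hD : IsOpen D) (hDc : IsPreconnected D) {f : ℂ → ℂ}
    (hf : ContinuousOn f D) (h0 : ∀ z ∈ D, f z ≠ 0)
    (h : ∀ K ⊆ D, IsCompact K → K.Nonempty → HasLogOn f K) : HasLogOn f D := by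
  rcases D.eq_empty_or_nonempty with rfl | ⟨z₀, hz₀⟩
  · exact ⟨0, continuousOn_empty _, by simp⟩
  have hpath : IsPathConnected D := (hD.isConnected_iff_isPathConnected).1 ⟨⟨z₀, hz₀⟩, hDc⟩
  have := isPathConnected_iff_pathConnectedSpace.1 hpath
  have := hD.locallyPathConnectedSpace
  have cov := Complex.isCoveringMap_exp
  let F : C(D, {z : ℂ // z ≠ 0}) := ⟨fun x => ⟨f x, h0 x x.2⟩, hf.domRestrict.subtype_mk _⟩
  -- The function is lifted through the covering `exp`. The endpoint of a lifted path does not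
  -- depend on the path, because a logarithm exists on the compact union of any two paths.
  have hexu := cov.isLocalHomeomorph.existsUnique_continuousMap_lifts F
    (⟨z₀, hz₀⟩ : D) (Complex.log (f z₀)) (Subtype.ext (Complex.exp_log (h0 z₀ hz₀))) ?_ ?_
  · obtain ⟨g, ⟨-, hg⟩, -⟩ := hexu
    classical
    refine ⟨fun z => if hz : z ∈ D then g ⟨z, hz⟩ else 0, ?_, fun z hz => ?_⟩
    · rw [continuousOn_iff_continuous_domRestrict]
      convert g.continuous using 1
      ext z
      simp
    · simp only [hz, dif_pos]
      exact congrArg Subtype.val (congrFun hg ⟨z, hz⟩)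
  · intro γ hγ
    obtain ⟨Γ, hΓ, hΓ0⟩ := cov.exists_path_lifts (F.comp γ) (Complex.log (f z₀))
      (by rw [ContinuousMap.comp_apply, hγ]; exact Subtype.ext (Complex.exp_log (h0 z₀ hz₀)).symm)
    exact ⟨Γ, hΓ0, hΓ⟩
  · intro γ γ' Γ Γ' hγ hγ' hΓ hΓ' hl hl' hend
    set K : Set ℂ := range (fun t => (γ t : ℂ)) ∪ range (fun t => (γ' t : ℂ)) with hKdef
    have hKD : K ⊆ D := by
      rintro _ (⟨t, rfl⟩ | ⟨t, rfl⟩)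
      exacts [(γ t).2, (γ' t).2]
    have hγc : Continuous fun t => (γ t : ℂ) := by fun_prop
    have hγc' : Continuous fun t => (γ' t : ℂ) := by fun_prop
    obtain ⟨g, hg, hg'⟩ := h K hKD ((isCompact_range hγc).union (isCompact_range hγc'))
      ⟨_, Or.inl (mem_range_self 0)⟩
    have key : ∀ (δ : C(unitInterval, D)) (Δ : C(unitInterval, ℂ)), (∀ t, (δ t : ℂ) ∈ K) →
        δ 0 = ⟨z₀, hz₀⟩ → Δ 0 = Complex.log (f z₀) →
        (fun z : ℂ => (⟨_, z.exp_ne_zero⟩ : {z : ℂ // z ≠ 0})) ∘ Δ = F.comp δ →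
        Δ 1 - g (δ 1) = Complex.log (f z₀) - g z₀ := by
      intro δ Δ hδK hδ hΔ hl
      have hcont : Continuous fun t => g (δ t) :=
        hg.comp_continuous (by fun_prop) hδK
      have := sub_eq_sub_of_exp_eq (K := univ) (g₁ := Δ) (g₂ := fun t => g (δ t)) isPreconnected_univ
        Δ.continuous.continuousOn hcont.continuousOn
        (fun t _ => by rw [hg' _ (hδK t)]; exact congrArg Subtype.val (congrFun hl t))
        (mem_univ 1) (mem_univ 0)
      simpa only [hδ, hΔ] using this
    have e1 := key γ Γ (fun t => Or.inl (mem_range_self t)) hγ hΓ hl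
    have e2 := key γ' Γ' (fun t => Or.inr (mem_range_self t)) hγ' hΓ' hl'
    rw [hend] at e1
    linear_combination e1 - e2

/-- The inner domain of a Jordan curve is simply connected, in the form used for the Riemann map. -/
theorem IsJordanCurve.hasLogOn_sub (hc : IsJordanCurve c) {ψ : ℂ → ℂ}
    (hψ : ContinuousOn ψ (enclosedDomain c)) (hinj : InjOn ψ (enclosedDomain c))
    (hopen : IsOpen (ψ '' enclosedDomain c)) {a : ℂ} (ha : a ∉ ψ '' enclosedDomain c) :
    HasLogOn (fun z => ψ z - a) (enclosedDomain c) := by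
  refine hasLogOn_of_forall_isCompact hc.isOpen_enclosedDomain hc.isPreconnected_enclosedDomain
    (by fun_prop) (fun z hz => sub_ne_zero.2 fun h => ha ⟨z, hz, h⟩) fun K hKD hK hKne => ?_
  obtain ⟨L, hL, hKL, hLD, hDL⟩ := hc.exists_isCompact_isPreconnected_diff hK hKD
  exact (hasLogOn_sub_of_injOn hL hLD (hKne.mono hKL) hDL hψ hinj hopen
    ha).mono hKL

end Domain

/-! ### Injective holomorphic functions and holomorphic logarithms. -/

section Injective

variable {f : ℂ → ℂ} {U : Set ℂ}

theorem not_eventually_const_of_injOn (hU : IsOpen U) (hinj : InjOn f U) {a : ℂ} (ha : a ∈ U) :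
    ¬ ∀ᶠ z in 𝓝 a, f z = f a := by
  intro h
  obtain ⟨z, ⟨hz, hzU⟩, hne⟩ := ((h.and (hU.mem_nhds ha)).filter_mono nhdsWithin_le_nhds).and
    (self_mem_nhdsWithin (s := ({a}ᶜ : Set ℂ))) |>.exists
  exact hne (hinj hzU ha hz)

theorem nhds_le_map_of_injOn (hU : IsOpen U) (hf : DifferentiableOn ℂ f U) (hinj : InjOn f U) {a : ℂ}
    (ha : a ∈ U) : 𝓝 (f a) ≤ map f (𝓝 a) :=
  ((hf.analyticAt (hU.mem_nhds ha)).eventually_constant_or_nhds_le_map_nhds).resolve_left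
    (not_eventually_const_of_injOn hU hinj ha)

theorem isOpen_image_of_injOn (hU : IsOpen U) (hf : DifferentiableOn ℂ f U) (hinj : InjOn f U) :
    IsOpen (f '' U) := by
  rw [isOpen_iff_mem_nhds]
  rintro _ ⟨a, ha, rfl⟩
  exact nhds_le_map_of_injOn hU hf hinj ha (image_mem_map (hU.mem_nhds ha))

theorem continuousAt_invFunOn_of_injOn (hU : IsOpen U) (hf : DifferentiableOn ℂ f U)
    (hinj : InjOn f U) {a : ℂ} (ha : a ∈ U) : ContinuousAt (Function.invFunOn f U) (f a) := by
  have hga : Function.invFunOn f U (f a) = a := hinj.leftInvOn_invFunOn ha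
  rw [ContinuousAt, hga]
  intro V hV
  have h := nhds_le_map_of_injOn hU hf hinj ha (image_mem_map (inter_mem hV (hU.mem_nhds ha)))
  rw [mem_map]
  refine mem_of_superset h ?_
  rintro _ ⟨x, hx, rfl⟩
  change Function.invFunOn f U (f x) ∈ V
  rw [hinj.leftInvOn_invFunOn hx.2]
  exact hx.1

theorem eventually_apply_invFunOn (hU : IsOpen U) (hf : DifferentiableOn ℂ f U)
    (hinj : InjOn f U) {a : ℂ} (ha : a ∈ U) : ∀ᶠ y in 𝓝 (f a), f (Function.invFunOn f U y) = y := by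
  filter_upwards [(isOpen_image_of_injOn hU hf hinj).mem_nhds (mem_image_of_mem f ha)] with y hy
  exact Function.invFunOn_eq hy

theorem differentiableAt_invFunOn_of_deriv_ne_zero (hU : IsOpen U) (hf : DifferentiableOn ℂ f U)
    (hinj : InjOn f U) {a : ℂ} (ha : a ∈ U) (hd : deriv f a ≠ 0) :
    DifferentiableAt ℂ (Function.invFunOn f U) (f a) := by
  have hga : Function.invFunOn f U (f a) = a := hinj.leftInvOn_invFunOn ha
  refine (HasDerivAt.of_local_left_inverse (continuousAt_invFunOn_of_injOn hU hf hinj ha)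
    (f := f) (f' := deriv f a) ?_ hd (eventually_apply_invFunOn hU hf hinj ha)).differentiableAt
  rw [hga]
  exact (hf.differentiableAt (hU.mem_nhds ha)).hasDerivAt

/-- Critical points are isolated, so near `f a` the inverse is differentiable except possibly at `f
a`, where it is continuous; such a singularity is removable. -/
theorem differentiableAt_invFunOn_of_injOn (hU : IsOpen U) (hf : DifferentiableOn ℂ f U)
    (hinj : InjOn f U) {a : ℂ} (ha : a ∈ U) :
    DifferentiableAt ℂ (Function.invFunOn f U) (f a) := by
  have hga : Function.invFunOn f U (f a) = a := hinj.leftInvOn_invFunOn ha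
  have hcont := continuousAt_invFunOn_of_injOn hU hf hinj ha
  refine (Complex.analyticAt_of_differentiable_on_punctured_nhds_of_continuousAt ?_
    hcont).differentiableAt
  have hne : ∀ᶠ z in 𝓝[≠] a, deriv f z ≠ 0 := by
    refine ((hf.analyticAt (hU.mem_nhds ha)).deriv.eventually_eq_zero_or_eventually_ne_zero
      ).resolve_left fun h0 => not_eventually_const_of_injOn hU hinj ha ?_
    obtain ⟨r, hr, hball⟩ := Metric.eventually_nhds_iff_ball.1 (h0.and (hU.mem_nhds ha))
    filter_upwards [Metric.ball_mem_nhds a hr] with z hz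
    refine Metric.isOpen_ball.is_const_of_deriv_eq_zero (convex_ball a r).isPreconnected
      (hf.mono fun z hz => (hball z hz).2) (fun z hz => (hball z hz).1) hz (Metric.mem_ball_self hr)
  have htend : Tendsto (Function.invFunOn f U) (𝓝[≠] (f a)) (𝓝[≠] a) := by
    refine tendsto_nhdsWithin_iff.2 ⟨?_, ?_⟩
    · have := hcont.tendsto.mono_left (nhdsWithin_le_nhds (s := {f a}ᶜ))
      rwa [hga] at this
    · filter_upwards [(eventually_apply_invFunOn hU hf hinj ha).filter_mono nhdsWithin_le_nhds,
        self_mem_nhdsWithin] with y hy hya he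
      exact hya (by rw [← hy, he]; rfl)
  filter_upwards [htend.eventually hne, self_mem_nhdsWithin,
    mem_nhdsWithin_of_mem_nhds
      ((isOpen_image_of_injOn hU hf hinj).mem_nhds (mem_image_of_mem f ha))] with y hy _ hyU
  obtain ⟨x, hx, rfl⟩ := hyU
  rw [hinj.leftInvOn_invFunOn hx] at hy
  exact differentiableAt_invFunOn_of_deriv_ne_zero hU hf hinj hx hy

theorem deriv_ne_zero_of_injOn (hU : IsOpen U) (hf : DifferentiableOn ℂ f U)
    (hinj : InjOn f U) {a : ℂ} (ha : a ∈ U) : deriv f a ≠ 0 := by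
  have h1 := (differentiableAt_invFunOn_of_injOn hU hf hinj ha).hasDerivAt.comp a
    (hf.differentiableAt (hU.mem_nhds ha)).hasDerivAt
  have h2 : HasDerivAt (Function.invFunOn f U ∘ f) 1 a :=
    (hasDerivAt_id a).congr_of_eventuallyEq (by
      filter_upwards [hU.mem_nhds ha] with z hz using hinj.leftInvOn_invFunOn hz)
  intro h0
  rw [h0, mul_zero] at h1
  exact zero_ne_one (h1.unique h2)

/-- Near `a`, a continuous logarithm is a constant plus the principal logarithm of `f z / f a`. -/
theorem differentiableOn_log {L f : ℂ → ℂ} {D : Set ℂ} (hD : IsOpen D) (hL : ContinuousOn L D)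
    (hf : DifferentiableOn ℂ f D) (h : ∀ z ∈ D, Complex.exp (L z) = f z) :
    DifferentiableOn ℂ L D := by
  intro a ha
  have hfa : DifferentiableAt ℂ f a := hf.differentiableAt (hD.mem_nhds ha)
  have hf0 : f a ≠ 0 := by rw [← h a ha]; exact Complex.exp_ne_zero _
  have hcont : ContinuousAt L a := hL.continuousAt (hD.mem_nhds ha)
  have hev : ∀ᶠ z in 𝓝 a, L z = L a + Complex.log (f z / f a) := by
    have h1 : ∀ᶠ z in 𝓝 a, ‖L z - L a‖ < 1 := by
      have := (hcont.sub_const (L a)).norm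
      simp only [sub_self, norm_zero] at this
      exact this.eventually_lt_const one_pos
    filter_upwards [h1, hD.mem_nhds ha] with z hz hzD
    have him := (Complex.abs_im_le_norm (L z - L a)).trans hz.le
    rw [abs_le] at him
    rw [← h z hzD, ← h a ha, ← Complex.exp_sub, Complex.log_exp (by linarith [Real.pi_gt_three])
      (by linarith [Real.pi_gt_three])]
    ring
  have hd : DifferentiableAt ℂ (fun z => L a + Complex.log (f z / f a)) a := by
    refine (differentiableAt_const _).add ((hfa.div_const _).clog ?_)
    rw [div_self hf0]
    exact Complex.one_mem_slitPlane
  exact (hd.congr_of_eventuallyEq hev).differentiableWithinAt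

end Injective

/-! ### The theorems of Montel and Hurwitz. -/

section Montel

variable {ι : Type*} {F : ι → ℂ → ℂ} {D : Set ℂ}

/-- The Schwarz lemma gives a Lipschitz constant that does not depend on `f`, hence local
equicontinuity. The `2` is the diameter of the target disk. -/
theorem dist_le_of_mapsTo_ball {f : ℂ → ℂ} (hf : DifferentiableOn ℂ f D)
    (hm : MapsTo f D (Metric.ball 0 1)) {z : ℂ} {r : ℝ} (hr : Metric.ball z r ⊆ D) {x : ℂ}
    (hx : x ∈ Metric.ball z r) : dist (f x) (f z) ≤ 2 / r * dist x z := by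
  have hr0 : 0 < r := Metric.pos_of_mem_ball hx
  refine Complex.dist_le_div_mul_dist_of_mapsTo_ball (hf.mono hr) (fun y hy => ?_) hx
  have h1 := hm (hr hy)
  have h2 := hm (hr (Metric.mem_ball_self hr0))
  rw [mem_ball_zero_iff] at h1 h2
  rw [Metric.mem_closedBall, dist_eq_norm]
  linarith [norm_sub_le (f y) (f z)]

/-- Montel's theorem along an ultrafilter. -/
theorem exists_tendstoLocallyUniformlyOn (𝒰 : Ultrafilter ι) (hD : IsOpen D)
    (hF : ∀ i, DifferentiableOn ℂ (F i) D) (hm : ∀ i, MapsTo (F i) D (Metric.ball 0 1)) :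
    ∃ g : ℂ → ℂ, TendstoLocallyUniformlyOn F g 𝒰 D := by
  -- Along an ultrafilter, compactness of the closed disk gives all pointwise limits at once,
  -- without extracting subsequences.
  have hex : ∀ z ∈ D, ∃ w : ℂ, Tendsto (fun i => F i z) 𝒰 (𝓝 w) := by
    intro z hz
    obtain ⟨w, -, hw⟩ := isCompact_iff_ultrafilter_le_nhds.1
      (isCompact_closedBall (0 : ℂ) 1) (𝒰.map fun i => F i z) (by
        rw [Ultrafilter.coe_map, le_principal_iff, mem_map]
        exact Filter.univ_mem' fun i => Metric.ball_subset_closedBall (hm i hz))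
    exact ⟨w, hw⟩
  choose! g hg using hex
  refine ⟨g, Metric.tendstoLocallyUniformlyOn_iff.2 fun ε hε z hz => ?_⟩
  obtain ⟨r, hr, hball⟩ := Metric.isOpen_iff.1 hD z hz
  set s : ℝ := min r (ε * r / 8) with hs
  have hs0 : 0 < s := lt_min hr (by positivity)
  have hsr : s ≤ r := min_le_left _ _
  have hlip : ∀ i, ∀ x ∈ Metric.ball z s, dist (F i x) (F i z) ≤ ε / 4 := by
    intro i x hx
    refine (dist_le_of_mapsTo_ball (hF i) (hm i) hball (Metric.ball_subset_ball hsr hx)).trans ?_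
    have h1 : dist x z ≤ ε * r / 8 := (Metric.mem_ball.1 hx).le.trans (min_le_right _ _)
    calc 2 / r * dist x z ≤ 2 / r * (ε * r / 8) := by gcongr
      _ = ε / 4 := by field_simp; norm_num
  have hlipg : ∀ x ∈ Metric.ball z s, dist (g x) (g z) ≤ ε / 4 := fun x hx =>
    le_of_tendsto ((hg x (hball (Metric.ball_subset_ball hsr hx))).dist (hg z hz))
      (Eventually.of_forall fun i => hlip i x hx)
  refine ⟨Metric.ball z s, mem_nhdsWithin_of_mem_nhds (Metric.ball_mem_nhds z hs0), ?_⟩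
  filter_upwards [Metric.tendsto_nhds.1 (hg z hz) (ε / 4) (by positivity)] with i hi x hx
  have h1 := dist_triangle4 (g x) (g z) (F i z) (F i x)
  rw [dist_comm (g z) (F i z), dist_comm (F i z) (F i x)] at h1
  linarith [hlip i x hx, hlipg x hx]

/-- Hurwitz's theorem on injective functions. -/
theorem injOn_of_tendstoLocallyUniformlyOn {l : Filter ι} [l.NeBot] {g : ℂ → ℂ} (hD : IsOpen D)
    (hDc : IsPreconnected D) (hF : ∀ i, DifferentiableOn ℂ (F i) D) (hinj : ∀ i, InjOn (F i) D)
    (hlim : TendstoLocallyUniformlyOn F g l D) {z₀ z₁ : ℂ} (hz₀ : z₀ ∈ D) (hz₁ : z₁ ∈ D)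
    (hne : g z₀ ≠ g z₁) : InjOn g D := by
  have hg : DifferentiableOn ℂ g D := hlim.differentiableOn (Eventually.of_forall hF) hD
  have hga : AnalyticOnNhd ℂ g D := hg.analyticOnNhd hD
  intro a ha b hb hab
  by_contra hab'
  have hiso : ∀ x ∈ D, g x = g a → ∀ᶠ z in 𝓝[≠] x, g z ≠ g a := by
    intro x hx hxa
    rcases ((hga x hx).sub analyticAt_const).eventually_eq_zero_or_eventually_ne_zero
      (f := g - fun _ => g a) with h | h
    · exfalso
      have := hga.eqOn_of_preconnected_of_eventuallyEq (analyticOnNhd_const (v := g a)) hDc hx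
        (h.mono fun z hz => sub_eq_zero.1 hz)
      exact hne ((this hz₀).trans (this hz₁).symm)
    · exact h.mono fun z hz => sub_ne_zero.1 hz
  -- Near every solution `x` of `g x = g a`, eventually `F i` also takes the value `g a`. At two
  -- distinct solutions, disjoint disks then contradict the injectivity of `F i`.
  have hloc : ∀ x ∈ D, g x = g a → ∀ s > 0, ∃ r, 0 < r ∧ r < s ∧
      ∀ᶠ i in l, g a ∈ F i '' (D ∩ Metric.closedBall x r) := by
    intro x hx hxa s hs
    obtain ⟨t, ht, hball⟩ := Metric.eventually_nhds_iff_ball.1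
      ((eventually_nhdsWithin_iff.1 (hiso x hx hxa)).and (hD.mem_nhds hx))
    set r := min s t / 2 with hr
    have hst : 0 < min s t := lt_min hs ht
    have hr0 : 0 < r := half_pos hst
    have hrs : r < s := (half_lt_self hst).trans_le (min_le_left _ _)
    have hrt : r < t := (half_lt_self hst).trans_le (min_le_right _ _)
    have hcb : Metric.closedBall x r ⊆ D := fun z hz =>
      (hball z (Metric.closedBall_subset_ball hrt hz)).2
    have hsph : Metric.sphere x r ⊆ Metric.closedBall x r := Metric.sphere_subset_closedBall
    -- If `F i` is within `m / 4` of `g`, it stays at distance at least `m / 2` from `F i x` on the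
    -- sphere; the quantitative open mapping theorem then covers the disk of radius `m / 4` about `F
    -- i x`, which contains `g a`.
    obtain ⟨m, hm0, hm⟩ : ∃ m > 0, ∀ z ∈ Metric.sphere x r, m ≤ ‖g z - g a‖ := by
      have hne : (Metric.sphere x r).Nonempty := NormedSpace.sphere_nonempty.2 hr0.le
      obtain ⟨y, hy, hmin⟩ := (isCompact_sphere x r).exists_isMinOn hne
        (f := fun z => ‖g z - g a‖)
        (((hg.continuousOn.mono (hsph.trans hcb)).sub continuousOn_const).norm)
      refine ⟨_, norm_pos_iff.2 (sub_ne_zero.2 ?_), fun z hz => hmin hz⟩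
      exact (hball y (Metric.closedBall_subset_ball hrt (hsph hy))).1 (Metric.ne_of_mem_sphere hy hr0.ne')
    refine ⟨r, hr0, hrs, ?_⟩
    have hunif := (tendstoLocallyUniformlyOn_iff_forall_isCompact hD).1 hlim _ hcb
      (isCompact_closedBall x r)
    filter_upwards [Metric.tendstoUniformlyOn_iff.1 hunif (m / 4) (by positivity)] with i hi
    have hxi := hi x (Metric.mem_closedBall_self hr0.le)
    rw [dist_eq_norm, hxa] at hxi
    have hcl : DiffContOnCl ℂ (F i) (Metric.ball x r) :=
      ((hF i).mono hcb).diffContOnCl_ball (subset_refl _)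
    have hsub := hcl.ball_subset_image_closedBall hr0 (ε := m / 2) (fun z hz => ?_) ?_
    · have : g a ∈ F i '' Metric.closedBall x r := hsub (by
        rw [Metric.mem_ball, dist_eq_norm]; linarith)
      rwa [inter_eq_self_of_subset_right hcb]
    · have h1 := hi z (hsph hz)
      rw [dist_eq_norm] at h1
      have h2 := hm z hz
      have h3 : g z - g a = (g z - F i z) + (F i z - F i x) - (g a - F i x) := by ring
      have h4 := norm_sub_le ((g z - F i z) + (F i z - F i x)) (g a - F i x)
      have h5 := norm_add_le (g z - F i z) (F i z - F i x)
      rw [← h3] at h4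
      linarith
    · exact fun h => not_eventually_const_of_injOn hD (hinj i) hx (h.mono fun z hz => not_not.1 hz)
  have hd : 0 < dist a b / 2 := half_pos (dist_pos.2 hab')
  obtain ⟨r, -, hr, h1⟩ := hloc a ha rfl _ hd
  obtain ⟨s, -, hs, h2⟩ := hloc b hb hab.symm _ hd
  obtain ⟨i, ⟨x, hx, hxe⟩, ⟨y, hy, hye⟩⟩ := (h1.and h2).exists
  have hxy : x = y := hinj i hx.1 hy.1 (hxe.trans hye.symm)
  subst hxy
  have h3 := Metric.mem_closedBall.1 hx.2
  have h4 := Metric.mem_closedBall.1 hy.2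
  have h5 := dist_triangle_left a b x
  linarith

end Montel

/-! ### The Riemann mapping theorem. -/

section Riemann

variable {D : Set ℂ}

theorem normSq_one_sub_conj_mul_sub (a b : ℂ) :
    Complex.normSq (1 - (starRingEnd ℂ) a * b) - Complex.normSq (b - a)
      = (1 - Complex.normSq a) * (1 - Complex.normSq b) := by
  simp only [Complex.normSq_apply, Complex.sub_re, Complex.sub_im, Complex.mul_re, Complex.mul_im,
    Complex.conj_re, Complex.conj_im, Complex.one_re, Complex.one_im]
  ring

theorem normSq_lt_one_of_norm {a : ℂ} (ha : ‖a‖ < 1) : Complex.normSq a < 1 := by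
  rw [Complex.normSq_eq_norm_sq]
  exact pow_lt_one₀ (norm_nonneg a) ha two_ne_zero

theorem norm_sub_lt_norm_one_sub_conj_mul {a b : ℂ} (ha : ‖a‖ < 1) (hb : ‖b‖ < 1) :
    ‖b - a‖ < ‖1 - (starRingEnd ℂ) a * b‖ := by
  have h := normSq_one_sub_conj_mul_sub a b
  have ha' := normSq_lt_one_of_norm ha
  have hb' := normSq_lt_one_of_norm hb
  have h2 : 0 < (1 - Complex.normSq a) * (1 - Complex.normSq b) :=
    mul_pos (by linarith) (by linarith)
  rw [← h, Complex.normSq_eq_norm_sq, Complex.normSq_eq_norm_sq] at h2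
  exact lt_of_pow_lt_pow_left₀ 2 (norm_nonneg _) (by linarith)

theorem one_sub_conj_mul_ne_zero {a b : ℂ} (ha : ‖a‖ < 1) (hb : ‖b‖ < 1) :
    1 - (starRingEnd ℂ) a * b ≠ 0 :=
  norm_pos_iff.1 ((norm_nonneg _).trans_lt (norm_sub_lt_norm_one_sub_conj_mul ha hb))

/-- The disk automorphism taking `a` to `0`. -/
noncomputable def diskShift (a w : ℂ) : ℂ := (w - a) / (1 - (starRingEnd ℂ) a * w)

theorem norm_diskShift_lt_one {a w : ℂ} (ha : ‖a‖ < 1) (hw : ‖w‖ < 1) : ‖diskShift a w‖ < 1 := by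
  have h := norm_sub_lt_norm_one_sub_conj_mul ha hw
  rw [diskShift, norm_div, div_lt_one ((norm_nonneg _).trans_lt h)]
  exact h

theorem diskShift_injOn {a : ℂ} (ha : ‖a‖ < 1) : InjOn (diskShift a) (Metric.ball 0 1) := by
  intro z hz w hw h
  rw [mem_ball_zero_iff] at hz hw
  have h1 := one_sub_conj_mul_ne_zero ha hz
  have h2 := one_sub_conj_mul_ne_zero ha hw
  rw [diskShift, diskShift, div_eq_div_iff h1 h2] at h
  have h3 : (z - w) * (1 - (starRingEnd ℂ) a * a) = 0 := by linear_combination h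
  rcases mul_eq_zero.1 h3 with h4 | h4
  · exact sub_eq_zero.1 h4
  · exact absurd h4 (one_sub_conj_mul_ne_zero ha ha)

theorem differentiableOn_diskShift {a : ℂ} (ha : ‖a‖ < 1) :
    DifferentiableOn ℂ (diskShift a) (Metric.ball 0 1) := by
  refine DifferentiableOn.div (by fun_prop) (by fun_prop) fun z hz => ?_
  exact one_sub_conj_mul_ne_zero ha (mem_ball_zero_iff.1 hz)

/-- The square root trick: an injective map into the disk fixing the base point that omits a point of
the disk can be expanded. -/
theorem exists_norm_lt_of_omitted_value (hD : IsOpen D)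
    (hlog : ∀ ψ : ℂ → ℂ, DifferentiableOn ℂ ψ D → InjOn ψ D → ∀ a, a ∉ ψ '' D →
      HasLogOn (fun z => ψ z - a) D)
    {z₀ z₁ : ℂ} (hz₀ : z₀ ∈ D) (hz₁ : z₁ ∈ D) (hne : z₀ ≠ z₁) {f : ℂ → ℂ}
    (hf : DifferentiableOn ℂ f D) (hinj : InjOn f D) (hm : MapsTo f D (Metric.ball 0 1))
    (h0 : f z₀ = 0) {a : ℂ} (ha : ‖a‖ < 1) (haD : a ∉ f '' D) :
    ∃ F : ℂ → ℂ, DifferentiableOn ℂ F D ∧ InjOn F D ∧ MapsTo F D (Metric.ball 0 1) ∧ F z₀ = 0 ∧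
      ‖f z₁‖ < ‖F z₁‖ := by
  set ψ : ℂ → ℂ := fun z => diskShift a (f z) with hψ
  have hψd : DifferentiableOn ℂ ψ D := (differentiableOn_diskShift ha).comp hf hm
  have hψi : InjOn ψ D := (diskShift_injOn ha).comp hinj hm
  have hψ0 : (0 : ℂ) ∉ ψ '' D := by
    rintro ⟨z, hz, hz0⟩
    rcases div_eq_zero_iff.1 hz0 with h | h
    · exact haD ⟨z, hz, sub_eq_zero.1 h⟩
    · exact one_sub_conj_mul_ne_zero ha (mem_ball_zero_iff.1 (hm hz)) h
  obtain ⟨L, hL, hL'⟩ := hlog ψ hψd hψi 0 hψ0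
  simp only [sub_zero] at hL'
  have hLd := differentiableOn_log hD hL hψd hL'
  -- A holomorphic square root of `ψ`, injective because its square is.
  set s : ℂ → ℂ := fun z => Complex.exp (L z / 2) with hs
  have hs2 : ∀ z ∈ D, s z ^ 2 = ψ z := fun z hz => by
    rw [← hL' z hz, hs, ← Complex.exp_nat_mul]
    congr 1
    push_cast
    ring
  have hs1 : ∀ z ∈ D, ‖s z‖ < 1 := fun z hz => by
    have : ‖s z‖ ^ 2 < 1 := by
      rw [← norm_pow, hs2 z hz]
      exact norm_diskShift_lt_one ha (mem_ball_zero_iff.1 (hm hz))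
    exact (pow_lt_one_iff_of_nonneg (norm_nonneg _) two_ne_zero).1 this
  have hsm : MapsTo s D (Metric.ball 0 1) := fun z hz => mem_ball_zero_iff.2 (hs1 z hz)
  have hsd : DifferentiableOn ℂ s D := (hLd.div_const 2).cexp
  have hsi : InjOn s D := fun z hz w hw h => hψi hz hw (by rw [← hs2 z hz, ← hs2 w hw, h])
  have hb := hs1 z₀ hz₀
  refine ⟨fun z => diskShift (s z₀) (s z), (differentiableOn_diskShift hb).comp hsd hsm,
    (diskShift_injOn hb).comp hsi hsm, fun z hz => mem_ball_zero_iff.2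
    (norm_diskShift_lt_one hb (hs1 z hz)), by simp [diskShift], ?_⟩
  set b := s z₀ with hbdef
  set w := s z₁ with hwdef
  have hw : ‖w‖ < 1 := hs1 z₁ hz₁
  have hab : b ^ 2 = -a := by rw [hs2 z₀ hz₀, hψ]; simp [diskShift, h0]
  have hba : a = -b ^ 2 := by rw [hab, neg_neg]
  have hf1 : ‖f z₁‖ < 1 := mem_ball_zero_iff.1 (hm hz₁)
  have hden := one_sub_conj_mul_ne_zero ha hf1
  have hw2 : w ^ 2 * (1 - (starRingEnd ℂ) a * f z₁) = f z₁ - a := by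
    rw [hs2 z₁ hz₁, hψ]
    exact div_mul_cancel₀ _ hden
  have hwb : w - b ≠ 0 := sub_ne_zero.2 fun h => hne (hsi hz₀ hz₁ h.symm)
  have hden1 := one_sub_conj_mul_ne_zero hb hw
  have hbn : ‖-b‖ < 1 := by rwa [norm_neg]
  have hden2 := one_sub_conj_mul_ne_zero hbn hw
  have hlt := norm_sub_lt_norm_one_sub_conj_mul hbn hw
  -- Undoing the square root, with `b ^ 2 = -a`, writes `f z₁` as the new value times a second disk
  -- automorphism evaluated at `w`, a factor of modulus less than `1`.
  have hfz : f z₁ = diskShift b w * ((w - -b) / (1 - (starRingEnd ℂ) (-b) * w)) := by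
    rw [diskShift, div_mul_div_comm, eq_div_iff (mul_ne_zero hden1 hden2)]
    rw [hba] at hw2
    simp only [map_neg, map_pow] at hw2 ⊢
    linear_combination -hw2
  have hFpos : 0 < ‖diskShift b w‖ := norm_pos_iff.2 (div_ne_zero hwb hden1)
  rw [hfz, norm_mul]
  refine mul_lt_of_lt_one_right hFpos ?_
  rw [norm_div, div_lt_one (norm_pos_iff.2 hden2)]
  exact hlt

/-- The Riemann mapping theorem for bounded domains on which injective functions have logarithms. -/
theorem exists_biholomorphic_ball (hD : IsOpen D) (hDc : IsPreconnected D) (hne : D.Nonempty)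
    (hb : Bornology.IsBounded D)
    (hlog : ∀ ψ : ℂ → ℂ, DifferentiableOn ℂ ψ D → InjOn ψ D → ∀ a, a ∉ ψ '' D →
      HasLogOn (fun z => ψ z - a) D) :
    ∃ φ : ℂ → ℂ, DifferentiableOn ℂ φ (Metric.ball 0 1) ∧ BijOn φ (Metric.ball 0 1) D := by
  obtain ⟨z₀, hz₀⟩ := hne
  obtain ⟨z₁, hz₁, hne⟩ : ∃ z₁ ∈ D, z₀ ≠ z₁ := by
    obtain ⟨r, hr, hball⟩ := Metric.isOpen_iff.1 hD z₀ hz₀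
    refine ⟨z₀ + (r / 2 : ℝ), hball ?_, ?_⟩
    · rw [Metric.mem_ball, dist_eq_norm, add_sub_cancel_left, Complex.norm_real, Real.norm_eq_abs,
        abs_of_pos (half_pos hr)]
      exact half_lt_self hr
    · simp [hr.ne']
  -- The extremal problem maximizes `‖f z₁‖` at a second point instead of the derivative at `z₀`; a
  -- positive maximum makes the limit nonconstant, as Hurwitz's theorem requires.
  let P : (ℂ → ℂ) → Prop := fun f => DifferentiableOn ℂ f D ∧ InjOn f D ∧
    MapsTo f D (Metric.ball 0 1) ∧ f z₀ = 0
  set A : Set ℝ := {x | ∃ f, P f ∧ ‖f z₁‖ = x} with hA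
  have hAb : BddAbove A := ⟨1, by
    rintro _ ⟨f, hf, rfl⟩
    exact (mem_ball_zero_iff.1 (hf.2.2.1 hz₁)).le⟩
  have hpos : ∀ f, P f → 0 < ‖f z₁‖ := fun f hf => norm_pos_iff.2 fun h =>
    hne (hf.2.1 hz₀ hz₁ (hf.2.2.2.trans h.symm))
  obtain ⟨R, hR0, hR⟩ := hb.subset_ball_lt 0 z₀
  have hAne : A.Nonempty := by
    refine ⟨_, fun z => (z - z₀) / R, ⟨by fun_prop, fun z _ w _ h => ?_, fun z hz => ?_, by simp⟩, rfl⟩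
    · have hR' : (R : ℂ) ≠ 0 := by exact_mod_cast hR0.ne'
      simpa [div_left_inj' hR'] using h
    · rw [mem_ball_zero_iff, norm_div, Complex.norm_real, Real.norm_eq_abs, abs_of_pos hR0,
        div_lt_one hR0, ← dist_eq_norm]
      exact hR hz
  obtain ⟨u, -, hu, huA⟩ := exists_seq_tendsto_sSup hAne hAb
  choose F hF hFu using huA
  obtain ⟨g, hg⟩ := exists_tendstoLocallyUniformlyOn (hyperfilter ℕ) hD (fun n => (hF n).1)
    (fun n => (hF n).2.2.1)
  have hgd : DifferentiableOn ℂ g D :=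
    hg.differentiableOn (Eventually.of_forall fun n => (hF n).1) hD
  have hg1 : ‖g z₁‖ = sSup A := by
    refine tendsto_nhds_unique (hg.tendsto_at hz₁).norm ?_
    simp only [hFu]
    exact hu.mono_left Nat.hyperfilter_le_atTop
  have hg0 : g z₀ = 0 := by
    refine tendsto_nhds_unique (hg.tendsto_at hz₀) ?_
    simp only [(hF _).2.2.2]
    exact tendsto_const_nhds
  have hg1pos : 0 < ‖g z₁‖ := by
    rw [hg1]
    exact (hpos _ (hF 0)).trans_le (le_csSup hAb ⟨_, hF 0, rfl⟩)
  have hgi : InjOn g D := injOn_of_tendstoLocallyUniformlyOn hD hDc (fun n => (hF n).1)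
    (fun n => (hF n).2.1) hg hz₀ hz₁ (by rw [hg0]; exact (norm_pos_iff.1 hg1pos).symm)
  have hgm : MapsTo g D (Metric.ball 0 1) := by
    have h1 : g '' D ⊆ Metric.closedBall 0 1 := by
      rintro _ ⟨z, hz, rfl⟩
      rw [mem_closedBall_zero_iff]
      exact le_of_tendsto (hg.tendsto_at hz).norm
        (Eventually.of_forall fun n => (mem_ball_zero_iff.1 ((hF n).2.2.1 hz)).le)
    have h2 := (isOpen_image_of_injOn hD hgd hgi).subset_interior_iff.2 h1
    rw [interior_closedBall _ one_ne_zero] at h2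
    exact mapsTo_iff_image_subset.2 h2
  have hgsurj : SurjOn g D (Metric.ball 0 1) := by
    intro a ha
    by_contra haD
    obtain ⟨G, hGd, hGi, hGm, hG0, hlt⟩ := exists_norm_lt_of_omitted_value hD hlog hz₀ hz₁ hne hgd hgi hgm hg0
      (mem_ball_zero_iff.1 ha) haD
    rw [hg1] at hlt
    exact absurd (le_csSup hAb ⟨G, ⟨hGd, hGi, hGm, hG0⟩, rfl⟩) (not_le.2 hlt)
  have hbij : BijOn g D (Metric.ball 0 1) := ⟨hgm, hgi, hgsurj⟩
  refine ⟨Function.invFunOn g D, fun w hw => ?_, ?_⟩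
  · obtain ⟨z, hz, rfl⟩ := hgsurj hw
    exact (differentiableAt_invFunOn_of_injOn hD hgd hgi hz).differentiableWithinAt
  · exact (hbij.symm hbij.invOn_invFunOn.symm)

end Riemann

theorem IsJordanCurve.exists_riemann_map {c : Circle → ℂ} (hc : IsJordanCurve c)
    (hne : (enclosedDomain c).Nonempty) :
    ∃ φ : ℂ → ℂ, DifferentiableOn ℂ φ (Metric.ball 0 1) ∧
      BijOn φ (Metric.ball 0 1) (enclosedDomain c) :=
  exists_biholomorphic_ball hc.isOpen_enclosedDomain hc.isPreconnected_enclosedDomain hne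
    hc.isBounded_enclosedDomain fun _ hψ hinj _ ha => hc.hasLogOn_sub hψ.continuousOn hinj
    (isOpen_image_of_injOn hc.isOpen_enclosedDomain hψ hinj) ha

/-! ### The length-area estimate. -/

section LengthArea

variable {ψ : ℂ → ℂ} {U : Set ℂ}

/-- Change of variables: the real Jacobian of multiplication by `ψ'` is `|ψ'|²`. -/
theorem lintegral_enorm_deriv_sq_eq_volume_image (hU : IsOpen U) (hψ : DifferentiableOn ℂ ψ U)
    (hinj : InjOn ψ U) : ∫⁻ z in U, ‖deriv ψ z‖ₑ ^ 2 = volume (ψ '' U) := by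
  have h := lintegral_image_eq_lintegral_abs_det_fderiv_mul volume hU.measurableSet
    (f' := fun z => (ContinuousLinearMap.toSpanSingleton ℂ (deriv ψ z)).restrictScalars ℝ)
    (fun z hz => ((hψ.differentiableAt (hU.mem_nhds hz)).hasDerivAt.hasFDerivAt.restrictScalars
      ℝ).hasFDerivWithinAt) hinj (fun _ => 1)
  rw [setLIntegral_one] at h
  rw [h]
  refine setLIntegral_congr_fun hU.measurableSet fun z _ => ?_
  have hdet : ((ContinuousLinearMap.toSpanSingleton ℂ (deriv ψ z)).restrictScalars ℝ).det
      = ‖deriv ψ z‖ ^ 2 := by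
    rw [← Complex.normSq_eq_norm_sq, ← Algebra.norm_complex_apply]
    simp [ContinuousLinearMap.det, LinearMap.det_restrictScalars]
  simp only [hdet, mul_one]
  rw [abs_of_nonneg (by positivity), ENNReal.ofReal_pow (norm_nonneg _), ofReal_norm]

theorem lintegral_Ioo_inv_eq_top {δ : ℝ} (hδ : 0 < δ) :
    ∫⁻ r in Ioo 0 δ, ENNReal.ofReal r⁻¹ = ⊤ := by
  by_contra hne
  have hint : IntegrableOn (fun r : ℝ => r⁻¹) (Ioo 0 δ) := by
    refine ⟨(by fun_prop : Measurable fun r : ℝ => r⁻¹).aestronglyMeasurable, ?_⟩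
    rw [hasFiniteIntegral_iff_ofReal]
    · exact lt_top_iff_ne_top.2 hne
    · exact (ae_restrict_mem measurableSet_Ioo).mono fun r hr => inv_nonneg.2 hr.1.le
  have h2 : IntervalIntegrable (fun r : ℝ => r⁻¹) volume 0 δ :=
    (intervalIntegrable_iff_integrableOn_Ioo_of_le hδ.le).2 hint
  rw [intervalIntegrable_inv_iff] at h2
  rcases h2 with h | h
  · exact hδ.ne h
  · exact h left_mem_uIcc

/-- If all small circles carried mass at least `ε`, the integral of `r g²` over the circle of radius
`r` would be at least a constant times `1 / r`, whose integral diverges at `0`. -/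
theorem exists_lintegral_circle_lt {g : ℂ → ENNReal} (hg : Measurable g)
    (hfin : ∫⁻ z, g z ^ 2 ≠ ⊤) (htop : ∀ z, g z ≠ ⊤) {ε δ : ℝ} (hε : 0 < ε) (hδ : 0 < δ) :
    ∃ r ∈ Ioo 0 δ, ∫⁻ θ in Ioo (-Real.pi) Real.pi,
      ENNReal.ofReal r * g (Complex.polarCoord.symm (r, θ)) < ENNReal.ofReal ε := by
  by_contra hcon
  push Not at hcon
  have hpi := Real.pi_pos
  -- Instead of the Cauchy–Schwarz inequality, `x ≤ lam * x ^ 2 + lam⁻¹` is used with `x = r g`;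
  -- this `lam` makes the last term contribute `ε / 2` over the angle `2π`.
  set lam : ℝ := 4 * Real.pi / ε with hlam
  have hlam0 : 0 < lam := by positivity
  have hcont : Continuous fun p : ℝ × ℝ => (Complex.polarCoord.symm p : ℂ) := by
    simp only [Complex.polarCoord_symm_apply]
    fun_prop
  have hpolar := Complex.lintegral_comp_polarCoord_symm (fun z => g z ^ 2)
  have htarget : polarCoord.target = Ioi (0 : ℝ) ×ˢ Ioo (-Real.pi) Real.pi := rfl
  rw [htarget, Measure.volume_eq_prod, setLIntegral_prod _ (by
    refine Measurable.aemeasurable ?_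
    simp only [smul_eq_mul]
    fun_prop)] at hpolar
  simp only [smul_eq_mul] at hpolar
  have hlow : ∀ r ∈ Ioo 0 δ, ENNReal.ofReal (ε / (2 * lam)) * ENNReal.ofReal r⁻¹ ≤
      ∫⁻ θ in Ioo (-Real.pi) Real.pi,
        ENNReal.ofReal r * g (Complex.polarCoord.symm (r, θ)) ^ 2 := by
    intro r hr
    have hr0 := hr.1
    have h1 := hcon r hr
    have hpt : ∀ θ : ℝ, ENNReal.ofReal r * g (Complex.polarCoord.symm (r, θ)) ≤
        ENNReal.ofReal (lam * r) * (ENNReal.ofReal r * g (Complex.polarCoord.symm (r, θ)) ^ 2)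
          + ENNReal.ofReal lam⁻¹ := by
      intro θ
      obtain ⟨x, hx⟩ : ∃ x : NNReal, (x : ENNReal) = g (Complex.polarCoord.symm (r, θ)) :=
        ⟨_, ENNReal.coe_toNNReal (htop _)⟩
      rw [← hx, ← ENNReal.ofReal_coe_nnreal, ← ENNReal.ofReal_pow x.coe_nonneg, ← ENNReal.ofReal_mul hr0.le,
        ← ENNReal.ofReal_mul hr0.le, ← ENNReal.ofReal_mul (by positivity),
        ← ENNReal.ofReal_add (by positivity) (by positivity)]
      refine ENNReal.ofReal_le_ofReal ?_
      have h2 : 0 ≤ (lam * (r * x) - 1) ^ 2 := sq_nonneg _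
      have h3 : 0 ≤ r * (x : ℝ) := by positivity
      have h4 : lam * (r * x) ≤ lam * (lam * r * (r * x ^ 2) + lam⁻¹) := by
        have : lam * (lam * r * (r * x ^ 2) + lam⁻¹) = (lam * (r * x)) ^ 2 + 1 := by
          field_simp
        rw [this]
        nlinarith [mul_nonneg hlam0.le h3]
      exact le_of_mul_le_mul_left h4 hlam0
    have h5 := h1.trans (lintegral_mono (μ := volume.restrict (Ioo (-Real.pi) Real.pi)) hpt)
    rw [lintegral_add_right _ measurable_const, lintegral_const_mul' _ _ ENNReal.ofReal_ne_top,
      lintegral_const, Measure.restrict_apply_univ, Real.volume_Ioo,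
      ← ENNReal.ofReal_mul (by positivity)] at h5
    have h6 : lam⁻¹ * (Real.pi - -Real.pi) = ε / 2 := by
      rw [hlam]; field_simp; ring
    have h7 : ENNReal.ofReal ε = ENNReal.ofReal (ε / 2) + ENNReal.ofReal (ε / 2) := by
      rw [← ENNReal.ofReal_add (by positivity) (by positivity)]; ring_nf
    rw [h6, h7] at h5
    have h8 := (ENNReal.add_le_add_iff_right ENNReal.ofReal_ne_top).1 h5
    have h9 : ε / (2 * lam) * r⁻¹ = (lam * r)⁻¹ * (ε / 2) := by field_simp
    rw [← ENNReal.ofReal_mul (by positivity), h9, ENNReal.ofReal_mul (by positivity)]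
    calc _ ≤ ENNReal.ofReal (lam * r)⁻¹ * (ENNReal.ofReal (lam * r) * _) := by gcongr
      _ = _ := by
        rw [← mul_assoc, ← ENNReal.ofReal_mul (by positivity), inv_mul_cancel₀ (by positivity),
          ENNReal.ofReal_one, one_mul]
  refine hfin ?_
  rw [← hpolar, eq_top_iff]
  calc (⊤ : ENNReal) = ENNReal.ofReal (ε / (2 * lam)) * ∫⁻ r in Ioo 0 δ, ENNReal.ofReal r⁻¹ := by
        rw [lintegral_Ioo_inv_eq_top hδ, ENNReal.mul_top]
        exact (ENNReal.ofReal_pos.2 (by positivity)).ne'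
    _ = ∫⁻ r in Ioo 0 δ, ENNReal.ofReal (ε / (2 * lam)) * ENNReal.ofReal r⁻¹ :=
        (lintegral_const_mul' _ _ ENNReal.ofReal_ne_top).symm
    _ ≤ _ := setLIntegral_mono' measurableSet_Ioo hlow
    _ ≤ _ := lintegral_mono_set Ioo_subset_Ioi_self

/-- The unit disk is centred at `1` so that the boundary point under study is the origin of polar
coordinates. -/
theorem mem_ball_one_iff_of_polar {r θ : ℝ} (hr : 0 < r) :
    Complex.polarCoord.symm (r, θ) ∈ Metric.ball (1 : ℂ) 1 ↔ r < 2 * Real.cos θ := by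
  rw [mem_ball_iff_norm, ← sq_lt_one_iff₀ (norm_nonneg _), ← Complex.normSq_eq_norm_sq,
    Complex.polarCoord_symm_apply, Complex.normSq_apply]
  have h1 : ((r : ℂ) * (Real.cos θ + Real.sin θ * Complex.I) - 1).re = r * Real.cos θ - 1 := by
    simp [-Complex.ofReal_cos, -Complex.ofReal_sin]
  have h2 : ((r : ℂ) * (Real.cos θ + Real.sin θ * Complex.I) - 1).im = r * Real.sin θ := by
    simp [-Complex.ofReal_cos, -Complex.ofReal_sin]
  dsimp only
  rw [h1, h2]
  have h3 : (r * Real.cos θ - 1) * (r * Real.cos θ - 1) + r * Real.sin θ * (r * Real.sin θ)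
      = 1 + r * (r - 2 * Real.cos θ) := by
    linear_combination r ^ 2 * Real.cos_sq_add_sin_sq θ
  rw [h3]
  constructor
  · intro h; nlinarith
  · intro h; nlinarith

/-- The image has finite area, so on some small circle about the boundary point `0` the image of the
arc inside the disk has length below `ε`, and this bounds its diameter. -/
theorem exists_norm_sub_le_on_circle (hψ : DifferentiableOn ℂ ψ (Metric.ball 1 1))
    (hinj : InjOn ψ (Metric.ball 1 1)) (hvol : volume (ψ '' Metric.ball 1 1) ≠ ⊤) {ε δ : ℝ}
    (hε : 0 < ε) (hδ : 0 < δ) :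
    ∃ r ∈ Ioo 0 δ, ∀ z ∈ Metric.ball (1 : ℂ) 1, ∀ w ∈ Metric.ball (1 : ℂ) 1, ‖z‖ = r → ‖w‖ = r →
      ‖ψ z - ψ w‖ ≤ ε := by
  set g : ℂ → ENNReal := (Metric.ball (1 : ℂ) 1).indicator fun z => ‖deriv ψ z‖ₑ with hg
  have hgm : Measurable g := (measurable_deriv ψ).enorm.indicator Metric.isOpen_ball.measurableSet
  have hfin : ∫⁻ z, g z ^ 2 ≠ ⊤ := by
    have : ∀ z, g z ^ 2 = (Metric.ball (1 : ℂ) 1).indicator (fun z => ‖deriv ψ z‖ₑ ^ 2) z := fun z => by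
      by_cases hz : z ∈ Metric.ball (1 : ℂ) 1 <;> simp [hg, hz]
    simp only [this]
    rwa [lintegral_indicator Metric.isOpen_ball.measurableSet,
      lintegral_enorm_deriv_sq_eq_volume_image Metric.isOpen_ball hψ hinj]
  have htop : ∀ z, g z ≠ ⊤ := fun z => by
    by_cases hz : z ∈ Metric.ball (1 : ℂ) 1 <;> simp [hg, hz]
  obtain ⟨r, hr, hlt⟩ := exists_lintegral_circle_lt hgm hfin htop hε hδ
  refine ⟨r, hr, ?_⟩
  have hr0 := hr.1
  have key : ∀ θ₁ ∈ Ioo (-Real.pi) Real.pi, ∀ θ₂ ∈ Ioo (-Real.pi) Real.pi, θ₁ ≤ θ₂ →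
      r < 2 * Real.cos θ₁ → r < 2 * Real.cos θ₂ →
      ‖ψ (Complex.polarCoord.symm (r, θ₂)) - ψ (Complex.polarCoord.symm (r, θ₁))‖ ≤ ε := by
    intro θ₁ hθ₁ θ₂ hθ₂ hle hc₁ hc₂
    -- Cosine is monotone on either side of `0`, so the arc between two points of the disk stays in
    -- the disk.
    have hin : ∀ θ ∈ Icc θ₁ θ₂, Complex.polarCoord.symm (r, θ) ∈ Metric.ball (1 : ℂ) 1 := by
      intro θ hθ
      rw [mem_ball_one_iff_of_polar hr0]
      rcases le_total 0 θ with h | h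
      · exact hc₂.trans_le (by
          have := Real.cos_le_cos_of_nonneg_of_le_pi h hθ₂.2.le hθ.2; linarith)
      · refine hc₁.trans_le ?_
        have := Real.cos_le_cos_of_nonneg_of_le_pi (x := -θ) (y := -θ₁) (by linarith)
          (by linarith [hθ₁.1]) (by linarith [hθ.1])
        rw [Real.cos_neg, Real.cos_neg] at this
        linarith
    have hpd : ∀ θ : ℝ, HasDerivAt (fun θ : ℝ => (Complex.polarCoord.symm (r, θ) : ℂ))
        (r * Complex.exp (θ * Complex.I) * Complex.I) θ := by
      intro θ
      have h1 : ∀ θ : ℝ, (Complex.polarCoord.symm (r, θ) : ℂ) = r * Complex.exp (θ * Complex.I) :=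
        fun θ => by rw [Complex.polarCoord_symm_apply, Complex.exp_mul_I]; simp
      simp only [h1]
      have h2 : HasDerivAt (fun θ : ℝ => (θ : ℂ) * Complex.I) Complex.I θ := by
        simpa using (Complex.ofRealCLM.hasDerivAt (x := θ)).mul_const Complex.I
      simpa [mul_assoc] using (h2.cexp).const_mul (r : ℂ)
    have hder : ∀ θ ∈ uIcc θ₁ θ₂, HasDerivAt (fun θ : ℝ => ψ (Complex.polarCoord.symm (r, θ)))
        (deriv ψ (Complex.polarCoord.symm (r, θ)) * (r * Complex.exp (θ * Complex.I) * Complex.I)) θ := by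
      intro θ hθ
      rw [uIcc_of_le hle] at hθ
      exact HasDerivAt.comp θ ((hψ.differentiableAt
        (Metric.isOpen_ball.mem_nhds (hin θ hθ))).hasDerivAt) (hpd θ)
    have hcontp : Continuous fun θ : ℝ => (Complex.polarCoord.symm (r, θ) : ℂ) :=
      continuous_iff_continuousAt.2 fun θ => (hpd θ).continuousAt
    have hcont : ContinuousOn (fun θ : ℝ => deriv ψ (Complex.polarCoord.symm (r, θ)) *
        (r * Complex.exp (θ * Complex.I) * Complex.I)) (uIcc θ₁ θ₂) := by
      rw [uIcc_of_le hle]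
      refine ContinuousOn.mul ?_ (by fun_prop)
      exact ((hψ.deriv Metric.isOpen_ball).continuousOn).comp hcontp.continuousOn hin
    have hftc := intervalIntegral.integral_eq_sub_of_hasDerivAt hder hcont.intervalIntegrable
    rw [← hftc, intervalIntegral.integral_of_le hle]
    have h3 : ‖∫ θ in Ioc θ₁ θ₂, deriv ψ (Complex.polarCoord.symm (r, θ)) *
        (r * Complex.exp (θ * Complex.I) * Complex.I)‖ₑ ≤ ENNReal.ofReal ε := by
      refine (enorm_integral_le_lintegral_enorm _).trans (le_trans ?_ hlt.le)
      refine le_trans (le_of_eq (setLIntegral_congr_fun measurableSet_Ioc fun θ hθ => ?_))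
        (lintegral_mono_set (Ioc_subset_Ioo hθ₁.1.le hθ₂.2))
      simp only [hg, indicator_of_mem (hin θ (Ioc_subset_Icc_self hθ))]
      rw [enorm_mul, enorm_mul, enorm_mul, ← ofReal_norm (Complex.exp _), ← ofReal_norm (r : ℂ),
        Complex.norm_exp_ofReal_mul_I, ← ofReal_norm Complex.I, Complex.norm_I, Complex.norm_real,
        Real.norm_eq_abs, abs_of_pos hr0, ENNReal.ofReal_one, mul_one, mul_one, mul_comm]
    rwa [← ofReal_norm, ENNReal.ofReal_le_ofReal_iff hε.le] at h3
  have hpolar : ∀ z : ℂ, ‖z‖ = r → z = Complex.polarCoord.symm (r, z.arg) := fun z hz => by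
    rw [Complex.polarCoord_symm_apply, ← hz]
    exact (Complex.norm_mul_cos_add_sin_mul_I z).symm.trans (by simp)
  have hargs : ∀ z ∈ Metric.ball (1 : ℂ) 1, ‖z‖ = r →
      z.arg ∈ Ioo (-Real.pi) Real.pi ∧ r < 2 * Real.cos z.arg := by
    intro z hz hzr
    have h := hz
    rw [hpolar z hzr, mem_ball_one_iff_of_polar hr0] at h
    refine ⟨⟨Complex.neg_pi_lt_arg z, lt_of_le_of_ne (Complex.arg_le_pi z) fun he => ?_⟩, h⟩
    rw [he, Real.cos_pi] at h
    linarith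
  intro z hz w hw hzr hwr
  obtain ⟨hz1, hz2⟩ := hargs z hz hzr
  obtain ⟨hw1, hw2⟩ := hargs w hw hwr
  rw [hpolar z hzr, hpolar w hwr]
  rcases le_total z.arg w.arg with h | h
  · rw [norm_sub_rev]; exact key _ hz1 _ hw1 h hz2 hw2
  · exact key _ hw1 _ hz1 h hw2 hz2

end LengthArea

/-! ### Carathéodory's theorem: continuous extension to the boundary. -/

section Caratheodory

variable {c : Circle → ℂ} {φ : ℂ → ℂ}

/-- Small subsets of a Jordan curve lie on small arcs. -/
theorem IsJordanCurve.exists_small_arc (hc : IsJordanCurve c) {ε : ℝ} (hε : 0 < ε) :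
    ∃ η > 0, ∀ E ⊆ range c, (∀ x ∈ E, ∀ y ∈ E, ‖x - y‖ ≤ η) →
      ∃ J ⊆ range c, E ⊆ J ∧ IsCompact J ∧ IsPreconnected J ∧ ∀ x ∈ J, ∃ y ∈ E, ‖x - y‖ ≤ ε := by
  obtain ⟨δ, hδ, huc⟩ := Metric.uniformContinuous_iff.1
    (CompactSpace.uniformContinuous_of_continuous hc.1) ε hε
  obtain ⟨s, hs, hexp⟩ : ∃ s > 0, ∀ t ∈ Icc (-s) s, dist (Circle.exp t) 1 < δ := by
    have h : ContinuousAt Circle.exp 0 := Circle.exp.continuous.continuousAt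
    obtain ⟨s, hs, h⟩ := Metric.continuousAt_iff.1 h δ hδ
    refine ⟨s / 2, half_pos hs, fun t ht => ?_⟩
    rw [← Circle.exp_zero]
    refine h ?_
    rw [Real.dist_eq, sub_zero]
    exact (abs_le.2 ht).trans_lt (half_lt_self hs)
  have hdist : ∀ z w : Circle, dist (w * z) w = dist z 1 := fun z w => by
    change dist ((w * z : Circle) : ℂ) (w : ℂ) = dist (z : ℂ) ((1 : Circle) : ℂ)
    rw [dist_eq_norm, dist_eq_norm, Circle.coe_mul, Circle.coe_one,
      ← mul_sub_one, norm_mul, Circle.norm_coe, one_mul]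
  -- Pairs of parameters whose quotient leaves the small arc form a compact set, on which `‖c z - c
  -- w‖` has a positive minimum.
  obtain ⟨η, hη, hsep⟩ : ∃ η > 0, ∀ z w : Circle, ‖c z - c w‖ ≤ η →
      w⁻¹ * z ∈ Circle.exp '' Ioo (-s) s := by
    set B : Set (Circle × Circle) := {q | q.2⁻¹ * q.1 ∉ Circle.exp '' Ioo (-s) s} with hB
    have hBc : IsCompact B := by
      refine IsClosed.isCompact (isOpen_compl_iff.1 ?_)
      have : Bᶜ = (fun q : Circle × Circle => q.2⁻¹ * q.1) ⁻¹' (Circle.exp '' Ioo (-s) s) := by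
        ext q; simp [hB, and_assoc]
      rw [this]
      exact (isLocalHomeomorph_circleExp.isOpenMap _ isOpen_Ioo).preimage (by fun_prop)
    have hcc := hc.1
    rcases B.eq_empty_or_nonempty with he | hne
    · refine ⟨1, one_pos, fun z w _ => ?_⟩
      by_contra h
      exact (he ▸ (show (z, w) ∈ B from h) : (z, w) ∈ (∅ : Set (Circle × Circle)))
    · obtain ⟨q, hq, hmin⟩ := hBc.exists_isMinOn hne (f := fun q => ‖c q.1 - c q.2‖)
        (by fun_prop)
      have hq0 : 0 < ‖c q.1 - c q.2‖ := by
        refine norm_pos_iff.2 (sub_ne_zero.2 fun h => hq ?_)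
        rw [hc.2 h, inv_mul_cancel]
        exact ⟨0, by simp [hs], Circle.exp_zero⟩
      refine ⟨‖c q.1 - c q.2‖ / 2, half_pos hq0, fun z w hzw => ?_⟩
      by_contra h
      have := hmin (show (z, w) ∈ B from h)
      simp only [mem_ofPred_eq] at this
      linarith
  refine ⟨η, hη, fun E hE hEd => ?_⟩
  rcases E.eq_empty_or_nonempty with rfl | ⟨_, hx⟩
  · exact ⟨∅, empty_subset _, subset_rfl, isCompact_empty, isPreconnected_empty, by simp⟩
  obtain ⟨w, rfl⟩ := hE hx
  have hcont : Continuous fun t : ℝ => c (w * Circle.exp t) := hc.1.comp (by fun_prop)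
  refine ⟨(fun t : ℝ => c (w * Circle.exp t)) '' Icc (-s) s, ?_, ?_, isCompact_Icc.image hcont,
    isPreconnected_Icc.image _ hcont.continuousOn, ?_⟩
  · rintro _ ⟨t, -, rfl⟩; exact mem_range_self _
  · intro y hy
    obtain ⟨z, rfl⟩ := hE hy
    obtain ⟨t, ht, htz⟩ := hsep z w (hEd _ hy _ hx)
    exact ⟨t, Ioo_subset_Icc_self ht, by simp [htz]⟩
  · rintro _ ⟨t, ht, rfl⟩
    refine ⟨_, hx, ?_⟩
    rw [← dist_eq_norm]
    exact (huc (by rw [hdist]; exact hexp t ht)).le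

theorem continuousOn_invFunOn_of_injOn {f : ℂ → ℂ} {U : Set ℂ} (hU : IsOpen U)
    (hf : DifferentiableOn ℂ f U) (hinj : InjOn f U) :
    ContinuousOn (Function.invFunOn f U) (f '' U) := by
  rintro _ ⟨a, ha, rfl⟩
  exact (continuousAt_invFunOn_of_injOn hU hf hinj ha).continuousWithinAt

/-- The intermediate value theorem for `u ∘ φ⁻¹` on the connected set `T`. -/
theorem exists_eq_zero_of_isPreconnected (hd : DifferentiableOn ℂ φ (Metric.ball 0 1)) {D : Set ℂ}
    (hb : BijOn φ (Metric.ball 0 1) D) {T : Set ℂ} (hT : IsPreconnected T) (hTD : T ⊆ D) {u : ℂ → ℝ}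
    (hu : Continuous u) {z w : ℂ} (hz : z ∈ Metric.ball (0 : ℂ) 1) (hw : w ∈ Metric.ball (0 : ℂ) 1)
    (hzT : φ z ∈ T) (hwT : φ w ∈ T) (huz : u z ≤ 0) (huw : 0 ≤ u w) :
    ∃ x ∈ Metric.ball (0 : ℂ) 1, φ x ∈ T ∧ u x = 0 := by
  have hg := continuousOn_invFunOn_of_injOn Metric.isOpen_ball hd hb.injOn
  rw [hb.image_eq] at hg
  have h := hT.image _ ((hu.comp_continuousOn hg).mono hTD)
  have hmem : (0 : ℝ) ∈ (u ∘ Function.invFunOn φ (Metric.ball 0 1)) '' T := by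
    refine h.ordConnected.out ⟨φ z, hzT, rfl⟩ ⟨φ w, hwT, rfl⟩ ⟨?_, ?_⟩
    · simpa [hb.injOn.leftInvOn_invFunOn hz] using huz
    · simpa [hb.injOn.leftInvOn_invFunOn hw] using huw
  obtain ⟨y, hy, hy0⟩ := hmem
  obtain ⟨x, hx, rfl⟩ := hb.surjOn (hTD hy)
  refine ⟨x, hx, hy, ?_⟩
  simpa [hb.injOn.leftInvOn_invFunOn hx] using hy0

theorem isPreconnected_compl_closedBall (a : ℂ) {R : ℝ} (hR : 0 < R) :
    IsPreconnected (Metric.closedBall a R)ᶜ := by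
  have h : (Metric.closedBall a R)ᶜ = (fun z => a + z) '' {z : ℂ | R < ‖z‖} := by
    ext z
    simp only [mem_compl_iff, Metric.mem_closedBall, dist_eq_norm, not_le, mem_image, mem_ofPred_eq]
    exact ⟨fun h => ⟨z - a, h, by ring⟩, by rintro ⟨y, hy, rfl⟩; simpa using hy⟩
  rw [h]
  exact (isPreconnected_norm_gt R hR).image _ (by fun_prop)

/-- A compact set meeting a Jordan curve in a connected set and separating two points of the inner
domain meets each level set of a function changing sign between these points. -/
theorem IsJordanCurve.exists_mem_of_separates (hc : IsJordanCurve c)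
    (hd : DifferentiableOn ℂ φ (Metric.ball 0 1))
    (hb : BijOn φ (Metric.ball 0 1) (enclosedDomain c)) {K : Set ℂ} (hK : IsCompact K)
    (hKc : IsPreconnected (K ∩ range c)) {u : ℂ → ℝ}
    (hu : Continuous u) {z w : ℂ} (hz : z ∈ Metric.ball (0 : ℂ) 1) (hw : w ∈ Metric.ball (0 : ℂ) 1)
    (huz : u z ≤ 0) (huw : 0 ≤ u w) (hzw : φ w ∈ connectedComponentIn Kᶜ (φ z)) :
    ∃ x ∈ Metric.ball (0 : ℂ) 1, φ x ∉ K ∧ u x = 0 := by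
  have hzD := hb.mapsTo hz
  have hwD := hb.mapsTo hw
  have h := mem_connectedComponentIn_compl_union hK hc.isCompact_range hKc hzw
    (hc.mem_connectedComponentIn_of_mem hzD hwD)
  have hsub := connectedComponentIn_subset (K ∪ range c)ᶜ (φ z)
  have hzz : φ z ∈ connectedComponentIn (K ∪ range c)ᶜ (φ z) :=
    mem_connectedComponentIn (connectedComponentIn_nonempty_iff.1 ⟨_, h⟩)
  have hTD : connectedComponentIn (K ∪ range c)ᶜ (φ z) ⊆ enclosedDomain c :=
    hc.subset_enclosedDomain isPreconnected_connectedComponentIn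
      (hsub.trans (compl_subset_compl.2 subset_union_right)) hzz hzD
  obtain ⟨x, hx, hxT, hx0⟩ := exists_eq_zero_of_isPreconnected hd hb
    isPreconnected_connectedComponentIn hTD hu hz hw hzz h huz huw
  exact ⟨x, hx, fun hxK => hsub hxT (Or.inl hxK), hx0⟩

/-- The oscillation of the Riemann map near boundary points tends to zero. -/
theorem IsJordanCurve.exists_oscillation_le (hc : IsJordanCurve c)
    (hd : DifferentiableOn ℂ φ (Metric.ball 0 1))
    (hb : BijOn φ (Metric.ball 0 1) (enclosedDomain c)) {ζ : ℂ} (hζ : ‖ζ‖ = 1) {ε : ℝ} (hε : 0 < ε) :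
    ∃ ρ > 0, ∀ z ∈ Metric.ball (0 : ℂ) 1, ∀ w ∈ Metric.ball (0 : ℂ) 1, ‖z - ζ‖ < ρ → ‖w - ζ‖ < ρ →
      ‖φ z - φ w‖ ≤ ε := by
  have h0 : (0 : ℂ) ∈ Metric.ball (0 : ℂ) 1 := Metric.mem_ball_self one_pos
  have h4 : (1 / 4 : ℂ) ∈ Metric.ball (0 : ℂ) 1 := by
    rw [mem_ball_zero_iff]; norm_num
  have hpos : 0 < ‖φ 0 - φ (1 / 4)‖ := by
    refine norm_pos_iff.2 (sub_ne_zero.2 fun h => ?_)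
    have := hb.injOn h0 h4 h
    norm_num at this
  -- The second bound ensures that a disk of radius `κ` cannot contain both `φ 0` and `φ (1 / 4)`.
  -- As `r < 1 / 2`, both `0` and `1 / 4` are farther than `r` from `ζ`.
  set κ : ℝ := min (ε / 2) (‖φ 0 - φ (1 / 4)‖ / 3) with hκ
  have hκ0 : 0 < κ := lt_min (by positivity) (by positivity)
  obtain ⟨η, hη, harc⟩ := hc.exists_small_arc (half_pos hκ0)
  -- The substitution `u ↦ ζ (1 - u)` carries the disk about `1` to the unit disk and `0` to `ζ`.
  have hζmul : ∀ u ∈ Metric.ball (1 : ℂ) 1, ζ * (1 - u) ∈ Metric.ball (0 : ℂ) 1 := fun u hu => by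
    rw [mem_ball_zero_iff, norm_mul, hζ, one_mul, norm_sub_rev]
    exact mem_ball_iff_norm.1 hu
  have hζ0 : ζ ≠ 0 := norm_pos_iff.1 (by rw [hζ]; exact one_pos)
  have hψd : DifferentiableOn ℂ (fun u => φ (ζ * (1 - u))) (Metric.ball 1 1) :=
    hd.comp (by fun_prop) hζmul
  have hψi : InjOn (fun u => φ (ζ * (1 - u))) (Metric.ball 1 1) := fun u hu v hv h => by
    have := hb.injOn (hζmul u hu) (hζmul v hv) h
    simpa [hζ0] using this
  have hψv : volume ((fun u => φ (ζ * (1 - u))) '' Metric.ball 1 1) ≠ ⊤ := by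
    refine (measure_mono ?_ |>.trans_lt hc.isBounded_enclosedDomain.measure_lt_top).ne
    rintro _ ⟨u, hu, rfl⟩
    exact hb.mapsTo (hζmul u hu)
  obtain ⟨r, hr, hosc⟩ := exists_norm_sub_le_on_circle hψd hψi hψv
    (lt_min hη (half_pos hκ0)) (half_pos one_pos)
  have hr0 := hr.1
  set S : Set ℂ := {z | z ∈ Metric.ball (0 : ℂ) 1 ∧ ‖z - ζ‖ = r} with hS
  have hSosc : ∀ z ∈ S, ∀ w ∈ S, ‖φ z - φ w‖ ≤ min η (κ / 2) := by
    have hrep : ∀ z ∈ S, ∃ u ∈ Metric.ball (1 : ℂ) 1, ‖u‖ = r ∧ z = ζ * (1 - u) := by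
      intro z hz
      refine ⟨1 - z / ζ, ?_, ?_, by field_simp; ring⟩
      · rw [mem_ball_iff_norm, sub_sub_cancel_left, norm_neg, norm_div, hζ, div_one]
        exact mem_ball_zero_iff.1 hz.1
      · have : 1 - z / ζ = -((z - ζ) / ζ) := by field_simp; ring
        rw [this, norm_neg, norm_div, hζ, div_one, hz.2]
    intro z hz w hw
    obtain ⟨u, hu, hur, rfl⟩ := hrep z hz
    obtain ⟨v, hv, hvr, rfl⟩ := hrep w hw
    exact hosc u hu v hv hur hvr
  have haS : ζ * (1 - r) ∈ S := by
    have h1 : ((1 : ℂ) - r) = ((1 - r : ℝ) : ℂ) := by push_cast; ring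
    refine ⟨?_, ?_⟩
    · rw [mem_ball_zero_iff, norm_mul, hζ, h1, Complex.norm_real, Real.norm_eq_abs, one_mul, abs_lt]
      constructor <;> linarith [hr.2]
    · rw [mul_one_sub, sub_sub_cancel_left, norm_neg, norm_mul, hζ, Complex.norm_real,
        Real.norm_eq_abs, abs_of_pos hr0, one_mul]
  set a := φ (ζ * (1 - r)) with ha
  have hcl : ∀ x ∈ closure (φ '' S), ∀ y ∈ closure (φ '' S), ‖x - y‖ ≤ min η (κ / 2) := by
    intro x hx y hy
    have h1 : (x, y) ∈ closure ((φ '' S) ×ˢ (φ '' S)) := by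
      rw [closure_prod_eq]; exact ⟨hx, hy⟩
    refine closure_minimal (t := {q : ℂ × ℂ | ‖q.1 - q.2‖ ≤ min η (κ / 2)}) ?_
      (isClosed_le (by fun_prop) continuous_const) h1
    rintro ⟨_, _⟩ ⟨⟨z, hz, rfl⟩, ⟨w, hw, rfl⟩⟩
    exact hSosc z hz w hw
  have hacl : a ∈ closure (φ '' S) := subset_closure (mem_image_of_mem φ haS)
  obtain ⟨J, hJc, hEJ, hJK, hJp, hJd⟩ := harc (closure (φ '' S) ∩ range c) inter_subset_right
    fun x hx y hy => (hcl x hx.1 y hy.1).trans (min_le_left _ _)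
  -- The closed image of a short crosscut, completed by a small arc `J` of the curve so that `K`
  -- meets the curve in a connected set.
  set K : Set ℂ := closure (φ '' S) ∪ J with hKdef
  have hKball : K ⊆ Metric.closedBall a κ := by
    rintro x (hx | hx)
    · rw [mem_closedBall_iff_norm]
      linarith [hcl x hx a hacl, min_le_right η (κ / 2)]
    · obtain ⟨y, hy, hxy⟩ := hJd x hx
      rw [mem_closedBall_iff_norm]
      have h1 := norm_sub_le_norm_sub_add_norm_sub x y a
      linarith [hcl y hy.1 a hacl, min_le_right η (κ / 2)]
  have hKcomp : IsCompact K := by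
    refine IsCompact.union ?_ hJK
    refine Metric.isCompact_of_isClosed_isBounded isClosed_closure ?_
    exact Metric.isBounded_closedBall.subset (subset_union_left.trans hKball)
  have hKc : K ∩ range c = J := by
    rw [hKdef, union_inter_distrib_right, inter_eq_self_of_subset_left hJc]
    exact union_eq_self_of_subset_left hEJ
  -- If both images were outside the disk around `a`, they could be joined off `K`. Then some point
  -- off `K` would come from the circle `‖x - ζ‖ = r`, yet the image of that circle is in `K`.
  have main : ∀ z ∈ Metric.ball (0 : ℂ) 1, ∀ w ∈ Metric.ball (0 : ℂ) 1, ‖z - ζ‖ < r → r < ‖w - ζ‖ →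
      φ z ∈ Metric.closedBall a κ ∨ φ w ∈ Metric.closedBall a κ := by
    intro z hz w hw hzr hwr
    by_contra hcon
    push Not at hcon
    have hmem : φ w ∈ connectedComponentIn Kᶜ (φ z) :=
      (isPreconnected_compl_closedBall a hκ0).subset_connectedComponentIn hcon.1
        (compl_subset_compl.2 hKball) hcon.2
    obtain ⟨x, hx, hxK, hx0⟩ := hc.exists_mem_of_separates hd hb hKcomp (by rwa [hKc])
      (u := fun x => ‖x - ζ‖ - r) (by fun_prop) hz hw (by linarith) (by linarith) hmem
    exact hxK (Or.inl (subset_closure ⟨x, ⟨hx, by linarith⟩, rfl⟩))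
  -- Otherwise the small disk about `a` would contain `φ 0` and `φ (1 / 4)`, against the choice of
  -- `κ`.
  have hin : ∀ z ∈ Metric.ball (0 : ℂ) 1, ‖z - ζ‖ < r → φ z ∈ Metric.closedBall a κ := by
    intro z hz hzr
    by_contra hcon
    have e0 := (main z hz 0 h0 hzr (by
      rw [zero_sub, norm_neg, hζ]; linarith [hr.2])).resolve_left hcon
    have e4 := (main z hz (1 / 4) h4 hzr (by
      have h1 := norm_sub_norm_le ζ (1 / 4)
      rw [norm_sub_rev] at h1
      have h2 : ‖(1 / 4 : ℂ)‖ = 1 / 4 := by norm_num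
      rw [h2, hζ] at h1
      linarith [hr.2])).resolve_left hcon
    rw [mem_closedBall_iff_norm] at e0
    rw [mem_closedBall_iff_norm'] at e4
    have h1 := norm_sub_le_norm_sub_add_norm_sub (φ 0) a (φ (1 / 4))
    linarith [min_le_right (ε / 2) (‖φ 0 - φ (1 / 4)‖ / 3)]
  refine ⟨r, hr0, fun z hz w hw hzr hwr => ?_⟩
  have e1 := hin z hz hzr
  have e2 := hin w hw hwr
  rw [mem_closedBall_iff_norm] at e1
  rw [mem_closedBall_iff_norm'] at e2
  have h1 := norm_sub_le_norm_sub_add_norm_sub (φ z) a (φ w)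
  linarith [min_le_left (ε / 2) (‖φ 0 - φ (1 / 4)‖ / 3)]

theorem IsJordanCurve.exists_continuousOn_extension (hc : IsJordanCurve c)
    (hd : DifferentiableOn ℂ φ (Metric.ball 0 1))
    (hb : BijOn φ (Metric.ball 0 1) (enclosedDomain c)) :
    ∃ Φ : ℂ → ℂ, ContinuousOn Φ (Metric.closedBall 0 1) ∧ EqOn Φ φ (Metric.ball 0 1) := by
  have hcl : closure (Metric.ball (0 : ℂ) 1) = Metric.closedBall 0 1 := closure_ball 0 one_ne_zero
  refine ⟨extendFrom (Metric.ball 0 1) φ, continuousOn_extendFrom hcl.ge fun x hx => ?_, fun x hx => ?_⟩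
  · have hne : (𝓝[Metric.ball 0 1] x).NeBot := mem_closure_iff_nhdsWithin_neBot.1 (hcl ▸ hx)
    by_cases hxb : x ∈ Metric.ball (0 : ℂ) 1
    · exact ⟨_, hd.continuousOn x hxb⟩
    · have hx1 : ‖x‖ = 1 := by
        rw [mem_closedBall_zero_iff] at hx
        rw [mem_ball_zero_iff, not_lt] at hxb
        exact le_antisymm hx hxb
      refine cauchy_map_iff_exists_tendsto.1 (Metric.cauchy_iff.2 ⟨hne.map _, fun ε hε => ?_⟩)
      obtain ⟨ρ, hρ, h⟩ := hc.exists_oscillation_le hd hb hx1 (half_pos hε)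
      refine ⟨φ '' (Metric.ball x ρ ∩ Metric.ball 0 1), image_mem_map
        (inter_mem (mem_nhdsWithin_of_mem_nhds (Metric.ball_mem_nhds x hρ)) self_mem_nhdsWithin), ?_⟩
      rintro _ ⟨z, hz, rfl⟩ _ ⟨w, hw, rfl⟩
      rw [dist_eq_norm]
      exact (h z hz.2 w hw.2 (mem_ball_iff_norm.1 hz.1) (mem_ball_iff_norm.1 hw.1)).trans_lt
        (half_lt_self hε)
  · exact extendFrom_eq (subset_closure hx) (hd.continuousOn x hx)

end Caratheodory

/-! ### Carathéodory's theorem: injectivity on the boundary. -/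

section Boundary

variable {c : Circle → ℂ} {φ : ℂ → ℂ}

/-- The value is a limit of points of the domain. Were it inside the domain, continuity of the
inverse there would place `ζ` in the open disk. -/
theorem IsJordanCurve.apply_mem_range (hc : IsJordanCurve c)
    (hcont : ContinuousOn φ (Metric.closedBall 0 1)) (hd : DifferentiableOn ℂ φ (Metric.ball 0 1))
    (hb : BijOn φ (Metric.ball 0 1) (enclosedDomain c)) {ζ : ℂ} (hζ : ‖ζ‖ = 1) : φ ζ ∈ range c := by
  have hζc : ζ ∈ Metric.closedBall (0 : ℂ) 1 := mem_closedBall_zero_iff.2 hζ.le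
  have hζb : ζ ∉ Metric.ball (0 : ℂ) 1 := fun h => by
    rw [mem_ball_zero_iff, hζ] at h; exact lt_irrefl _ h
  have hcl : ζ ∈ closure (Metric.ball (0 : ℂ) 1) := by rwa [closure_ball 0 one_ne_zero]
  have hne := mem_closure_iff_nhdsWithin_neBot.1 hcl
  have ht : Tendsto φ (𝓝[Metric.ball 0 1] ζ) (𝓝 (φ ζ)) :=
    (hcont ζ hζc).mono_left (nhdsWithin_mono _ Metric.ball_subset_closedBall)
  rw [← hc.frontier_enclosedDomain ⟨_, hb.mapsTo (Metric.mem_ball_self one_pos)⟩,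
    hc.isOpen_enclosedDomain.frontier_eq]
  refine ⟨mem_closure_of_tendsto ht (by
    filter_upwards [self_mem_nhdsWithin] with z hz using hb.mapsTo hz), fun hD => ?_⟩
  obtain ⟨z, hz, hzζ⟩ := hb.surjOn hD
  have hg := continuousAt_invFunOn_of_injOn Metric.isOpen_ball hd hb.injOn hz
  rw [hzζ] at hg
  have h1 := hg.tendsto.comp ht
  rw [← hzζ, hb.injOn.leftInvOn_invFunOn hz] at h1
  have h2 : Tendsto (Function.invFunOn φ (Metric.ball 0 1) ∘ φ) (𝓝[Metric.ball 0 1] ζ) (𝓝 ζ) := by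
    refine (tendsto_id.mono_left nhdsWithin_le_nhds).congr' ?_
    filter_upwards [self_mem_nhdsWithin] with x hx using (hb.injOn.leftInvOn_invFunOn hx).symm
  exact hζb (tendsto_nhds_unique h2 h1 ▸ hz)

/-- A function on the closed disk that takes the value `p` on an open arc takes it at the centre. -/
theorem apply_zero_eq_of_eq_on_arc (hcont : ContinuousOn φ (Metric.closedBall 0 1))
    (hd : DifferentiableOn ℂ φ (Metric.ball 0 1)) {u : ℂ → ℝ} (hu : Continuous u) {p ζ₀ : ℂ}
    (hζ₀ : ‖ζ₀‖ = 1) (huζ : 0 < u ζ₀) (h : ∀ ζ, ‖ζ‖ = 1 → 0 < u ζ → φ ζ = p) : φ 0 = p := by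
  -- Finitely many rotations of the arc cover the circle. The product of the rotated functions `φ -
  -- p` vanishes on the boundary, hence at the centre by the maximum principle.
  obtain ⟨s, hs⟩ := (isCompact_univ (X := Circle)).elim_finite_subcover
    (fun v : Circle => {z : Circle | 0 < u (v * z)})
    (fun v => isOpen_lt continuous_const (by fun_prop)) (fun z _ => by
      refine mem_iUnion.2 ⟨⟨ζ₀, mem_sphere_zero_iff_norm.2 hζ₀⟩ * z⁻¹, ?_⟩
      change 0 < u (ζ₀ * (z⁻¹ : Circle) * z)
      rwa [mul_assoc, ← Circle.coe_mul, inv_mul_cancel, Circle.coe_one, mul_one])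
  have hrot : ∀ v : Circle, MapsTo (fun z : ℂ => (v : ℂ) * z) (Metric.closedBall 0 1)
      (Metric.closedBall 0 1) := fun v z hz => by
    simpa [mem_closedBall_zero_iff, Circle.norm_coe] using hz
  have hrot' : ∀ v : Circle, MapsTo (fun z : ℂ => (v : ℂ) * z) (Metric.ball 0 1)
      (Metric.ball 0 1) := fun v z hz => by
    simpa [mem_ball_zero_iff, Circle.norm_coe] using hz
  have hdc : DiffContOnCl ℂ (fun z => ∏ v ∈ s, (φ ((v : ℂ) * z) - p)) (Metric.ball 0 1) := by
    refine ⟨?_, ?_⟩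
    · refine DifferentiableOn.fun_finsetProd fun v _ => DifferentiableOn.sub_const ?_ _
      exact hd.comp (by fun_prop) (hrot' v)
    · rw [closure_ball 0 one_ne_zero]
      refine continuousOn_finsetProd _ fun v _ => ContinuousOn.sub ?_ continuousOn_const
      exact hcont.comp (by fun_prop) (hrot v)
  have h0 := Complex.norm_le_of_forall_mem_frontier_norm_le Metric.isBounded_ball hdc (C := 0)
    (fun z hz => by
      rw [frontier_ball 0 one_ne_zero, mem_sphere_zero_iff_norm] at hz
      obtain ⟨v, hv, hvz⟩ := mem_iUnion₂.1 (hs (mem_univ ⟨z, mem_sphere_zero_iff_norm.2 hz⟩))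
      rw [Finset.prod_eq_zero hv, norm_zero]
      rw [h _ (by simp [hz, Circle.norm_coe]) hvz, sub_self]) (subset_closure (Metric.mem_ball_self one_pos))
  rw [norm_le_zero_iff, Finset.prod_eq_zero_iff] at h0
  obtain ⟨v, -, hv⟩ := h0
  rwa [mul_zero, sub_eq_zero] at hv

/-- The signed distance (up to a factor) from the line through `a` and `b`. -/
noncomputable def chordSide (a b z : ℂ) : ℝ := ((z - a) * (starRingEnd ℂ) (b - a)).im

theorem continuous_chordSide (a b : ℂ) : Continuous (chordSide a b) := by
  unfold chordSide; fun_prop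

theorem mem_segment_of_chordSide_eq_zero {a b z : ℂ} (ha : ‖a‖ = 1) (hb : ‖b‖ = 1) (hab : a ≠ b)
    (hz : ‖z‖ < 1) (h : chordSide a b z = 0) : z ∈ segment ℝ a b := by
  have hd : b - a ≠ 0 := sub_ne_zero.2 hab.symm
  have hn : 0 < Complex.normSq (b - a) := Complex.normSq_pos.2 hd
  set t : ℝ := ((z - a) * (starRingEnd ℂ) (b - a)).re / Complex.normSq (b - a) with ht
  have hzt : z = a + t * (b - a) := by
    have h1 : (z - a) * (starRingEnd ℂ) (b - a) = ((t * Complex.normSq (b - a) : ℝ) : ℂ) := by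
      rw [ht, div_mul_cancel₀ _ hn.ne']
      exact Complex.ext rfl h
    have h2 : (z - a - t * (b - a)) * (starRingEnd ℂ) (b - a) = 0 := by
      rw [sub_mul, h1, mul_assoc, Complex.mul_conj]
      push_cast; ring
    rcases mul_eq_zero.1 h2 with h3 | h3
    · linear_combination h3
    · exact absurd ((map_eq_zero _).1 h3) hd
  have ha2 : a.re ^ 2 + a.im ^ 2 = 1 := by
    have := Complex.normSq_eq_norm_sq a
    rw [ha, Complex.normSq_apply] at this; linarith
  have hb2 : b.re ^ 2 + b.im ^ 2 = 1 := by
    have := Complex.normSq_eq_norm_sq b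
    rw [hb, Complex.normSq_apply] at this; linarith
  have hz2 : z.re ^ 2 + z.im ^ 2 < 1 := by
    have := Complex.normSq_eq_norm_sq z
    rw [Complex.normSq_apply] at this
    have h1 : ‖z‖ ^ 2 < 1 := pow_lt_one₀ (norm_nonneg _) hz two_ne_zero
    linarith
  have hre : z.re = a.re + t * (b.re - a.re) := by rw [hzt]; simp
  have him : z.im = a.im + t * (b.im - a.im) := by rw [hzt]; simp
  have hn' : Complex.normSq (b - a) = (b.re - a.re) ^ 2 + (b.im - a.im) ^ 2 := by
    rw [Complex.normSq_apply]; simp; ring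
  -- Being inside the disk forces `t (t - 1) < 0`, so `z` lies strictly between the endpoints.
  have key : z.re ^ 2 + z.im ^ 2 = 1 + Complex.normSq (b - a) * (t * (t - 1)) := by
    rw [hre, him, hn']
    linear_combination (1 - t) * ha2 + t * hb2
  have hlt : t * (t - 1) < 0 := by
    by_contra hge
    have := mul_nonneg hn.le (not_lt.1 hge)
    linarith
  have ht0 : 0 < t := by nlinarith
  have ht1 : t < 1 := by nlinarith
  refine ⟨1 - t, t, by linarith, ht0.le, by ring, ?_⟩
  rw [hzt, Complex.real_smul, Complex.real_smul]
  push_cast; ring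

/-- The unit normal to the chord works: the line through `a` and `b` is at distance `|κ| / n < 1`
from the centre, so it separates the two antipodal points `ζ` and `-ζ`. -/
theorem exists_chordSide_pos {a b : ℂ} (ha : ‖a‖ = 1) (hb : ‖b‖ = 1) (hab : a ≠ b) :
    ∃ ζ : ℂ, ‖ζ‖ = 1 ∧ 0 < chordSide a b ζ ∧ chordSide a b (-ζ) < 0 := by
  have hd : b - a ≠ 0 := sub_ne_zero.2 hab.symm
  set n : ℝ := ‖b - a‖ with hn
  have hn0 : 0 < n := norm_pos_iff.2 hd
  have hnC : (n : ℂ) ≠ 0 := by exact_mod_cast hn0.ne'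
  have hnn : (b - a) * (starRingEnd ℂ) (b - a) = (n : ℂ) ^ 2 := by
    rw [Complex.mul_conj, Complex.normSq_eq_norm_sq]; push_cast; rfl
  set ζ : ℂ := Complex.I * (b - a) / n with hζ
  have hζd : ζ * (starRingEnd ℂ) (b - a) = Complex.I * n := by
    have : ζ * (starRingEnd ℂ) (b - a) = Complex.I * ((b - a) * (starRingEnd ℂ) (b - a)) / n := by
      rw [hζ]; ring
    rw [this, hnn]; field_simp
  set κ : ℝ := (a * (starRingEnd ℂ) (b - a)).im with hκ
  have hpos : chordSide a b ζ = n - κ := by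
    rw [chordSide, sub_mul, hζd]; simp [hκ]
  have hneg : chordSide a b (-ζ) = -n - κ := by
    rw [chordSide, sub_mul, neg_mul, hζd]; simp [hκ]
  have ha2 : a.re ^ 2 + a.im ^ 2 = 1 := by
    have := Complex.normSq_eq_norm_sq a
    rw [ha, Complex.normSq_apply] at this; linarith
  have hb2 : b.re ^ 2 + b.im ^ 2 = 1 := by
    have := Complex.normSq_eq_norm_sq b
    rw [hb, Complex.normSq_apply] at this; linarith
  have hn2 : n ^ 2 = (b.re - a.re) ^ 2 + (b.im - a.im) ^ 2 := by
    rw [hn, ← Complex.normSq_eq_norm_sq, Complex.normSq_apply]; simp; ring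
  have hκ' : κ = a.im * b.re - a.re * b.im := by
    rw [hκ]; simp; ring
  have hn2pos : 0 < n ^ 2 := by positivity
  have hκn : n ^ 2 - κ ^ 2 = (n ^ 2 / 2) ^ 2 := by
    have hR : a.re * b.re + a.im * b.im = 1 - n ^ 2 / 2 := by
      rw [hn2]; linear_combination (1 / 2) * ha2 + (1 / 2) * hb2
    have h1 : κ ^ 2 + (a.re * b.re + a.im * b.im) ^ 2 = 1 := by
      rw [hκ']
      linear_combination (b.re ^ 2 + b.im ^ 2) * ha2 + hb2
    rw [hR] at h1
    linear_combination -h1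
  have habs : |κ| < n := by
    refine abs_lt_of_sq_lt_sq ?_ hn0.le
    have : 0 < (n ^ 2 / 2) ^ 2 := by positivity
    linarith
  rw [abs_lt] at habs
  refine ⟨ζ, ?_, by rw [hpos]; linarith, by rw [hneg]; linarith⟩
  rw [hζ, norm_div, norm_mul, Complex.norm_I, one_mul, Complex.norm_real, Real.norm_eq_abs,
    abs_of_pos hn0, ← hn, div_self hn0.ne']

theorem IsJordanCurve.isPreconnected_range_diff_singleton (hc : IsJordanCurve c) (w : Circle) :
    IsPreconnected (range c \ {c w}) := by
  obtain ⟨t₀, rfl⟩ := Circle.exp_surjective w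
  have hcont : Continuous fun t : ℝ => c (Circle.exp t) := hc.1.comp Circle.exp.continuous
  have : range c \ {c (Circle.exp t₀)} =
      (fun t : ℝ => c (Circle.exp t)) '' Ioo t₀ (t₀ + 2 * Real.pi) := by
    ext z
    constructor
    · rintro ⟨⟨v, rfl⟩, hv⟩
      obtain ⟨s, rfl⟩ := Circle.exp_surjective v
      obtain ⟨m, hm, -⟩ := existsUnique_add_zsmul_mem_Ico Real.two_pi_pos s t₀
      simp only [zsmul_eq_mul] at hm
      have he : Circle.exp (s + m * (2 * Real.pi)) = Circle.exp s := Circle.periodic_exp.int_mul m s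
      refine ⟨_, ⟨lt_of_le_of_ne hm.1 fun h => hv ?_, hm.2⟩, congrArg c he⟩
      rw [mem_singleton_iff, ← he, ← h]
    · rintro ⟨t, ht, rfl⟩
      refine ⟨mem_range_self _, fun h => ?_⟩
      have h1 := Circle.exp_injOn_Ico (a := t₀) (b := t₀ + 2 * Real.pi) (by linarith)
        ⟨ht.1.le, ht.2⟩ (left_mem_Ico.2 (by linarith [Real.pi_pos])) (hc.2 h)
      exact ht.1.ne' h1
  rw [this]
  exact isPreconnected_Ioo.image _ hcont.continuousOn

/-- If `a` and `b` have the same image `p`, the chord between them maps to a set `K` meeting the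
curve only in `p`. The rest of the curve is connected, so it lies in one component of `Kᶜ`. If both
arcs cut off by the chord had boundary values other than `p`, nearby images from the two sides could
be joined off `K` inside the domain, crossing the chord off its own image. Hence one arc is sent to
`p`, which forces `φ 0 = p`. -/
theorem IsJordanCurve.injOn_sphere (hc : IsJordanCurve c)
    (hcont : ContinuousOn φ (Metric.closedBall 0 1)) (hd : DifferentiableOn ℂ φ (Metric.ball 0 1))
    (hb : BijOn φ (Metric.ball 0 1) (enclosedDomain c)) : InjOn φ (Metric.sphere 0 1) := by
  intro a ha b hb' hab
  by_contra hne
  rw [mem_sphere_zero_iff_norm] at ha hb'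
  set p := φ a with hp
  have hpc : p ∈ range c := hc.apply_mem_range hcont hd hb ha
  have hac : a ∈ Metric.closedBall (0 : ℂ) 1 := mem_closedBall_zero_iff.2 ha.le
  have hbc : b ∈ Metric.closedBall (0 : ℂ) 1 := mem_closedBall_zero_iff.2 hb'.le
  have hseg : segment ℝ a b ⊆ Metric.closedBall 0 1 := (convex_closedBall 0 1).segment_subset hac hbc
  set K : Set ℂ := φ '' segment ℝ a b with hK
  have hKc : IsCompact K := by
    have : IsCompact (segment ℝ a b) := by
      rw [segment_eq_image_lineMap]
      exact isCompact_Icc.image (by fun_prop)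
    exact this.image_of_continuousOn (hcont.mono hseg)
  have hKr : K ∩ range c = {p} := by
    ext y
    constructor
    · rintro ⟨⟨x, hx, rfl⟩, hxc⟩
      rw [mem_singleton_iff]
      have hxb : x ∉ Metric.ball (0 : ℂ) 1 := fun h => (hb.mapsTo h).1 hxc
      by_contra hxp
      have hxa : x ≠ a := fun h => hxp (by rw [h])
      have hxb' : x ≠ b := fun h => hxp (by rw [h, hab])
      have hxo : x ∈ openSegment ℝ a b := mem_openSegment_of_ne_left_right hxa.symm hxb'.symm hx
      have := (strictConvex_closedBall ℝ (0 : ℂ) 1).openSegment_subset hac hbc hne hxo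
      rw [interior_closedBall _ one_ne_zero] at this
      exact hxb this
    · rintro rfl
      exact ⟨⟨a, left_mem_segment ℝ a b, rfl⟩, hpc⟩
  have hCK : range c \ {p} ⊆ Kᶜ := fun y hy hyK => hy.2 (hKr ▸ ⟨hyK, hy.1⟩)
  have hCp : IsPreconnected (range c \ {p}) := by
    obtain ⟨w, hw⟩ := hpc
    rw [← hw]
    exact hc.isPreconnected_range_diff_singleton w
  have happrox : ∀ ζ : ℂ, ‖ζ‖ = 1 → ∀ V : Set ℂ, IsOpen V → φ ζ ∈ V → ∀ W : Set ℂ, IsOpen W →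
      ζ ∈ W → ∃ z ∈ Metric.ball (0 : ℂ) 1, φ z ∈ V ∧ z ∈ W := by
    intro ζ hζ V hV hζV W hW hζW
    have hcl : ζ ∈ closure (Metric.ball (0 : ℂ) 1) := by
      rw [closure_ball 0 one_ne_zero]; exact mem_closedBall_zero_iff.2 hζ.le
    have hneb := mem_closure_iff_nhdsWithin_neBot.1 hcl
    have ht : Tendsto φ (𝓝[Metric.ball 0 1] ζ) (𝓝 (φ ζ)) :=
      (hcont ζ (mem_closedBall_zero_iff.2 hζ.le)).mono_left
        (nhdsWithin_mono _ Metric.ball_subset_closedBall)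
    obtain ⟨z, hz1, hz2, hz3⟩ := ((ht.eventually (hV.mem_nhds hζV)).and
      ((show ∀ᶠ z in 𝓝[Metric.ball 0 1] ζ, z ∈ W from
        mem_nhdsWithin_of_mem_nhds (hW.mem_nhds hζW)).and self_mem_nhdsWithin) :
        ∀ᶠ z in 𝓝[Metric.ball 0 1] ζ, φ z ∈ V ∧ z ∈ W ∧ z ∈ Metric.ball (0 : ℂ) 1).exists
    exact ⟨z, hz3, hz1, hz2⟩
  have hcs := continuous_chordSide a b
  have hcase : (∀ ζ, ‖ζ‖ = 1 → 0 < chordSide a b ζ → φ ζ = p) ∨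
      (∀ ζ, ‖ζ‖ = 1 → 0 < -chordSide a b ζ → φ ζ = p) := by
    by_contra hcon
    push Not at hcon
    obtain ⟨⟨ζ, hζ, hζs, hζp⟩, ⟨ξ, hξ, hξs, hξp⟩⟩ := hcon
    have hζr : φ ζ ∈ range c \ {p} := ⟨hc.apply_mem_range hcont hd hb hζ, hζp⟩
    have hξr : φ ξ ∈ range c \ {p} := ⟨hc.apply_mem_range hcont hd hb hξ, hξp⟩
    have hVo : IsOpen (connectedComponentIn Kᶜ (φ ζ)) := hKc.isClosed.isOpen_compl.connectedComponentIn
    obtain ⟨z, hz, hzV, hzs⟩ := happrox ζ hζ _ hVo (mem_connectedComponentIn (hCK hζr))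
      {z | 0 < chordSide a b z} (isOpen_lt continuous_const hcs) hζs
    obtain ⟨w, hw, hwV, hws⟩ := happrox ξ hξ _ hVo
      (hCp.subset_connectedComponentIn hζr hCK hξr)
      {z | 0 < -chordSide a b z} (isOpen_lt continuous_const hcs.neg) hξs
    rw [connectedComponentIn_eq hwV] at hzV
    have hws' : 0 < -chordSide a b w := hws
    have hzs' : 0 < chordSide a b z := hzs
    obtain ⟨x, hx, hxK, hx0⟩ := hc.exists_mem_of_separates hd hb hKc
      (by rw [hKr]; exact isPreconnected_singleton) hcs hw hz (by linarith) hzs'.le hzV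
    exact hxK ⟨x, mem_segment_of_chordSide_eq_zero ha hb' hne (mem_ball_zero_iff.1 hx) hx0, rfl⟩
  obtain ⟨ζ, hζ, hζp, hζn⟩ := exists_chordSide_pos ha hb' hne
  have h0 : φ 0 = p := by
    rcases hcase with h | h
    · exact apply_zero_eq_of_eq_on_arc hcont hd hcs hζ hζp h
    · exact apply_zero_eq_of_eq_on_arc hcont hd hcs.neg (ζ₀ := -ζ) (by rwa [norm_neg])
        (neg_pos.2 hζn) h
  exact (hb.mapsTo (Metric.mem_ball_self one_pos)).1 (h0 ▸ hpc)

/-- Carathéodory's theorem for Jordan domains. -/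
theorem IsJordanCurve.exists_isExtendedRiemannMap (hc : IsJordanCurve c)
    (hne : (enclosedDomain c).Nonempty) :
    ∃ φ : ℂ → ℂ, IsExtendedRiemannMap φ (enclosedDomain c) ∧ φ '' Metric.sphere 0 1 = range c := by
  obtain ⟨φ₀, hd₀, hb₀⟩ := hc.exists_riemann_map hne
  obtain ⟨φ, hcont, heq⟩ := hc.exists_continuousOn_extension hd₀ hb₀
  have hd : DifferentiableOn ℂ φ (Metric.ball 0 1) := hd₀.congr heq
  have hb : BijOn φ (Metric.ball 0 1) (enclosedDomain c) := hb₀.congr heq.symm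
  have hfr := hc.frontier_enclosedDomain hne
  have hsplit : Metric.closedBall (0 : ℂ) 1 = Metric.ball 0 1 ∪ Metric.sphere 0 1 :=
    Metric.ball_union_sphere.symm
  have hsub : φ '' Metric.sphere 0 1 ⊆ range c := by
    rintro _ ⟨z, hz, rfl⟩
    exact hc.apply_mem_range hcont hd hb (mem_sphere_zero_iff_norm.1 hz)
  have himg : φ '' Metric.closedBall 0 1 = closure (enclosedDomain c) := by
    refine subset_antisymm ?_ ?_
    · rw [hsplit, image_union, hb.image_eq, closure_eq_self_union_frontier, hfr]
      exact union_subset_union_right _ hsub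
    · refine closure_minimal ?_ ((isCompact_closedBall 0 1).image_of_continuousOn hcont).isClosed
      rw [← hb.image_eq]
      exact image_mono Metric.ball_subset_closedBall
  refine ⟨φ, ⟨hcont, ⟨mapsTo_iff_image_subset.2 himg.subset, ?_, himg.superset⟩, hd, hb⟩,
    subset_antisymm hsub fun x hx => ?_⟩
  · rw [hsplit, injOn_union]
    · refine ⟨hb.injOn, hc.injOn_sphere hcont hd hb, fun z hz w hw h => ?_⟩
      exact (hb.mapsTo hz).1 (h ▸ hsub (mem_image_of_mem φ hw))
    · exact Metric.sphere_disjoint_ball.symm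
  · have hx' : x ∈ closure (enclosedDomain c) := frontier_subset_closure (hfr ▸ hx)
    rw [← himg] at hx'
    obtain ⟨z, hz, rfl⟩ := hx'
    refine ⟨z, ?_, rfl⟩
    rw [hsplit] at hz
    exact hz.resolve_left fun h => (hb.mapsTo h).1 hx

end Boundary

/-! ### Jordan curves with the same image. -/

section Reparametrization

variable {c₁ c₂ : Circle → ℂ}

theorem exists_lift_real {h : Circle → Circle} (hh : Continuous h) :
    ∃ H : ℝ → ℝ, Continuous H ∧ (∀ t, Circle.exp (H t) = h (Circle.exp t)) ∧
      ∃ d : ℤ, ∀ t, H (t + 2 * Real.pi) = H t + d * (2 * Real.pi) := by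
  obtain ⟨G, hG, hG'⟩ := exists_continuous_log_real (f := fun t => (h (Circle.exp t) : ℂ))
    (by fun_prop) (fun t => Circle.coe_ne_zero _)
  obtain ⟨d, hd⟩ := exists_eq_add_mul_of_exp_periodic hG fun t => by
    rw [hG', hG', Circle.exp_add_two_pi]
  refine ⟨fun t => (G t).im, by fun_prop, fun t => ?_, d, fun t => ?_⟩
  · have hre : (G t).re = 0 := by
      have h1 := congrArg norm (hG' t)
      rwa [Complex.norm_exp, Circle.norm_coe, Real.exp_eq_one_iff] at h1
    ext
    rw [Circle.coe_exp, ← hG' t]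
    congr 1
    exact Complex.ext (by simp [hre]) (by simp)
  · change (G (t + 2 * Real.pi)).im = (G t).im + d * (2 * Real.pi)
    rw [hd t]
    simp

/-- The lift of an injective self-map of the circle is strictly monotone, up to a sign, and commutes
with the deck transformation. -/
theorem exists_strictMono_lift {h : Circle → Circle} (hh : Continuous h)
    (hinj : Function.Injective h) :
    ∃ (σ : ℝ) (M : ℝ → ℝ), (σ = 1 ∨ σ = -1) ∧ Continuous M ∧ StrictMono M ∧
      (∀ t, M (t + 2 * Real.pi) = M t + 2 * Real.pi) ∧
      ∀ t, Circle.exp (σ * M t) = h (Circle.exp t) := by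
  obtain ⟨H, hH, hexp, d, hd⟩ := exists_lift_real hh
  have hpi := Real.pi_pos
  have hex : ∀ s t, H s = H t → ∃ m : ℤ, s = t + m * (2 * Real.pi) := fun s t hst => by
    refine Circle.exp_eq_exp.1 (hinj ?_)
    rw [← hexp, ← hexp, hst]
  have hd0 : d ≠ 0 := by
    rintro rfl
    have h2 : H (2 * Real.pi) = H 0 := by simpa using hd 0
    -- In degree zero `H` goes from `H 0` to `H π` and back within one period, so it takes the
    -- middle value `v` at two parameters that are distinct on the circle.
    set v := (H 0 + H Real.pi) / 2 with hv
    have hne : H 0 ≠ H Real.pi := fun he => by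
      obtain ⟨m, hm⟩ := hex _ _ he
      have h3 : (m : ℝ) * 2 = -1 := by
        have : Real.pi * (m * 2 + 1) = 0 := by linear_combination -hm
        rcases mul_eq_zero.1 this with h4 | h4
        · exact absurd h4 hpi.ne'
        · linarith
      have h5 : m * 2 = -1 := by exact_mod_cast h3
      omega
    have hv1 : v ∈ uIcc (H 0) (H Real.pi) := by
      rcases le_total (H 0) (H Real.pi) with hle | hle
      · rw [uIcc_of_le hle]; constructor <;> linarith
      · rw [uIcc_of_ge hle]; constructor <;> linarith
    have hv2 : v ∈ uIcc (H Real.pi) (H (2 * Real.pi)) := by rw [h2, uIcc_comm]; exact hv1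
    obtain ⟨s, hs, hsv⟩ := intermediate_value_uIcc hH.continuousOn hv1
    obtain ⟨t, ht, htv⟩ := intermediate_value_uIcc hH.continuousOn hv2
    rw [uIcc_of_le hpi.le] at hs
    rw [uIcc_of_le (by linarith)] at ht
    obtain ⟨m, hm⟩ := hex s t (hsv.trans htv.symm)
    have hsne : s ≠ 0 ∧ s ≠ Real.pi := by
      constructor <;> rintro rfl <;> apply hne <;> linarith
    have hs0 : 0 < s := lt_of_le_of_ne hs.1 hsne.1.symm
    have hsp : s < Real.pi := lt_of_le_of_ne hs.2 hsne.2
    have hm0 : (m : ℝ) < 0 := by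
      by_contra hcon
      have := mul_nonneg (not_lt.1 hcon) Real.two_pi_pos.le
      linarith [ht.1]
    have hm1 : (-1 : ℝ) < m := by
      by_contra hcon
      have := mul_le_mul_of_nonneg_right (not_lt.1 hcon) Real.two_pi_pos.le
      linarith [ht.2]
    have h3 : m < 0 := by exact_mod_cast hm0
    have h4 : -1 < m := by exact_mod_cast hm1
    omega
  have hper : Function.Periodic (fun t => H t - d * t) (2 * Real.pi) := fun t => by
    change H (t + 2 * Real.pi) - d * (t + 2 * Real.pi) = H t - d * t
    rw [hd]; ring
  have hHinj : Function.Injective H := fun s t hst => by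
    obtain ⟨m, rfl⟩ := hex s t hst
    have h1 := hper.int_mul m t
    change H (t + m * (2 * Real.pi)) - d * (t + m * (2 * Real.pi)) = H t - d * t at h1
    have h2 : (d : ℝ) * m * (2 * Real.pi) = 0 := by linear_combination hst - h1
    have h3 : (d : ℝ) ≠ 0 := by exact_mod_cast hd0
    have h4 : (m : ℝ) = 0 := by simpa [h3, hpi.ne'] using h2
    rw [h4]; ring
  obtain ⟨σ, hσ, hM⟩ : ∃ σ : ℝ, (σ = 1 ∨ σ = -1) ∧ StrictMono fun t => σ * H t := by
    rcases hH.strictMono_of_inj hHinj with hm | hm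
    · exact ⟨1, Or.inl rfl, by simpa using hm⟩
    · exact ⟨-1, Or.inr rfl, fun a b hab => by have := hm hab; simp only; linarith⟩
  have hσ2 : σ * σ = 1 := by rcases hσ with rfl | rfl <;> norm_num
  obtain ⟨e, he⟩ : ∃ e : ℤ, (e : ℝ) = σ * d := by
    rcases hσ with rfl | rfl
    · exact ⟨d, by simp⟩
    · exact ⟨-d, by simp⟩
  have hMe : ∀ t, σ * H (t + 2 * Real.pi) = σ * H t + e * (2 * Real.pi) := fun t => by
    rw [hd, he]; ring
  have hexp' : ∀ t, Circle.exp (σ * (σ * H t)) = h (Circle.exp t) := fun t => by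
    rw [← mul_assoc, hσ2, one_mul, hexp]
  have hepos : 0 < e := by
    have h1 := hM (show (0 : ℝ) < 0 + 2 * Real.pi by linarith)
    simp only [hMe 0] at h1
    have h2 : 0 < (e : ℝ) := by
      by_contra hcon
      have := mul_nonpos_of_nonpos_of_nonneg (not_lt.1 hcon) Real.two_pi_pos.le
      linarith
    exact_mod_cast h2
  -- For degree at least two, the lift would reach its initial value plus `2π` strictly within a
  -- period, against injectivity on the circle.
  have he1 : e = 1 := by
    by_contra hne
    have he2 : 2 ≤ e := by omega
    have he2' : (2 : ℝ) ≤ e := by exact_mod_cast he2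
    have hval : σ * H 0 + 2 * Real.pi ∈ Ioo (σ * H 0) (σ * H (0 + 2 * Real.pi)) := by
      rw [hMe]
      constructor
      · linarith
      · nlinarith
    obtain ⟨t, ht, htv⟩ := intermediate_value_Ioo (f := fun t => σ * H t)
      (show (0 : ℝ) ≤ 0 + 2 * Real.pi by linarith) (by fun_prop) hval
    simp only at htv
    have h1 : h (Circle.exp t) = h (Circle.exp 0) := by
      rw [← hexp', ← hexp', htv, mul_add]
      rcases hσ with rfl | rfl
      · rw [one_mul (2 * Real.pi), Circle.exp_add_two_pi]
      · rw [neg_one_mul (2 * Real.pi), ← sub_eq_add_neg, Circle.exp_sub_two_pi]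
    have h2 := Circle.exp_injOn_Ico (a := 0) (b := 0 + 2 * Real.pi) (by linarith)
      ⟨ht.1.le, ht.2⟩ (left_mem_Ico.2 (by linarith)) (hinj h1)
    exact ht.1.ne' h2
  exact ⟨σ, fun t => σ * H t, hσ, by fun_prop, hM, fun t => by
    change σ * H (t + 2 * Real.pi) = σ * H t + 2 * Real.pi
    rw [hMe, he1]; simp, hexp'⟩

/-- Two Jordan curves with the same image differ by a monotone reparametrization. -/
theorem IsJordanCurve.exists_reparametrization (h₁ : IsJordanCurve c₁) (h₂ : IsJordanCurve c₂)
    (hr : range c₁ = range c₂) :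
    ∃ (σ : ℝ) (M : ℝ → ℝ), (σ = 1 ∨ σ = -1) ∧ Continuous M ∧ StrictMono M ∧
      (∀ t, M (t + 2 * Real.pi) = M t + 2 * Real.pi) ∧ ∀ t, lift c₁ t = lift c₂ (σ * M t) := by
  have hex : ∀ z, ∃ w, c₂ w = c₁ z := fun z => by
    have : c₁ z ∈ range c₂ := hr ▸ mem_range_self z
    exact this
  choose h hh using hex
  have hcont : Continuous h := by
    rw [h₂.isEmbedding.isInducing.continuous_iff]
    exact h₁.1.congr fun z => (hh z).symm
  have hinj : Function.Injective h := fun z w hzw => h₁.2 (by rw [← hh, ← hh, hzw])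
  obtain ⟨σ, M, hσ, hM, hMm, hMp, hexp⟩ := exists_strictMono_lift hcont hinj
  refine ⟨σ, M, hσ, hM, hMm, hMp, fun t => ?_⟩
  rw [lift, lift, hexp, hh]

end Reparametrization

/-! ### Total variation on concentric circles. -/

section Variation

variable {c : Circle → ℂ}

theorem lift_periodic (c : Circle → ℂ) : Function.Periodic (lift c) (2 * Real.pi) := fun t => by
  rw [lift, lift, Circle.exp_add_two_pi]

theorem IsRectifiable.eVariationOn_lt_top (h : IsRectifiable c) (a b : ℝ) :
    eVariationOn (lift c) (Icc a b) < ⊤ := by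
  have hpi := Real.two_pi_pos
  have htrans : ∀ m : ℤ, eVariationOn (lift c) (Icc (m * (2 * Real.pi)) (m * (2 * Real.pi) + 2 * Real.pi))
      < ⊤ := by
    intro m
    have h1 := eVariationOn.comp_eq_of_monotoneOn (lift c) (t := Icc 0 (2 * Real.pi))
      (fun t => t + m * (2 * Real.pi)) (fun x _ y _ hxy => by simpa using hxy)
    have h2 : lift c ∘ (fun t => t + m * (2 * Real.pi)) = lift c :=
      funext fun t => (lift_periodic c).int_mul m t
    rw [h2, image_add_const_Icc, zero_add, add_comm (2 * Real.pi)] at h1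
    rw [← h1]
    exact h
  have hN : ∀ n : ℕ, eVariationOn (lift c) (Icc (-(n * (2 * Real.pi))) (n * (2 * Real.pi))) < ⊤ := by
    intro n
    induction n with
    | zero => simp [eVariationOn.subsingleton]
    | succ n ih =>
      have h0 : 0 ≤ (n : ℝ) * (2 * Real.pi) := by positivity
      have e1 := eVariationOn.Icc_add_Icc (lift c) (s := univ)
        (a := -((n + 1 : ℕ) * (2 * Real.pi))) (b := -(n * (2 * Real.pi))) (c := n * (2 * Real.pi))
        (by push_cast; linarith) (by linarith) (mem_univ _)
      have e2 := eVariationOn.Icc_add_Icc (lift c) (s := univ)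
        (a := -((n + 1 : ℕ) * (2 * Real.pi))) (b := n * (2 * Real.pi))
        (c := (n + 1 : ℕ) * (2 * Real.pi))
        (by push_cast; linarith) (by push_cast; linarith) (mem_univ _)
      simp only [univ_inter] at e1 e2
      have t1 := htrans (-(n + 1 : ℤ))
      have t2 := htrans n
      have i1 : ((-(n + 1 : ℤ) : ℤ) : ℝ) * (2 * Real.pi) = -((n + 1 : ℕ) * (2 * Real.pi)) := by
        push_cast; ring
      have i2 : -((n + 1 : ℕ) * (2 * Real.pi)) + 2 * Real.pi = -((n : ℝ) * (2 * Real.pi)) := by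
        push_cast; ring
      have i3 : ((n : ℤ) : ℝ) * (2 * Real.pi) + 2 * Real.pi = (n + 1 : ℕ) * (2 * Real.pi) := by
        push_cast; ring
      rw [i1, i2] at t1
      rw [i3, Int.cast_natCast] at t2
      rw [← e2, ← e1]
      exact ENNReal.add_lt_top.2 ⟨ENNReal.add_lt_top.2 ⟨t1, ih⟩, t2⟩
  obtain ⟨n, hn⟩ := exists_nat_gt (max |a| |b| / (2 * Real.pi))
  rw [div_lt_iff₀ hpi] at hn
  refine (eVariationOn.mono _ (Icc_subset_Icc ?_ ?_)).trans_lt (hN n)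
  · linarith [neg_abs_le a, le_max_left |a| |b|]
  · linarith [le_abs_self b, le_max_right |a| |b|]

/-- Rectifiability depends only on the image. -/
theorem IsRectifiable.eVariationOn_lt_top_of_range_eq {c' : Circle → ℂ} (h : IsRectifiable c)
    (hc : IsJordanCurve c) (hc' : IsJordanCurve c') (hr : range c' = range c) (a b : ℝ) :
    eVariationOn (lift c') (Icc a b) < ⊤ := by
  obtain ⟨σ, M, hσ, -, hM, -, hl⟩ := hc'.exists_reparametrization hc hr
  have hl' : lift c' = lift c ∘ fun t => σ * M t := funext hl
  rw [hl']
  rcases hσ with rfl | rfl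
  · refine (eVariationOn.comp_le_of_monotoneOn (lift c) (s := Icc (M a) (M b)) _ ?_ ?_).trans_lt
      (h.eVariationOn_lt_top _ _)
    · intro x _ y _ hxy
      simpa using hM.monotone hxy
    · intro x hx
      simpa using ⟨hM.monotone hx.1, hM.monotone hx.2⟩
  · refine (eVariationOn.comp_le_of_antitoneOn (lift c) (s := Icc (-M b) (-M a)) _ ?_ ?_).trans_lt
      (h.eVariationOn_lt_top _ _)
    · intro x _ y _ hxy
      simpa using hM.monotone hxy
    · intro x hx
      simpa using And.intro (hM.monotone hx.2) (hM.monotone hx.1)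

/-- The variation of a holomorphic function on concentric circles is bounded by the variation of its
boundary values. -/
theorem exists_eVariationOn_circleImage_le {φ : ℂ → ℂ}
    (hcont : ContinuousOn φ (Metric.closedBall 0 1)) (hd : DifferentiableOn ℂ φ (Metric.ball 0 1))
    (hv : ∀ a b, eVariationOn (lift (circleImage φ 1)) (Icc a b) < ⊤) (T : ℝ) :
    ∃ B : ℝ, 0 ≤ B ∧ ∀ r ∈ Ico (0 : ℝ) 1,
      eVariationOn (lift (circleImage φ r)) (Icc (-T) T) ≤ ENNReal.ofReal B := by
  -- The enlargement by `π` absorbs the rotation by `arg z` in the boundary estimate below.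
  set V := eVariationOn (lift (circleImage φ 1)) (Icc (-T - Real.pi) (T + Real.pi)) with hV
  refine ⟨V.toReal, ENNReal.toReal_nonneg, fun r hr => iSup_le ?_⟩
  rintro ⟨n, u, hu, hus⟩
  have hnorm : ∀ z w : ℂ, edist z w = ENNReal.ofReal ‖z - w‖ := fun z w => by
    rw [edist_dist, dist_eq_norm]
  simp only [hnorm]
  rw [← ENNReal.ofReal_sum_of_nonneg fun _ _ => norm_nonneg _]
  refine ENNReal.ofReal_le_ofReal ?_
  have hphase : ∀ w : ℂ, ∃ k : ℂ, ‖k‖ ≤ 1 ∧ k * w = ‖w‖ := fun w => by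
    by_cases hw : w = 0
    · exact ⟨0, by simp, by simp [hw]⟩
    · refine ⟨‖w‖ / w, ?_, div_mul_cancel₀ _ hw⟩
      rw [norm_div, Complex.norm_real, norm_norm, div_self (norm_ne_zero_iff.2 hw)]
  choose k hk1 hk2 using fun i => hphase (lift (circleImage φ r) (u (i + 1)) - lift (circleImage φ r) (u i))
  -- The phases `k i` turn the variation sum at radius `r` into the value at `r` of a function
  -- holomorphic in the disk; on the unit circle this function is bounded by the variation `V`.
  set F : ℂ → ℂ := fun z => ∑ i ∈ Finset.range n, k i * (φ (z * Circle.exp (u (i + 1))) -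
    φ (z * Circle.exp (u i))) with hF
  have hrot : ∀ v : Circle, MapsTo (fun z : ℂ => z * (v : ℂ)) (Metric.closedBall 0 1)
      (Metric.closedBall 0 1) := fun v z hz => by
    simpa [mem_closedBall_zero_iff, Circle.norm_coe] using hz
  have hrot' : ∀ v : Circle, MapsTo (fun z : ℂ => z * (v : ℂ)) (Metric.ball 0 1)
      (Metric.ball 0 1) := fun v z hz => by
    simpa [mem_ball_zero_iff, Circle.norm_coe] using hz
  have hdc : DiffContOnCl ℂ F (Metric.ball 0 1) := by
    refine ⟨?_, ?_⟩
    · refine DifferentiableOn.fun_sum fun i _ => DifferentiableOn.const_mul (DifferentiableOn.sub ?_ ?_) _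
      · exact hd.comp (by fun_prop) (hrot' _)
      · exact hd.comp (by fun_prop) (hrot' _)
    · rw [closure_ball 0 one_ne_zero]
      refine continuousOn_finsetSum _ fun i _ => continuousOn_const.mul (ContinuousOn.sub ?_ ?_)
      · exact hcont.comp (by fun_prop) (hrot _)
      · exact hcont.comp (by fun_prop) (hrot _)
  have hfr : ∀ z ∈ frontier (Metric.ball (0 : ℂ) 1), ‖F z‖ ≤ V.toReal := by
    intro z hz
    rw [frontier_ball 0 one_ne_zero, mem_sphere_zero_iff_norm] at hz
    set s := z.arg with hs
    have hzs : ∀ t : ℝ, z * Circle.exp t = (1 : ℝ) * (Circle.exp (s + t) : ℂ) := fun t => by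
      rw [Circle.exp_add, Circle.coe_mul, Circle.coe_exp s]
      have := Complex.norm_mul_exp_arg_mul_I z
      rw [hz] at this
      rw [← mul_assoc, ← this]
    have hb : ∀ i, ‖k i * (φ (z * Circle.exp (u (i + 1))) - φ (z * Circle.exp (u i)))‖ ≤
        ‖lift (circleImage φ 1) (s + u (i + 1)) - lift (circleImage φ 1) (s + u i)‖ := fun i => by
      rw [norm_mul, hzs, hzs]
      exact mul_le_of_le_one_left (norm_nonneg _) (hk1 i)
    refine (norm_sum_le _ _).trans ((Finset.sum_le_sum fun i _ => hb i).trans ?_)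
    have hle := eVariationOn.sum_le (f := lift (circleImage φ 1))
      (s := Icc (-T - Real.pi) (T + Real.pi)) (n := n) (u := fun i => s + u i)
      (fun i j hij => by simpa using hu hij) (fun i => by
        have h1 := hus i
        have h2 := Complex.neg_pi_lt_arg z
        have h3 := Complex.arg_le_pi z
        exact ⟨by linarith [h1.1], by linarith [h1.2]⟩)
    simp only [hnorm] at hle
    rw [← ENNReal.ofReal_sum_of_nonneg fun _ _ => norm_nonneg _] at hle
    exact (ENNReal.ofReal_le_iff_le_toReal (hv _ _).ne).1 hle
  have hrm : (r : ℂ) ∈ closure (Metric.ball (0 : ℂ) 1) := by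
    rw [closure_ball 0 one_ne_zero, mem_closedBall_zero_iff, Complex.norm_real, Real.norm_eq_abs,
      abs_of_nonneg hr.1]
    exact hr.2.le
  have hFr : F r = ((∑ i ∈ Finset.range n,
      ‖lift (circleImage φ r) (u (i + 1)) - lift (circleImage φ r) (u i)‖ : ℝ) : ℂ) := by
    rw [Complex.ofReal_sum]
    exact Finset.sum_congr rfl fun i _ => hk2 i
  have hfin := Complex.norm_le_of_forall_mem_frontier_norm_le Metric.isBounded_ball hdc hfr hrm
  rw [hFr, Complex.norm_real] at hfin
  exact (le_abs_self _).trans hfin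

end Variation

/-! ### Convergence of the Liouville primitives. -/

/-- The length of a continuously differentiable curve is at most its total variation. -/
theorem integral_norm_deriv_le_of_eVariationOn_le {g g' : ℝ → ℂ} {a b B : ℝ} (hab : a ≤ b)
    (hB : 0 ≤ B) (hg : ∀ t, HasDerivAt g (g' t) t) (hg' : Continuous g')
    (hv : eVariationOn g (Icc a b) ≤ ENNReal.ofReal B) : ∫ t in a..b, ‖g' t‖ ≤ B := by
  refine le_of_forall_pos_le_add fun ε hε => ?_
  obtain ⟨η, hη, hηε⟩ : ∃ η > 0, 2 * η * (b - a) ≤ ε := by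
    refine ⟨ε / (2 * (b - a + 1)), by have := sub_nonneg.2 hab; positivity, ?_⟩
    have h0 := sub_nonneg.2 hab
    rw [show 2 * (ε / (2 * (b - a + 1))) * (b - a) = ε * ((b - a) / (b - a + 1)) by field_simp]
    exact mul_le_of_le_one_right hε.le ((div_le_one (by linarith)).2 (by linarith))
  obtain ⟨δ, hδ, hδη⟩ := Metric.uniformContinuousOn_iff.1
    ((isCompact_Icc (a := a) (b := b)).uniformContinuousOn_of_continuous hg'.continuousOn) η hη
  obtain ⟨n, hn⟩ := exists_nat_gt ((b - a) / δ)
  have hn0 : (0 : ℝ) < n := (div_nonneg (sub_nonneg.2 hab) hδ.le).trans_lt hn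
  have hstep : (b - a) / n < δ := by
    rw [div_lt_iff₀ hδ] at hn
    rw [div_lt_iff₀ hn0]
    linarith
  have hs0 : 0 ≤ (b - a) / n := div_nonneg (sub_nonneg.2 hab) hn0.le
  -- The cutoff `min i n` keeps the monotone sequence inside `[a, b]` for all indices, as the
  -- definition of variation demands.
  set u : ℕ → ℝ := fun i => a + (min i n : ℕ) * ((b - a) / n) with hu
  have hmono : Monotone u := fun i j hij => by
    have : ((min i n : ℕ) : ℝ) ≤ (min j n : ℕ) := by exact_mod_cast min_le_min_right n hij
    simp only [hu]
    gcongr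
  have hu0 : u 0 = a := by simp [hu]
  have hun : u n = b := by simp [hu]; field_simp; ring
  have hus : ∀ i, u i ∈ Icc a b := fun i => by
    constructor
    · rw [← hu0]; exact hmono (Nat.zero_le i)
    · have : u i ≤ u (max i n) := hmono (le_max_left _ _)
      simpa [hu, hun] using this.trans_eq (by rw [← hun]; simp [hu])
  have hud : ∀ i, u (i + 1) - u i ≤ (b - a) / n := fun i => by
    have : ((min (i + 1) n : ℕ) : ℝ) ≤ (min i n : ℕ) + 1 := by
      have : min (i + 1) n ≤ min i n + 1 := by omega
      exact_mod_cast this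
    simp only [hu]
    nlinarith
  have hint : ∀ x y, IntervalIntegrable (fun t => ‖g' t‖) volume x y := fun x y =>
    hg'.norm.intervalIntegrable x y
  have hpiece : ∀ i, ∫ t in u i..u (i + 1), ‖g' t‖ ≤
      ‖g (u (i + 1)) - g (u i)‖ + 2 * η * (u (i + 1) - u i) := fun i => by
    have hle := hmono (Nat.le_succ i)
    have hnear : ∀ t ∈ Icc (u i) (u (i + 1)), ‖g' t - g' (u i)‖ ≤ η := fun t ht => by
      rw [← dist_eq_norm]
      refine (hδη t ⟨(hus i).1.trans ht.1, ht.2.trans (hus _).2⟩ (u i) (hus i) ?_).le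
      rw [Real.dist_eq, abs_of_nonneg (sub_nonneg.2 ht.1)]
      linarith [hud i, ht.2]
    have h1 : ∫ t in u i..u (i + 1), ‖g' t‖ ≤ ∫ t in u i..u (i + 1), (‖g' (u i)‖ + η) := by
      refine intervalIntegral.integral_mono_on hle (hint _ _) (by simp) fun t ht => ?_
      have := norm_le_norm_add_norm_sub' (g' t) (g' (u i))
      linarith [hnear t ht]
    have h2 : ‖(∫ t in u i..u (i + 1), (g' t - g' (u i)))‖ ≤ η * |u (i + 1) - u i| :=
      intervalIntegral.norm_integral_le_of_norm_le_const fun t ht => by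
        rw [uIoc_of_le hle] at ht
        exact hnear t ⟨ht.1.le, ht.2⟩
    rw [intervalIntegral.integral_sub (hg'.intervalIntegrable _ _) (by simp),
      intervalIntegral.integral_eq_sub_of_hasDerivAt (fun t _ => hg t)
        (hg'.intervalIntegrable _ _), abs_of_nonneg (sub_nonneg.2 hle)] at h2
    rw [intervalIntegral.integral_const, smul_eq_mul] at h1
    rw [intervalIntegral.integral_const] at h2
    have h3 : ‖(u (i + 1) - u i) • g' (u i)‖ = (u (i + 1) - u i) * ‖g' (u i)‖ := by
      rw [norm_smul, Real.norm_of_nonneg (sub_nonneg.2 hle)]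
    have h4 := norm_le_norm_add_norm_sub ((g (u (i + 1)) - g (u i))) ((u (i + 1) - u i) • g' (u i))
    nlinarith
  calc ∫ t in a..b, ‖g' t‖ = ∑ i ∈ Finset.range n, ∫ t in u i..u (i + 1), ‖g' t‖ := by
        rw [intervalIntegral.sum_integral_adjacent_intervals fun _ _ => hint _ _, hu0, hun]
    _ ≤ ∑ i ∈ Finset.range n,
        (‖g (u (i + 1)) - g (u i)‖ + 2 * η * (u (i + 1) - u i)) :=
        Finset.sum_le_sum fun i _ => hpiece i
    _ = ∑ i ∈ Finset.range n, ‖g (u (i + 1)) - g (u i)‖ + 2 * η * (b - a) := by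
        rw [Finset.sum_add_distrib, ← Finset.mul_sum, Finset.sum_range_sub, hu0, hun]
    _ ≤ B + ε := by
        refine add_le_add ?_ hηε
        have h := (eVariationOn.sum_le (f := g) (s := Icc a b) (n := n) hmono hus).trans hv
        simp only [edist_dist, dist_eq_norm] at h
        rw [← ENNReal.ofReal_sum_of_nonneg fun _ _ => norm_nonneg _] at h
        exact (ENNReal.ofReal_le_ofReal_iff hB).1 h

/-- The integral of the Liouville form over the difference of two nearby curves of bounded length
is small. -/
theorem abs_integral_liouville_sub_le {g h g' h' : ℝ → ℂ} {T t B R η : ℝ}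
    (hg : ∀ t, HasDerivAt g (g' t) t) (hg' : Continuous g')
    (hh : ∀ t, HasDerivAt h (h' t) t) (hh' : Continuous h') (hT : t ∈ Icc (-T) T)
    (hBg : ∫ t in (-T)..T, ‖g' t‖ ≤ B) (hBh : ∫ t in (-T)..T, ‖h' t‖ ≤ B)
    (hR : ∀ t, ‖h t‖ ≤ R) (hη : ∀ t, ‖g t - h t‖ ≤ η) :
    |(∫ s in 0..t, (g s).im * (g' s).re) - ∫ s in 0..t, (h s).im * (h' s).re| ≤
      2 * η * B + 2 * (R * η) := by
  have hη0 : 0 ≤ η := (norm_nonneg _).trans (hη 0)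
  have hgc : Continuous g := continuous_iff_continuousAt.2 fun t => (hg t).continuousAt
  have hhc : Continuous h := continuous_iff_continuousAt.2 fun t => (hh t).continuousAt
  have hre : ∀ {k k' : ℝ → ℂ}, (∀ t, HasDerivAt k (k' t) t) →
      ∀ t, HasDerivAt (fun s => (k s).re) (k' t).re t := fun hk t =>
    Complex.reCLM.hasFDerivAt.comp_hasDerivAt t (hk t)
  have him : ∀ {k k' : ℝ → ℂ}, (∀ t, HasDerivAt k (k' t) t) →
      ∀ t, HasDerivAt (fun s => (k s).im) (k' t).im t := fun hk t =>
    Complex.imCLM.hasFDerivAt.comp_hasDerivAt t (hk t)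
  -- The derivatives of `g` and `h` need not be close, only the curves are; integration by parts
  -- moves the derivative off `g - h` and onto `h`.
  have hparts := intervalIntegral.integral_mul_deriv_eq_deriv_mul (a := 0) (b := t)
    (u := fun s => (h s).im) (v := fun s => (g s).re - (h s).re)
    (u' := fun s => (h' s).im) (v' := fun s => (g' s).re - (h' s).re)
    (fun s _ => him hh s) (fun s _ => (hre hg s).sub (hre hh s))
    (Continuous.intervalIntegrable (by fun_prop) _ _)
    (Continuous.intervalIntegrable (by fun_prop) _ _)
  have hsplit : (∫ s in 0..t, (g s).im * (g' s).re) - ∫ s in 0..t, (h s).im * (h' s).re =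
      (∫ s in 0..t, ((g s).im - (h s).im) * (g' s).re) +
        ∫ s in 0..t, (h s).im * ((g' s).re - (h' s).re) := by
    rw [← intervalIntegral.integral_sub (Continuous.intervalIntegrable (by fun_prop) _ _)
      (Continuous.intervalIntegrable (by fun_prop) _ _), ← intervalIntegral.integral_add
      (Continuous.intervalIntegrable (by fun_prop) _ _)
      (Continuous.intervalIntegrable (by fun_prop) _ _)]
    exact intervalIntegral.integral_congr fun s _ => by ring
  have hkey : ∀ {k k' : ℝ → ℝ} {G : ℝ → ℂ}, Continuous k → Continuous k' → Continuous G →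
      (∀ s, |k s| ≤ η) → (∀ s, |k' s| ≤ ‖G s‖) → ∫ s in (-T)..T, ‖G s‖ ≤ B →
      |∫ s in 0..t, k s * k' s| ≤ η * B := by
    intro k k' G hk hk' hG h1 h2 h3
    have hsub : uIoc 0 t ⊆ Ioc (-T) T := by
      intro s hs
      rcases mem_uIoc.1 hs with hs | hs
      · exact ⟨by linarith [hs.1, hT.1, hT.2, hs.2], hs.2.trans hT.2⟩
      · exact ⟨hT.1.trans_lt hs.1, by linarith [hs.1, hs.2, hT.1]⟩
    have hTT : -T ≤ T := hT.1.trans hT.2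
    calc |∫ s in 0..t, k s * k' s| ≤ ∫ s in uIoc 0 t, ‖k s * k' s‖ := by
          rw [← Real.norm_eq_abs]
          exact intervalIntegral.norm_integral_le_integral_norm_uIoc
      _ ≤ ∫ s in Ioc (-T) T, ‖k s * k' s‖ := by
          refine setIntegral_mono_set ?_ (ae_of_all _ fun s => norm_nonneg _)
            (LE.le.eventuallyLE hsub)
          exact ((hk.mul hk').norm.integrableOn_Icc).mono_set Ioc_subset_Icc_self
      _ = ∫ s in (-T)..T, ‖k s * k' s‖ := (intervalIntegral.integral_of_le hTT).symm
      _ ≤ ∫ s in (-T)..T, η * ‖G s‖ := by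
          refine intervalIntegral.integral_mono hTT
            (Continuous.intervalIntegrable (by fun_prop) _ _)
            (Continuous.intervalIntegrable (by fun_prop) _ _) fun s => ?_
          rw [norm_mul]
          exact mul_le_mul (h1 s) (h2 s) (norm_nonneg _) hη0
      _ ≤ η * B := by
          rw [intervalIntegral.integral_const_mul]
          exact mul_le_mul_of_nonneg_left h3 hη0
  have e1 := hkey (k := fun s => (g s).im - (h s).im) (k' := fun s => (g' s).re) (G := g')
    (by fun_prop) (by fun_prop) hg' (fun s => by
      rw [← Complex.sub_im]; exact (Complex.abs_im_le_norm _).trans (hη s))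
    (fun s => Complex.abs_re_le_norm _) hBg
  have e2 := hkey (k := fun s => (g s).re - (h s).re) (k' := fun s => (h' s).im) (G := h')
    (by fun_prop) (by fun_prop) hh' (fun s => by
      rw [← Complex.sub_re]; exact (Complex.abs_re_le_norm _).trans (hη s))
    (fun s => Complex.abs_im_le_norm _) hBh
  have e3 : ∀ s, |(h s).im * ((g s).re - (h s).re)| ≤ R * η := fun s => by
    rw [abs_mul, ← Complex.sub_re]
    exact mul_le_mul ((Complex.abs_im_le_norm _).trans (hR s))
      ((Complex.abs_re_le_norm _).trans (hη s)) (abs_nonneg _)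
      ((norm_nonneg _).trans (hR s))
  have e4 : (∫ s in 0..t, (h' s).im * ((g s).re - (h s).re)) =
      ∫ s in 0..t, ((g s).re - (h s).re) * (h' s).im :=
    intervalIntegral.integral_congr fun s _ => mul_comm _ _
  rw [hsplit, hparts, e4]
  have f1 := abs_le.1 e1
  have f2 := abs_le.1 e2
  have f3 := abs_le.1 (e3 0)
  have f4 := abs_le.1 (e3 t)
  rw [abs_le]
  constructor <;> linarith [f1.1, f1.2, f2.1, f2.2, f3.1, f3.2, f4.1, f4.2]

/-- The primitives of the Liouville form along a uniformly convergent sequence of curves of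
locally bounded length converge locally uniformly. -/
theorem exists_tendstoUniformlyOn_liouville {G G' : ℕ → ℝ → ℂ} {γ : ℝ → ℂ} {R : ℝ}
    (hG : ∀ n t, HasDerivAt (G n) (G' n t) t) (hG' : ∀ n, Continuous (G' n))
    (hlim : TendstoUniformly G γ atTop) (hR : ∀ n t, ‖G n t‖ ≤ R)
    (hB : ∀ T : ℝ, ∃ B, 0 ≤ B ∧ ∀ n, ∫ t in (-T)..T, ‖G' n t‖ ≤ B) :
    ∃ f : ℝ → ℝ, Continuous f ∧ ∀ K, IsCompact K →
      TendstoUniformlyOn (fun n t => ∫ s in 0..t, (G n s).im * (G' n s).re) f atTop K := by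
  set F : ℕ → ℝ → ℝ := fun n t => ∫ s in 0..t, (G n s).im * (G' n s).re with hF
  have hGc : ∀ n, Continuous (G n) := fun n =>
    continuous_iff_continuousAt.2 fun t => (hG n t).continuousAt
  have hFc : ∀ n, Continuous (F n) := fun n =>
    intervalIntegral.continuous_primitive
      (fun _ _ => Continuous.intervalIntegrable (by have := hGc n; have := hG' n; fun_prop) _ _) 0
  have hR0 : 0 ≤ R := (norm_nonneg _).trans (hR 0 0)
  have hcauchy : ∀ T, UniformCauchySeqOn F atTop (Icc (-T) T) := fun T => by
    obtain ⟨B, hB0, hBn⟩ := hB T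
    rw [Metric.uniformCauchySeqOn_iff]
    intro ε hε
    -- Two curves this close to the limit are within `η = ε / (4 (B + R + 1))` of each other, and
    -- then `2 η B + 2 R η < ε`.
    obtain ⟨N, hN⟩ := (Metric.tendstoUniformly_iff.1 hlim (ε / (8 * (B + R + 1)))
      (by positivity)).exists_forall_of_atTop
    refine ⟨N, fun m hm n hn t ht => ?_⟩
    rw [Real.dist_eq]
    refine (abs_integral_liouville_sub_le (hG m) (hG' m) (hG n) (hG' n) ht (hBn m) (hBn n) (hR n)
      (η := ε / (4 * (B + R + 1))) fun s => ?_).trans_lt ?_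
    · rw [← dist_eq_norm]
      have h1 := hN m hm s
      have h2 := hN n hn s
      have h3 := dist_triangle_left (G m s) (G n s) (γ s)
      rw [show ε / (4 * (B + R + 1)) = ε / (8 * (B + R + 1)) + ε / (8 * (B + R + 1)) by
        field_simp; norm_num]
      linarith
    · rw [show 2 * (ε / (4 * (B + R + 1))) * B + 2 * (R * (ε / (4 * (B + R + 1)))) =
        ε * ((B + R) / (2 * (B + R + 1))) by field_simp; ring]
      refine mul_lt_of_lt_one_right hε ((div_lt_one (by positivity)).2 (by linarith))
  have hex : ∀ t, ∃ y, Tendsto (fun n => F n t) atTop (𝓝 y) := fun t =>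
    cauchySeq_tendsto_of_complete
      ((hcauchy |t|).cauchySeq ⟨neg_abs_le t, le_abs_self t⟩)
  choose f hf using hex
  have hunif : ∀ T, TendstoUniformlyOn F f atTop (Icc (-T) T) := fun T =>
    (hcauchy T).tendstoUniformlyOn_of_tendsto fun t _ => hf t
  refine ⟨f, ?_, fun K hK => ?_⟩
  · rw [continuous_iff_continuousAt]
    intro t
    have h1 := (hunif (|t| + 1)).continuousOn (Frequently.of_forall fun n => (hFc n).continuousOn)
    refine h1.continuousAt (Icc_mem_nhds ?_ ?_)
    · linarith [neg_abs_le t]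
    · linarith [le_abs_self t]
  · obtain ⟨T, hT⟩ := hK.isBounded.subset_closedBall 0
    refine (hunif T).mono (hT.trans ?_)
    rw [Real.closedBall_eq_Icc]
    simp

/-! ### The concentric curves of a Riemann map. -/

section ConcentricCurves

variable {φ : ℂ → ℂ} {D : Set ℂ} {r : ℝ}

theorem range_circleImage_one (φ : ℂ → ℂ) :
    range (circleImage φ 1) = φ '' Metric.sphere 0 1 := by
  ext w
  constructor
  · rintro ⟨z, rfl⟩
    exact ⟨z, mem_sphere_zero_iff_norm.2 z.norm_coe, by simp [circleImage]⟩
  · rintro ⟨z, hz, rfl⟩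
    exact ⟨⟨z, hz⟩, by simp [circleImage]⟩

theorem norm_ofReal_mul_circle (hr : 0 ≤ r) (z : Circle) : ‖(r : ℂ) * z‖ = r := by
  rw [norm_mul, Circle.norm_coe, mul_one, Complex.norm_of_nonneg hr]

theorem IsExtendedRiemannMap.isJordanCurve_circleImage (hφ : IsExtendedRiemannMap φ D)
    (hr : r ∈ Ioc 0 1) : IsJordanCurve (circleImage φ r) := by
  have hmem : ∀ z : Circle, (r : ℂ) * z ∈ Metric.closedBall (0 : ℂ) 1 := fun z => by
    rw [mem_closedBall_zero_iff, norm_ofReal_mul_circle hr.1.le]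
    exact hr.2
  refine ⟨hφ.1.comp_continuous (by fun_prop) hmem, fun z w hzw => ?_⟩
  have h := hφ.2.1.injOn (hmem z) (hmem w) hzw
  exact Circle.ext (mul_left_cancel₀ (by exact_mod_cast hr.1.ne') h)

theorem hasDerivAt_ofReal_mul_circle_exp (r t : ℝ) :
    HasDerivAt (fun s : ℝ => (r : ℂ) * (Circle.exp s : ℂ))
      (r * (Circle.exp t : ℂ) * Complex.I) t := by
  have h : HasDerivAt (fun s : ℝ => Complex.exp (s * Complex.I))
      (Complex.exp (t * Complex.I) * (1 * Complex.I)) t :=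
    ((Complex.ofRealCLM.hasDerivAt (x := t)).mul_const Complex.I).cexp
  have h2 := h.const_mul (r : ℂ)
  simp only [one_mul, ← mul_assoc] at h2
  simpa only [Circle.coe_exp] using h2

theorem contDiff_ofReal_mul_circle_exp (r : ℝ) :
    ContDiff ℝ (⊤ : ℕ∞) fun s : ℝ => (r : ℂ) * (Circle.exp s : ℂ) := by
  simp only [Circle.coe_exp]
  exact contDiff_const.mul ((Complex.ofRealCLM.contDiff.mul contDiff_const).cexp)

/-- The velocity of the curve `t ↦ φ (r e ^ (i t))`. -/
noncomputable def circleVelocity (φ : ℂ → ℂ) (r t : ℝ) : ℂ :=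
  deriv φ (r * Circle.exp t) * (r * (Circle.exp t : ℂ) * Complex.I)

theorem ofReal_mul_circle_mem_ball (hr : r ∈ Ico 0 1) (z : Circle) :
    (r : ℂ) * z ∈ Metric.ball (0 : ℂ) 1 := by
  rw [mem_ball_zero_iff, norm_ofReal_mul_circle hr.1]
  exact hr.2

theorem hasDerivAt_lift_circleImage (hd : DifferentiableOn ℂ φ (Metric.ball 0 1))
    (hr : r ∈ Ico 0 1) (t : ℝ) :
    HasDerivAt (lift (circleImage φ r)) (circleVelocity φ r t) t :=
  ((hd.differentiableAt (Metric.isOpen_ball.mem_nhds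
    (ofReal_mul_circle_mem_ball hr _))).hasDerivAt).comp t (hasDerivAt_ofReal_mul_circle_exp r t)

theorem continuous_circleVelocity (hd : DifferentiableOn ℂ φ (Metric.ball 0 1))
    (hr : r ∈ Ico 0 1) : Continuous (circleVelocity φ r) := by
  have h : Continuous fun t : ℝ => deriv φ (r * Circle.exp t) :=
    (hd.deriv Metric.isOpen_ball).continuousOn.comp_continuous (by fun_prop)
      fun t => ofReal_mul_circle_mem_ball hr _
  unfold circleVelocity
  fun_prop

theorem contDiff_lift_circleImage (hd : DifferentiableOn ℂ φ (Metric.ball 0 1))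
    (hr : r ∈ Ico 0 1) : ContDiff ℝ (⊤ : ℕ∞) (lift (circleImage φ r)) := by
  have h : ContDiffOn ℝ (⊤ : ℕ∞) φ (Metric.ball 0 1) :=
    (hd.contDiffOn Metric.isOpen_ball).restrict_scalars ℝ
  exact h.comp_contDiff (contDiff_ofReal_mul_circle_exp r) fun t => ofReal_mul_circle_mem_ball hr _

theorem IsExtendedRiemannMap.circleVelocity_ne_zero (hφ : IsExtendedRiemannMap φ D)
    (hr : r ∈ Ioo 0 1) (t : ℝ) : circleVelocity φ r t ≠ 0 := by
  have hr0 : (r : ℂ) ≠ 0 := by exact_mod_cast hr.1.ne'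
  exact mul_ne_zero (deriv_ne_zero_of_injOn Metric.isOpen_ball hφ.2.2.1 hφ.2.2.2.injOn
    (ofReal_mul_circle_mem_ball ⟨hr.1.le, hr.2⟩ _))
    (mul_ne_zero (mul_ne_zero hr0 (Circle.coe_ne_zero _)) Complex.I_ne_zero)

theorem IsExtendedRiemannMap.isSmoothJordanCurve_circleImage (hφ : IsExtendedRiemannMap φ D)
    (hr : r ∈ Ioo 0 1) : IsSmoothJordanCurve (circleImage φ r) := by
  refine ⟨hφ.isJordanCurve_circleImage ⟨hr.1, hr.2.le⟩,
    contDiff_lift_circleImage hφ.2.2.1 ⟨hr.1.le, hr.2⟩, fun t => ?_⟩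
  rw [(hasDerivAt_lift_circleImage hφ.2.2.1 ⟨hr.1.le, hr.2⟩ t).deriv]
  exact hφ.circleVelocity_ne_zero hr t

/-- The shift by two makes the index range start at `n = 2` of the original sequence `1 - 1 / n`. -/
theorem one_sub_inv_mem_Ioo (n : ℕ) : 1 - 1 / ((n : ℝ) + 2) ∈ Ioo (0 : ℝ) 1 := by
  have h : (0 : ℝ) < 1 / ((n : ℝ) + 2) := by positivity
  have h2 : 1 / ((n : ℝ) + 2) < 1 := by
    rw [div_lt_one (by positivity)]
    linarith [n.cast_nonneg (α := ℝ)]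
  constructor <;> linarith

theorem tendsto_one_sub_inv : Tendsto (fun n : ℕ => 1 - 1 / ((n : ℝ) + 2)) atTop (𝓝 1) := by
  have h : Tendsto (fun n : ℕ => ((n : ℝ) + 2)) atTop atTop :=
    tendsto_atTop_add_const_right _ _ tendsto_natCast_atTop_atTop
  simpa using (h.const_div_atTop 1).const_sub 1

theorem tendstoUniformly_circleImage (hφ : ContinuousOn φ (Metric.closedBall 0 1)) {r : ℕ → ℝ}
    (hr : ∀ n, r n ∈ Icc 0 1) (hlim : Tendsto r atTop (𝓝 1)) :
    TendstoUniformly (fun n => circleImage φ (r n)) (circleImage φ 1) atTop := by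
  rw [Metric.tendstoUniformly_iff]
  intro ε hε
  obtain ⟨δ, hδ, h⟩ := Metric.uniformContinuousOn_iff.1
    ((isCompact_closedBall (0 : ℂ) 1).uniformContinuousOn_of_continuous hφ) ε hε
  filter_upwards [Metric.tendsto_nhds.1 hlim δ hδ] with n hn z
  have hmem : ∀ s ∈ Icc (0 : ℝ) 1, (s : ℂ) * z ∈ Metric.closedBall (0 : ℂ) 1 := fun s hs => by
    rw [mem_closedBall_zero_iff, norm_ofReal_mul_circle hs.1]
    exact hs.2
  refine h _ (hmem 1 (by simp)) _ (hmem _ (hr n)) ?_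
  rw [dist_eq_norm, ← sub_mul, norm_mul, Circle.norm_coe, mul_one, ← Complex.ofReal_sub,
    Complex.norm_real, ← dist_eq_norm, dist_comm]
  exact hn

/-- Integrating the Liouville form along a continuously differentiable lift gives its primitive. -/
theorem isLiouvillePrimitive_of_hasDerivAt {c : Circle → ℂ} {g' : ℝ → ℂ}
    (hg : ∀ t, HasDerivAt (lift c) (g' t) t) (hg' : Continuous g') :
    IsLiouvillePrimitive c fun t => ∫ s in 0..t, (lift c s).im * (g' s).re := by
  refine ⟨by simp, fun t => ?_⟩
  have hgc : Continuous (lift c) := continuous_iff_continuousAt.2 fun t => (hg t).continuousAt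
  have hre : HasDerivAt (fun s => (lift c s).re) (g' t).re t :=
    Complex.reCLM.hasFDerivAt.comp_hasDerivAt t (hg t)
  rw [hre.deriv]
  exact (Continuous.integral_hasStrictDerivAt (f := fun s => (lift c s).im * (g' s).re)
    (by fun_prop) 0 t).hasDerivAt

/-- The concentric images under an extended Riemann map approximate the boundary curve when the
latter has locally finite variation. -/
theorem IsExtendedRiemannMap.exists_tendstoUniformlyOn_liouville (hφ : IsExtendedRiemannMap φ D)
    (hv : ∀ a b, eVariationOn (lift (circleImage φ 1)) (Icc a b) < ⊤) {r : ℕ → ℝ}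
    (hr : ∀ n, r n ∈ Ioo 0 1) (hlim : Tendsto r atTop (𝓝 1)) :
    ∃ f : ℝ → ℝ, Continuous f ∧ ∀ K, IsCompact K →
      TendstoUniformlyOn (fun n t => ∫ s in 0..t, (lift (circleImage φ (r n)) s).im *
        (circleVelocity φ (r n) s).re) f atTop K := by
  have hr' : ∀ n, r n ∈ Ico 0 1 := fun n => ⟨(hr n).1.le, (hr n).2⟩
  obtain ⟨R, hR⟩ := ((isCompact_closedBall (0 : ℂ) 1).image_of_continuousOn hφ.1).isBounded
    |>.exists_norm_le
  refine RectangularPeg.exists_tendstoUniformlyOn_liouville (γ := lift (circleImage φ 1)) (R := R)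
    (fun n => hasDerivAt_lift_circleImage hφ.2.2.1 (hr' n))
    (fun n => continuous_circleVelocity hφ.2.2.1 (hr' n)) ?_ (fun n t => ?_) fun T => ?_
  · exact (tendstoUniformly_circleImage hφ.1 (fun n => ⟨(hr n).1.le, (hr n).2.le⟩)
      hlim).comp fun t : ℝ => Circle.exp t
  · exact hR _ ⟨_, Metric.ball_subset_closedBall (ofReal_mul_circle_mem_ball (hr' n) _), rfl⟩
  · obtain ⟨B, hB, hle⟩ := exists_eVariationOn_circleImage_le hφ.1 hφ.2.2.1 hv |T|
    refine ⟨B, hB, fun n => ?_⟩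
    -- For negative `T` the oriented integral is nonpositive and any `B ≥ 0` serves.
    rcases le_total 0 T with hT | hT
    · have h := hle _ (hr' n)
      rw [abs_of_nonneg hT] at h
      exact integral_norm_deriv_le_of_eVariationOn_le (by linarith) hB
        (hasDerivAt_lift_circleImage hφ.2.2.1 (hr' n))
        (continuous_circleVelocity hφ.2.2.1 (hr' n)) h
    · rw [intervalIntegral.integral_symm]
      have := intervalIntegral.integral_nonneg (f := fun t => ‖circleVelocity φ (r n) t‖)
        (μ := volume) (show T ≤ -T by linarith) fun t _ => norm_nonneg _
      linarith

/-- The domain depends on the curve only through its image. -/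
theorem enclosedDomain_congr {c c' : Circle → ℂ} (h : range c = range c') :
    enclosedDomain c = enclosedDomain c' := by
  simp only [enclosedDomain, h]

end ConcentricCurves

/-! ### Smoothing monotone maps of degree one. -/

section Mollification

open scoped Convolution

variable {M : ℝ → ℝ}

theorem apply_add_int_mul_two_pi (hq : ∀ t, M (t + 2 * Real.pi) = M t + 2 * Real.pi) (m : ℤ)
    (t : ℝ) : M (t + m * (2 * Real.pi)) = M t + m * (2 * Real.pi) := by
  have hper : Function.Periodic (fun t => M t - t) (2 * Real.pi) := fun t => by
    change M (t + 2 * Real.pi) - (t + 2 * Real.pi) = M t - t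
    rw [hq]; ring
  have h : M (t + m * (2 * Real.pi)) - (t + m * (2 * Real.pi)) = M t - t := hper.int_mul m t
  linarith

theorem exists_int_add_mem_Icc (t : ℝ) :
    ∃ m : ℤ, t + m * (2 * Real.pi) ∈ Icc 0 (2 * Real.pi) := by
  refine ⟨-⌊t / (2 * Real.pi)⌋, ?_⟩
  have hpi := Real.two_pi_pos
  have h1 := (le_div_iff₀ hpi).1 (Int.floor_le (t / (2 * Real.pi)))
  have h2 := (div_lt_iff₀ hpi).1 (Int.lt_floor_add_one (t / (2 * Real.pi)))
  push_cast
  constructor <;> linarith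

theorem uniformContinuous_of_apply_add_two_pi (hM : Continuous M)
    (hq : ∀ t, M (t + 2 * Real.pi) = M t + 2 * Real.pi) : UniformContinuous M := by
  rw [Metric.uniformContinuous_iff]
  intro ε hε
  obtain ⟨δ, hδ, h⟩ := Metric.uniformContinuousOn_iff.1
    ((isCompact_Icc (a := -1) (b := 2 * Real.pi + 1)).uniformContinuousOn_of_continuous
      hM.continuousOn) ε hε
  refine ⟨min δ 1, by positivity, fun {s t} hst => ?_⟩
  obtain ⟨m, hm⟩ := exists_int_add_mem_Icc t
  have hst1 := abs_lt.1 ((Real.dist_eq s t ▸ hst).trans_le (min_le_right _ _))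
  have := h (s + m * (2 * Real.pi)) ⟨by linarith [hm.1, hst1.1], by linarith [hm.2, hst1.2]⟩
    (t + m * (2 * Real.pi)) ⟨by linarith [hm.1], by linarith [hm.2]⟩
    (by rw [dist_add_right]; exact hst.trans_le (min_le_left _ _))
  rwa [apply_add_int_mul_two_pi hq, apply_add_int_mul_two_pi hq, dist_add_right] at this

/-- Convolution with a nonnegative bump of mass one preserves both monotonicity and the translation
law; closeness is uniform because `M` is uniformly continuous. -/
theorem exists_smooth_monotone_approximation (hM : Continuous M) (hmono : Monotone M)
    (hq : ∀ t, M (t + 2 * Real.pi) = M t + 2 * Real.pi) {ε : ℝ} (hε : 0 < ε) :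
    ∃ N : ℝ → ℝ, ContDiff ℝ (⊤ : ℕ∞) N ∧ Monotone N ∧
      (∀ t, N (t + 2 * Real.pi) = N t + 2 * Real.pi) ∧ ∀ t, |N t - M t| ≤ ε := by
  obtain ⟨δ, hδ, h⟩ := Metric.uniformContinuous_iff.1
    (uniformContinuous_of_apply_add_two_pi hM hq) ε hε
  let ρ : ContDiffBump (0 : ℝ) := ⟨δ / 2, δ, half_pos hδ, half_lt_self hδ⟩
  have hint : ∀ t, Integrable fun s => ρ.normed volume s * M (t - s) := fun t =>
    (Continuous.integrable_of_hasCompactSupport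
      (ρ.continuous_normed.mul (by fun_prop)) ρ.hasCompactSupport_normed.mul_right)
  refine ⟨fun t => ∫ s, ρ.normed volume s * M (t - s), ?_, fun a b hab => ?_, fun t => ?_,
    fun t => ?_⟩
  · exact ρ.hasCompactSupport_normed.contDiff_convolution_left (ContinuousLinearMap.lsmul ℝ ℝ)
      ρ.contDiff_normed hM.locallyIntegrable
  · exact integral_mono (hint a) (hint b) fun s =>
      mul_le_mul_of_nonneg_left (hmono (by linarith)) (ρ.nonneg_normed s)
  · have h1 : ∀ s, ρ.normed volume s * M (t + 2 * Real.pi - s) =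
        ρ.normed volume s * M (t - s) + ρ.normed volume s * (2 * Real.pi) := fun s => by
      rw [show t + 2 * Real.pi - s = t - s + 2 * Real.pi by ring, hq]; ring
    simp only [h1]
    rw [integral_add (hint t) (ρ.integrable_normed.mul_const _), integral_mul_const,
      ρ.integral_normed, one_mul]
  · rw [← Real.dist_eq]
    exact ρ.dist_normed_convolution_le (μ := volume) hM.aestronglyMeasurable
      fun s hs => (h hs).le

/-- A degree one monotone map is a uniform limit of degree one diffeomorphisms. -/
theorem exists_smooth_approximation_of_monotone (hM : Continuous M) (hmono : Monotone M)
    (hq : ∀ t, M (t + 2 * Real.pi) = M t + 2 * Real.pi) {ε : ℝ} (hε : 0 < ε) :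
    ∃ N : ℝ → ℝ, ContDiff ℝ (⊤ : ℕ∞) N ∧ (∀ t, 0 < deriv N t) ∧
      (∀ t, N (t + 2 * Real.pi) = N t + 2 * Real.pi) ∧ ∀ t, |N t - M t| ≤ ε := by
  obtain ⟨N, hN, hNm, hNq, hNM⟩ := exists_smooth_monotone_approximation hM hmono hq (half_pos hε)
  obtain ⟨C, hC⟩ := (isCompact_Icc (a := 0) (b := 2 * Real.pi)).exists_bound_of_continuousOn
    (f := fun t => t - N t) (by have := hN.continuous; fun_prop)
  have hC0 : 0 ≤ C := (norm_nonneg _).trans (hC 0 ⟨le_rfl, Real.two_pi_pos.le⟩)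
  have hC' : ∀ t, |t - N t| ≤ C := fun t => by
    obtain ⟨m, hm⟩ := exists_int_add_mem_Icc t
    have h := hC _ hm
    rwa [apply_add_int_mul_two_pi hNq, Real.norm_eq_abs, add_sub_add_right_eq_sub] at h
  -- Blending with the identity raises the derivative to at least `η > 0` and moves the map by at
  -- most `η * C ≤ ε / 2`.
  set η : ℝ := min 1 (ε / (2 * (C + 1))) with hη
  have hη0 : 0 < η := by positivity
  have hη1 : η ≤ 1 := min_le_left _ _
  have hηC : η * C ≤ ε / 2 := by
    have h : η ≤ ε / (2 * (C + 1)) := min_le_right _ _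
    rw [le_div_iff₀ (by positivity)] at h
    nlinarith
  have hNd : Differentiable ℝ N := hN.differentiable (by simp)
  refine ⟨fun t => (1 - η) * N t + η * t, by fun_prop, fun t => ?_, fun t => ?_, fun t => ?_⟩
  · have h : HasDerivAt (fun t => (1 - η) * N t + η * t) ((1 - η) * deriv N t + η * 1) t :=
      ((hNd t).hasDerivAt.const_mul _).add ((hasDerivAt_id t).const_mul _)
    rw [h.deriv]
    have := mul_nonneg (sub_nonneg.2 hη1) (hNm.deriv_nonneg (x := t))
    linarith
  · simp only [hNq]; ring
  · have h1 : (1 - η) * N t + η * t - M t = (N t - M t) + η * (t - N t) := by ring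
    rw [h1]
    refine (abs_add_le _ _).trans ?_
    rw [abs_mul, abs_of_pos hη0]
    have := mul_le_mul_of_nonneg_left (hC' t) hη0.le
    linarith [hNM t]

end Mollification

/-! ### Transfer to another parametrization of the same curve. -/

/-- Locally uniform convergence is stable under composition. -/
theorem tendstoUniformlyOn_comp_real {E : Type*} [PseudoMetricSpace E] {F : ℕ → ℝ → E} {f : ℝ → E}
    (hf : Continuous f) (hF : ∀ K, IsCompact K → TendstoUniformlyOn F f atTop K)
    {g : ℕ → ℝ → ℝ} {g₀ : ℝ → ℝ} (hg₀ : Continuous g₀) {K : Set ℝ} (hK : IsCompact K)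
    (hg : TendstoUniformlyOn g g₀ atTop K) :
    TendstoUniformlyOn (fun n t => F n (g n t)) (fun t => f (g₀ t)) atTop K := by
  rw [Metric.tendstoUniformlyOn_iff]
  intro ε hε
  -- A compact set that contains the values of `g n` on `K` for all large `n`.
  have hL : IsCompact (Metric.cthickening 1 (g₀ '' K)) := (hK.image hg₀).cthickening
  obtain ⟨δ, hδ, h⟩ := Metric.uniformContinuousOn_iff.1
    (hL.uniformContinuousOn_of_continuous hf.continuousOn) (ε / 2) (half_pos hε)
  filter_upwards [Metric.tendstoUniformlyOn_iff.1 hg (min δ 1) (by positivity),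
    Metric.tendstoUniformlyOn_iff.1 (hF _ hL) (ε / 2) (half_pos hε)] with n h1 h2 t ht
  have hd := h1 t ht
  have hm : g n t ∈ Metric.cthickening 1 (g₀ '' K) :=
    Metric.mem_cthickening_of_dist_le _ _ _ _ (mem_image_of_mem g₀ ht)
      ((dist_comm _ _).trans_le (hd.le.trans (min_le_right _ _)))
  have hm₀ : g₀ t ∈ Metric.cthickening 1 (g₀ '' K) :=
    Metric.self_subset_cthickening _ (mem_image_of_mem g₀ ht)
  have := dist_triangle (f (g₀ t)) (f (g n t)) (F n (g n t))
  linarith [h _ hm₀ _ hm (hd.trans_le (min_le_left _ _)), h2 _ hm]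

/-- Reparametrizing a smooth Jordan curve by a degree one diffeomorphism. -/
theorem IsSmoothJordanCurve.exists_reparametrization {b : Circle → ℂ} (hb : IsSmoothJordanCurve b)
    {σ : ℝ} (hσ : σ = 1 ∨ σ = -1) {N : ℝ → ℝ} (hN : ContDiff ℝ (⊤ : ℕ∞) N)
    (hN' : ∀ t, 0 < deriv N t) (hq : ∀ t, N (t + 2 * Real.pi) = N t + 2 * Real.pi) :
    ∃ a : Circle → ℂ, IsSmoothJordanCurve a ∧ ∀ t, lift a t = lift b (σ * N t) := by
  have hσ0 : σ ≠ 0 := by rcases hσ with rfl | rfl <;> norm_num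
  have hbc : Continuous (lift b) := hb.2.1.continuous
  have hNc : Continuous N := hN.continuous
  have hper : Function.Periodic (fun t => lift b (σ * N t)) (2 * Real.pi) := fun t => by
    change lift b (σ * N (t + 2 * Real.pi)) = lift b (σ * N t)
    rw [hq]
    rcases hσ with rfl | rfl
    · rw [mul_add, one_mul (2 * Real.pi), lift_periodic b]
    · rw [mul_add, neg_one_mul (2 * Real.pi), ← sub_eq_add_neg, (lift_periodic b).sub_eq]
  obtain ⟨a, ha, hab⟩ := exists_circle_factor (by fun_prop) hper
  have hlift : lift a = fun t => lift b (σ * N t) := funext hab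
  have hNmono : StrictMono N := strictMono_of_deriv_pos hN'
  refine ⟨a, ⟨⟨ha, fun z w hzw => ?_⟩, ?_, fun t => ?_⟩, hab⟩
  · obtain ⟨s, rfl⟩ := Circle.exp_surjective z
    obtain ⟨t, rfl⟩ := Circle.exp_surjective w
    rw [hab, hab] at hzw
    have h1 : Circle.exp (σ * N s) = Circle.exp (σ * N t) := hb.1.2 hzw
    have h2 : Circle.exp (N s) = Circle.exp (N t) := by
      rcases hσ with rfl | rfl
      · simpa using h1
      · simpa using h1
    obtain ⟨m, hm⟩ := Circle.exp_eq_exp.1 h2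
    rw [← apply_add_int_mul_two_pi hq] at hm
    exact Circle.exp_eq_exp.2 ⟨m, hNmono.injective hm⟩
  · rw [hlift]
    exact hb.2.1.comp (contDiff_const.mul hN)
  · have hNd := (hN.differentiable (by simp) t).hasDerivAt
    have hbd := (hb.2.1.differentiable (by simp) (σ * N t)).hasDerivAt
    have h : HasDerivAt (fun t => lift b (σ * N t)) ((σ * deriv N t) • deriv (lift b) (σ * N t)) t :=
      HasDerivAt.scomp (g₁ := lift b) (h := fun t => σ * N t) t hbd (hNd.const_mul σ)
    rw [hlift, h.deriv]
    exact smul_ne_zero (mul_ne_zero hσ0 (hN' t).ne') (hb.2.2 _)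

/-- Reparametrizing a primitive of the Liouville form. -/
theorem IsLiouvillePrimitive.comp {a b : Circle → ℂ} {F : ℝ → ℝ} (hF : IsLiouvillePrimitive b F)
    (hb : Differentiable ℝ (lift b)) {u : ℝ → ℝ} (hu : Differentiable ℝ u)
    (hab : ∀ t, lift a t = lift b (u t)) :
    IsLiouvillePrimitive a fun t => F (u t) - F (u 0) := by
  refine ⟨sub_self _, fun t => ?_⟩
  have hre : DifferentiableAt ℝ (fun s => (lift b s).re) (u t) :=
    Complex.reCLM.differentiableAt.comp _ (hb _)
  have h1 : HasDerivAt (fun s => (lift a s).re)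
      (deriv (fun s => (lift b s).re) (u t) * deriv u t) t := by
    simp only [hab]
    exact hre.hasDerivAt.comp t (hu t).hasDerivAt
  rw [h1.deriv, hab, ← mul_assoc]
  exact ((hF.2 (u t)).comp t (hu t).hasDerivAt).sub_const _

/-- The existence of a smooth approximation does not depend on the parametrization. -/
theorem IsSmoothApproximation.exists_of_range_eq {b : ℕ → Circle → ℂ} {c c' : Circle → ℂ}
    (h : IsSmoothApproximation b c) (hc : IsJordanCurve c) (hc' : IsJordanCurve c')
    (hr : range c' = range c) : ∃ a, IsSmoothApproximation a c' := by
  obtain ⟨hb, hbc, F, f, hF, hf, hFf⟩ := h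
  obtain ⟨σ, M, hσ, hM, hmono, hq, hl⟩ := hc'.exists_reparametrization hc hr
  have hσ1 : |σ| = 1 := by rcases hσ with rfl | rfl <;> norm_num
  choose N hN hN' hNq hNM using fun n : ℕ => exists_smooth_approximation_of_monotone hM
    hmono.monotone hq (Nat.one_div_pos_of_nat (α := ℝ) (n := n))
  have hNlim : TendstoUniformly (fun n t => σ * N n t) (fun t => σ * M t) atTop := by
    rw [Metric.tendstoUniformly_iff]
    intro ε hε
    filter_upwards [(tendsto_one_div_add_atTop_nhds_zero_nat (𝕜 := ℝ)).eventually_lt_const hε]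
      with n hn t
    rw [dist_comm, Real.dist_eq, ← mul_sub, abs_mul, hσ1, one_mul]
    exact (hNM n t).trans_lt hn
  choose a ha hal using fun n => (hb n).exists_reparametrization hσ (hN n) (hN' n) (hNq n)
  have hMσ : Continuous fun t => σ * M t := by fun_prop
  -- Composition moves the base point of the primitives, hence the subtraction of the value at `t =
  -- 0`, which itself converges.
  refine ⟨a, ha, ?_, fun n t => F n (σ * N n t) - F n (σ * N n 0),
    fun t => f (σ * M t) - f (σ * M 0), fun n => ?_, by fun_prop, fun K hK => ?_⟩
  · have hlc : Continuous (lift c) := hc.1.comp Circle.exp.continuous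
    have h1 := tendstoUniformlyOn_comp_real hlc (F := fun n => lift (b n))
      (fun K _ => (hbc.comp fun t : ℝ => Circle.exp t).tendstoUniformlyOn) hMσ
      (isCompact_Icc (a := 0) (b := 2 * Real.pi)) hNlim.tendstoUniformlyOn
    rw [Metric.tendstoUniformlyOn_iff] at h1
    rw [Metric.tendstoUniformly_iff]
    intro ε hε
    filter_upwards [h1 ε hε] with n hn z
    obtain ⟨t, rfl⟩ := Circle.exp_surjective z
    obtain ⟨m, hm⟩ := exists_int_add_mem_Icc t
    have h2 : Circle.exp (t + m * (2 * Real.pi)) = Circle.exp t :=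
      Circle.exp_eq_exp.2 ⟨m, rfl⟩
    have h3 := hn _ hm
    rw [← hl, ← hal, lift, lift, h2] at h3
    exact h3
  · exact (hF n).comp ((hb n).2.1.differentiable (by simp))
      (((hN n).differentiable (by simp)).const_mul σ) (hal n)
  · have h1 := tendstoUniformlyOn_comp_real hf hFf hMσ hK hNlim.tendstoUniformlyOn
    have h0 := (tendstoUniformlyOn_comp_real hf hFf hMσ (isCompact_singleton (x := (0 : ℝ)))
      hNlim.tendstoUniformlyOn).tendsto_at (mem_singleton 0)
    exact h1.fun_sub (h0.tendstoUniformlyOn_const K)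

end RectangularPeg

theorem mainTheorem8 (c : Circle → ℂ)
    (hc : RectangularPeg.IsJordanCurve c)
    (hrect : RectangularPeg.IsRectifiable c)
    (harea : volume (RectangularPeg.enclosedDomain c) = ENNReal.ofReal Real.pi) :
    (∃ φ : ℂ → ℂ,
      RectangularPeg.IsExtendedRiemannMap φ (RectangularPeg.enclosedDomain c) ∧
      Set.range (RectangularPeg.circleImage φ 1) = Set.range c ∧
      RectangularPeg.IsSmoothApproximation
        (fun n : ℕ => RectangularPeg.circleImage φ (1 - 1 / ((n : ℝ) + 2)))
        (RectangularPeg.circleImage φ 1) ∧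
      RectangularPeg.SatisfiesPegAssumptions (RectangularPeg.circleImage φ 1)) ∧
    RectangularPeg.SatisfiesPegAssumptions c := by
  -- Positive area supplies the bounded component, so the existence half of the Jordan curve theorem
  -- is not needed.
  have hne : (RectangularPeg.enclosedDomain c).Nonempty := by
    refine nonempty_of_measure_ne_zero (μ := volume) ?_
    rw [harea]
    exact (ENNReal.ofReal_pos.2 Real.pi_pos).ne'
  obtain ⟨φ, hφ, him⟩ := hc.exists_isExtendedRiemannMap hne
  have hrange : range (RectangularPeg.circleImage φ 1) = range c := by
    rw [RectangularPeg.range_circleImage_one, him]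
  have hφJ : RectangularPeg.IsJordanCurve (RectangularPeg.circleImage φ 1) :=
    hφ.isJordanCurve_circleImage ⟨one_pos, le_rfl⟩
  have happrox : RectangularPeg.IsSmoothApproximation
      (fun n : ℕ => RectangularPeg.circleImage φ (1 - 1 / ((n : ℝ) + 2)))
      (RectangularPeg.circleImage φ 1) := by
    have hr := RectangularPeg.one_sub_inv_mem_Ioo
    have hr' : ∀ n : ℕ, 1 - 1 / ((n : ℝ) + 2) ∈ Ico 0 1 := fun n => ⟨(hr n).1.le, (hr n).2⟩
    -- Finite variation is assumed for `c` only; equality of the images passes it to the boundary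
    -- values of `φ`.
    obtain ⟨f, hf, hFf⟩ := hφ.exists_tendstoUniformlyOn_liouville
      (hrect.eVariationOn_lt_top_of_range_eq hc hφJ hrange) hr RectangularPeg.tendsto_one_sub_inv
    refine ⟨fun n => hφ.isSmoothJordanCurve_circleImage (hr n),
      RectangularPeg.tendstoUniformly_circleImage hφ.1 (fun n => ⟨(hr n).1.le, (hr n).2.le⟩)
        RectangularPeg.tendsto_one_sub_inv, _, f, fun n => ?_, hf, hFf⟩
    exact RectangularPeg.isLiouvillePrimitive_of_hasDerivAt
      (RectangularPeg.hasDerivAt_lift_circleImage hφ.2.2.1 (hr' n))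
      (RectangularPeg.continuous_circleVelocity hφ.2.2.1 (hr' n))
  refine ⟨⟨φ, hφ, hrange, happrox, hφJ, ?_, _, happrox⟩, hc, harea,
    happrox.exists_of_range_eq hφJ hc hrange.symm⟩
  rw [RectangularPeg.enclosedDomain_congr hrange, harea]
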